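/- **Theorem.** Let $S=(-a,a)$ with $0<a<\infty$, or $S=\mathbb R$, and put $\Omega=\mathbb R\times S$. Let $W:S\to\mathbb R$ be measurable with $W(y)\ge c\,y^2$ for all $y\in S$, where $c\ge 0$, and $c>0$ if $S=\mathbb R$. Let $U\in L^\infty(\Omega)$ be real-valued and nonzero, with $\lim_{|x|\to\infty}\sup_{y\in S}|U(x,y)|=0$ (essential supremum), and let $B\in\mathbb R$. Consider the operator $$H_U(B)=(-i\partial_x-By)^2-\partial_y^2+W(y)+U(x,y)\quad\text{in } L^2(\Omega),$$ with Dirichlet boundary conditions at $y=\pm a$ if $S=(-a,a)$. It is the operator associated with the quadratic form $$\|(-i\partial_x-By)\psi\|^2+\|\partial_y\psi\|^2+\int_\Omega (W+U)|\psi|^2$$ on all $\psi\in L^2(\Omega)$ for which the weak derivatives $(-i\partial_x-By)\psi$ and $\partial_y\psi$ are in $L^2(\Omega)$, $\int_\Omega W|\psi|^2<\infty$, and $\psi=0$ at $y=\pm a$ if $S=(-a,a)$. For $p\in\mathbb R$ let $$h_B^W(p)=-\partial_y^2+(By-p)^2+W(y)\quad\text{in } L^2(S),$$ defined in the same way through its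 form (with Dirichlet conditions if $S=(-a,a)$), and let $\nu_1^B(p)$ be its lowest eigenvalue. Let $p_0$ be a point where $\nu_1^B$ attains its minimum over $\mathbb R$, let $\chi_1^B(p_0,\cdot)$ be a normalized eigenfunction of $h_B^W(p_0)$ for the eigenvalue $\nu_1^B(p_0)$, and put $$U_{1,1}(x;p_0)=\int_S U(x,y)\,|\chi_1^B(p_0,y)|^2\,dy .$$ If $$\int_{\mathbb R}U_{1,1}(x;p_0)\,dx<0,$$ where the integral is required to exist as a number in $[-\infty,\infty)$ (the positive part of $U_{1,1}(\cdot\,;p_0)$ is integrable; the value $-\infty$ is allowed), then the discrete spectrum of $H_U(B)$, i.e. the set of isolated points of its spectrum that are eigenvalues of finite multiplicity, is non-empty. -/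

import Mathlib

open MeasureTheory Set
open scoped ContDiff ENNReal ComplexConjugate

noncomputable section

namespace MagneticWire

/-! ### Spectral notions for unbounded operators

An unbounded operator in a Hilbert space is represented by its graph
`T = {(ψ, Tψ) : ψ ∈ dom T}`, a linear subspace of the product space. -/

section Spectrum

variable {E : Type*} [NormedAddCommGroup E] [InnerProductSpace ℂ E]

/-- The resolvent set of the operator with graph `T`: those `z` for which `T - z` is a bijection from
its domain onto the whole space with a bounded everywhere defined inverse `R`. -/
def resolventSet (T : Submodule ℂ (E × E)) : Set ℂ :=
  {z | ∃ R : E →L[ℂ] E, (∀ x y : E, (x, y) ∈ T → R (y - z • x) = x) ∧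
    ∀ f : E, (R f, f + z • R f) ∈ T}

/-- The spectrum of the operator with graph `T`. -/
def spectrum (T : Submodule ℂ (E × E)) : Set ℂ := (resolventSet T)ᶜ

/-- The eigenspace `{ψ ∈ dom T : Tψ = zψ}` of the operator with graph `T`. -/
def eigenspace (T : Submodule ℂ (E × E)) (z : ℂ) : Submodule ℂ E :=
  T.comap (LinearMap.id.prod (z • LinearMap.id))

/-- The discrete spectrum: isolated points of the spectrum that are eigenvalues of finite
multiplicity. -/
def discreteSpectrum (T : Submodule ℂ (E × E)) : Set ℂ :=
  {z | z ∈ spectrum T ∧ (∃ ε > 0, ∀ w ∈ spectrum T, dist w z < ε → w = z) ∧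
    eigenspace T z ≠ ⊥ ∧ FiniteDimensional ℂ (eigenspace T z)}

/-- The lowest eigenvalue (infimum of the set of real eigenvalues) of the operator with graph `T`. -/
def lowestEigenvalue (T : Submodule ℂ (E × E)) : ℝ :=
  sInf {t : ℝ | eigenspace T (t : ℂ) ≠ ⊥}

end Spectrum

/-! ### The sesquilinear form of a potential -/

section Potential

variable {X : Type*} [MeasurableSpace X] {μ : Measure X}

theorem integrable_potential {V : X → ℝ} {f g : X → ℂ}
    (hf : AEStronglyMeasurable f μ) (hg : AEStronglyMeasurable g μ)
    (hVf : Integrable (fun x => V x * ‖f x‖ ^ 2) μ)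
    (hVg : Integrable (fun x => V x * ‖g x‖ ^ 2) μ) :
    Integrable (fun x => (V x : ℂ) * (conj (f x) * g x)) μ := by
  have key : (fun x => (V x : ℂ) * (conj (f x) * g x)) =
      fun x => ((V x * ‖f x‖ ^ 2 : ℝ) : ℂ) * (g x / f x) := by
    funext x
    by_cases h : f x = 0
    · simp [h]
    · have h2 : ((‖f x‖ ^ 2 : ℝ) : ℂ) = conj (f x) * f x := by
        rw [← Complex.normSq_eq_norm_sq, Complex.normSq_eq_conj_mul_self]
      rw [Complex.ofReal_mul, h2]
      field_simp
  have hm : AEStronglyMeasurable (fun x => (V x : ℂ) * (conj (f x) * g x)) μ := by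
    rw [key]
    exact ((Complex.measurable_ofReal.comp_aemeasurable hVf.aemeasurable).mul
      (hg.aemeasurable.div hf.aemeasurable)).aestronglyMeasurable
  refine Integrable.mono' (hVf.norm.add hVg.norm) hm (Filter.Eventually.of_forall fun x => ?_)
  simp only [norm_mul, Complex.norm_real, RCLike.norm_conj, Pi.add_apply, norm_pow, norm_norm]
  have := norm_nonneg (V x)
  nlinarith [sq_nonneg (‖f x‖ - ‖g x‖), mul_nonneg this (sq_nonneg (‖f x‖ - ‖g x‖)),
    mul_nonneg this (sq_nonneg (‖f x‖)), mul_nonneg this (sq_nonneg (‖g x‖))]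

/-- `ψ` has finite potential energy: `∫ V |ψ|² < ∞`. -/
def HasFinitePotentialEnergy (μ : Measure X) (V : X → ℝ) (ψ : Lp ℂ 2 μ) : Prop :=
  Integrable (fun x => V x * ‖ψ x‖ ^ 2) μ

/-- The form `∫ V \bar φ ψ` of the potential `V`. -/
def potentialForm (μ : Measure X) (V : X → ℝ) (φ ψ : Lp ℂ 2 μ) : ℂ :=
  ∫ x, (V x : ℂ) * (conj (φ x) * ψ x) ∂μ

theorem HasFinitePotentialEnergy.integrable {V : X → ℝ} {φ ψ : Lp ℂ 2 μ}
    (hφ : HasFinitePotentialEnergy μ V φ) (hψ : HasFinitePotentialEnergy μ V ψ) :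
    Integrable (fun x => (V x : ℂ) * (conj (φ x) * ψ x)) μ :=
  integrable_potential (Lp.aestronglyMeasurable φ) (Lp.aestronglyMeasurable ψ) hφ hψ

theorem HasFinitePotentialEnergy.zero (V : X → ℝ) :
    HasFinitePotentialEnergy μ V (0 : Lp ℂ 2 μ) := by
  refine (integrable_zero X ℝ μ).congr ?_
  filter_upwards [Lp.coeFn_zero ℂ 2 μ] with x hx
  simp only [hx, Pi.zero_apply]
  simp

theorem HasFinitePotentialEnergy.smul {V : X → ℝ} {ψ : Lp ℂ 2 μ} (a : ℂ)
    (hψ : HasFinitePotentialEnergy μ V ψ) : HasFinitePotentialEnergy μ V (a • ψ) := by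
  refine (Integrable.const_mul hψ (‖a‖ ^ 2)).congr ?_
  filter_upwards [Lp.coeFn_smul a ψ] with x hx
  simp only [hx, Pi.smul_apply, norm_smul]
  ring

theorem HasFinitePotentialEnergy.add {V : X → ℝ} {φ ψ : Lp ℂ 2 μ}
    (hφ : HasFinitePotentialEnergy μ V φ) (hψ : HasFinitePotentialEnergy μ V ψ) :
    HasFinitePotentialEnergy μ V (φ + ψ) := by
  have h := (Integrable.add hφ hψ).add ((hφ.integrable hψ).re.const_mul 2)
  refine h.congr ?_
  filter_upwards [Lp.coeFn_add φ ψ] with x hx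
  simp only [hx, Pi.add_apply]
  rw [← Complex.normSq_eq_norm_sq (φ x + ψ x), Complex.normSq_apply,
    ← Complex.normSq_eq_norm_sq (φ x), Complex.normSq_apply,
    ← Complex.normSq_eq_norm_sq (ψ x), Complex.normSq_apply]
  simp
  ring

theorem potentialForm_zero (V : X → ℝ) (φ : Lp ℂ 2 μ) : potentialForm μ V φ 0 = 0 := by
  refine integral_eq_zero_of_ae ?_
  filter_upwards [Lp.coeFn_zero ℂ 2 μ] with x hx
  simp only [hx, Pi.zero_apply]
  simp

theorem potentialForm_smul (V : X → ℝ) (φ ψ : Lp ℂ 2 μ) (a : ℂ) :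
    potentialForm μ V φ (a • ψ) = a * potentialForm μ V φ ψ := by
  unfold potentialForm
  rw [← integral_const_mul]
  refine integral_congr_ae ?_
  filter_upwards [Lp.coeFn_smul a ψ] with x hx
  simp only [hx, Pi.smul_apply, smul_eq_mul]
  ring

theorem potentialForm_add {V : X → ℝ} {φ ψ₁ ψ₂ : Lp ℂ 2 μ}
    (hφ : HasFinitePotentialEnergy μ V φ) (h₁ : HasFinitePotentialEnergy μ V ψ₁)
    (h₂ : HasFinitePotentialEnergy μ V ψ₂) :
    potentialForm μ V φ (ψ₁ + ψ₂) = potentialForm μ V φ ψ₁ + potentialForm μ V φ ψ₂ := by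
  unfold potentialForm
  rw [← integral_add (hφ.integrable h₁) (hφ.integrable h₂)]
  refine integral_congr_ae ?_
  filter_upwards [Lp.coeFn_add ψ₁ ψ₂] with x hx
  simp only [hx, Pi.add_apply]
  ring

/-- Pairing of a continuous compactly supported function with `L²` functions is integrable. -/
theorem integrable_test [TopologicalSpace X] [OpensMeasurableSpace X]
    [IsFiniteMeasureOnCompacts μ] {g : X → ℂ} (hg : Continuous g)
    (hc : HasCompactSupport g) (ψ : Lp ℂ 2 μ) : Integrable (fun x => g x * ψ x) μ :=
  MemLp.integrable_mul (p := 2) (q := 2) (hg.memLp_of_hasCompactSupport hc) (Lp.memLp ψ)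

end Potential

/-! ### The transverse problem on `L²(S)` -/

/-- The Hilbert space `L²(S)`. -/
abbrev TransverseL2 (S : Set ℝ) : Type := Lp ℂ 2 (volume.restrict S)

/-- `v ∈ L²(S)` is the weak derivative of `ψ ∈ L²(S)`, with the Dirichlet condition at the boundary
of `S`. Since the test functions need not vanish on the boundary of `S`, this says that the
extension of `ψ` by zero belongs to `H¹(ℝ)`, that is, `ψ ∈ H¹₀(S)` and `v = ψ'`. -/
def HasDirichletDeriv (S : Set ℝ) (ψ v : TransverseL2 S) : Prop :=
  ∀ φ : ℝ → ℝ, ContDiff ℝ ∞ φ → HasCompactSupport φ →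
    ∫ y in S, (φ y : ℂ) * v y = -∫ y in S, ((deriv φ y : ℝ) : ℂ) * ψ y

/-- The pairs `(ψ, ψ')` with `ψ` in the form domain `{ψ ∈ H¹₀(S) : ∫ V |ψ|² < ∞}`. -/
def transverseFormDomain (S : Set ℝ) (V : ℝ → ℝ) : Set (TransverseL2 S × TransverseL2 S) :=
  {Ψ | HasDirichletDeriv S Ψ.1 Ψ.2 ∧ HasFinitePotentialEnergy (volume.restrict S) V Ψ.1}

/-- The form `(φ', ψ') + ∫ V \bar φ ψ`. -/
def transverseForm (S : Set ℝ) (V : ℝ → ℝ) (Φ Ψ : TransverseL2 S × TransverseL2 S) : ℂ :=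
  inner ℂ Φ.2 Ψ.2 + potentialForm (volume.restrict S) V Φ.1 Ψ.1

theorem HasDirichletDeriv.zero (S : Set ℝ) : HasDirichletDeriv S 0 0 := by
  intro φ _ _
  rw [integral_eq_zero_of_ae, integral_eq_zero_of_ae, neg_zero]
  all_goals
    filter_upwards [Lp.coeFn_zero ℂ 2 (volume.restrict S)] with x hx
    simp only [hx, Pi.zero_apply]
    simp

theorem HasDirichletDeriv.smul {S : Set ℝ} {ψ v : TransverseL2 S} (a : ℂ)
    (h : HasDirichletDeriv S ψ v) : HasDirichletDeriv S (a • ψ) (a • v) := by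
  intro φ h1 h2
  have e (k : ℝ → ℝ) (u : TransverseL2 S) :
      ∫ y in S, (k y : ℂ) * (a • u : TransverseL2 S) y = a * ∫ y in S, (k y : ℂ) * u y := by
    rw [← integral_const_mul]
    refine integral_congr_ae ?_
    filter_upwards [Lp.coeFn_smul a u] with x hx
    simp only [hx, Pi.smul_apply, smul_eq_mul]
    ring
  rw [e, e, h φ h1 h2]
  ring

theorem HasDirichletDeriv.add {S : Set ℝ} {ψ₁ v₁ ψ₂ v₂ : TransverseL2 S}
    (h₁ : HasDirichletDeriv S ψ₁ v₁) (h₂ : HasDirichletDeriv S ψ₂ v₂) :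
    HasDirichletDeriv S (ψ₁ + ψ₂) (v₁ + v₂) := by
  intro φ h1 h2
  have e (k : ℝ → ℝ) (hk : Continuous k) (hc : HasCompactSupport k) (u w : TransverseL2 S) :
      ∫ y in S, (k y : ℂ) * (u + w : TransverseL2 S) y =
        (∫ y in S, (k y : ℂ) * u y) + ∫ y in S, (k y : ℂ) * w y := by
    have hk' : Continuous fun y => (k y : ℂ) := Complex.continuous_ofReal.comp hk
    have hc' : HasCompactSupport fun y => (k y : ℂ) :=
      hc.comp_left (g := fun t : ℝ => (t : ℂ)) Complex.ofReal_zero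
    rw [← integral_add (integrable_test hk' hc' u) (integrable_test hk' hc' w)]
    refine integral_congr_ae ?_
    filter_upwards [Lp.coeFn_add u w] with x hx
    simp only [hx, Pi.add_apply]
    ring
  rw [e _ h1.continuous h2, e _ (h1.continuous_deriv (by simp)) h2.deriv, h₁ φ h1 h2, h₂ φ h1 h2]
  ring

/-- (The graph of) the self-adjoint operator `-d²/dy² + V(y)` in `L²(S)` with Dirichlet condition on
the boundary of `S`, for `V ≥ 0`: it is the operator associated with the form above, so `ψ` is in
its domain with image `f` if and only if `ψ` is in the form domain and `q(φ, ψ) = (φ, f)` for every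
`φ` in the form domain. -/
def transverseOperator (S : Set ℝ) (V : ℝ → ℝ) :
    Submodule ℂ (TransverseL2 S × TransverseL2 S) where
  carrier := {p | ∃ v, (p.1, v) ∈ transverseFormDomain S V ∧
    ∀ Φ ∈ transverseFormDomain S V, transverseForm S V Φ (p.1, v) = inner ℂ Φ.1 p.2}
  zero_mem' := by
    refine ⟨0, ⟨HasDirichletDeriv.zero S, HasFinitePotentialEnergy.zero V⟩, fun Φ _ => ?_⟩
    simp [transverseForm, potentialForm_zero]
  add_mem' := by
    rintro p₁ p₂ ⟨v₁, ⟨hd₁, he₁⟩, h₁⟩ ⟨v₂, ⟨hd₂, he₂⟩, h₂⟩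
    refine ⟨v₁ + v₂, ⟨hd₁.add hd₂, he₁.add he₂⟩, fun Φ hΦ => ?_⟩
    have a₁ := h₁ Φ hΦ
    have a₂ := h₂ Φ hΦ
    simp only [transverseForm] at a₁ a₂
    simp only [transverseForm, Prod.fst_add, Prod.snd_add, inner_add_right,
      potentialForm_add hΦ.2 he₁ he₂, ← a₁, ← a₂]
    ring
  smul_mem' := by
    rintro a p ⟨v, ⟨hd, he⟩, h⟩
    refine ⟨a • v, ⟨hd.smul a, he.smul a⟩, fun Φ hΦ => ?_⟩
    have h' := h Φ hΦ
    simp only [transverseForm] at h'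
    simp only [transverseForm, Prod.smul_fst, Prod.smul_snd, inner_smul_right,
      potentialForm_smul, ← h']
    ring

/-- The fibre operator `h_B^W(p) = -d²/dy² + (By - p)² + W(y)` in `L²(S)`. -/
def fibreOperator (S : Set ℝ) (W : ℝ → ℝ) (B p : ℝ) :
    Submodule ℂ (TransverseL2 S × TransverseL2 S) :=
  transverseOperator S fun y => (B * y - p) ^ 2 + W y

/-- The lowest eigenvalue `ν₁^B(p)` of the fibre operator `h_B^W(p)`. -/
def fibreEigenvalue (S : Set ℝ) (W : ℝ → ℝ) (B p : ℝ) : ℝ :=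
  lowestEigenvalue (fibreOperator S W B p)

/-! ### The magnetic Hamiltonian on `L²(ℝ × S)` -/

/-- Lebesgue measure on the strip `Ω = ℝ × S`. -/
abbrev stripMeasure (S : Set ℝ) : Measure (ℝ × ℝ) := volume.restrict (univ ×ˢ S)

/-- The Hilbert space `L²(Ω)`, `Ω = ℝ × S`. -/
abbrev StripL2 (S : Set ℝ) : Type := Lp ℂ 2 (stripMeasure S)

/-- `v = (-i∂ₓ - By)ψ` in the weak sense. -/
def HasMagneticDeriv (S : Set ℝ) (B : ℝ) (ψ v : StripL2 S) : Prop :=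
  ∀ φ : ℝ × ℝ → ℝ, ContDiff ℝ ∞ φ → HasCompactSupport φ →
    ∫ z, (φ z : ℂ) * v z ∂stripMeasure S =
      ∫ z, (Complex.I * ((fderiv ℝ φ z (1, 0) : ℝ) : ℂ) - (B * z.2 * φ z : ℂ)) * ψ z ∂stripMeasure S

/-- `w = ∂_y ψ` in the weak sense, with the Dirichlet condition at the boundary of the strip
`Ω = ℝ × S` (the test functions need not vanish there, so that this says that the extension of
`ψ` by zero has a square integrable weak `y`-derivative on the plane). -/
def HasTransverseDeriv (S : Set ℝ) (ψ w : StripL2 S) : Prop :=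
  ∀ φ : ℝ × ℝ → ℝ, ContDiff ℝ ∞ φ → HasCompactSupport φ →
    ∫ z, (φ z : ℂ) * w z ∂stripMeasure S = -∫ z, ((fderiv ℝ φ z (0, 1) : ℝ) : ℂ) * ψ z ∂stripMeasure S

/-- The triples `(ψ, (-i∂ₓ - By)ψ, ∂_y ψ)` with `ψ` in the form domain: both weak derivatives are
square integrable, `ψ` vanishes on the boundary of the strip, and `∫ P |ψ|² < ∞`. -/
def stripFormDomain (S : Set ℝ) (B : ℝ) (P : ℝ × ℝ → ℝ) :
    Set (StripL2 S × StripL2 S × StripL2 S) :=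
  {Ψ | HasMagneticDeriv S B Ψ.1 Ψ.2.1 ∧ HasTransverseDeriv S Ψ.1 Ψ.2.2 ∧
    HasFinitePotentialEnergy (stripMeasure S) P Ψ.1}

/-- The form `((-i∂ₓ - By)φ, (-i∂ₓ - By)ψ) + (∂_y φ, ∂_y ψ) + ∫ P \bar φ ψ`. -/
def stripForm (S : Set ℝ) (P : ℝ × ℝ → ℝ) (Φ Ψ : StripL2 S × StripL2 S × StripL2 S) : ℂ :=
  inner ℂ Φ.2.1 Ψ.2.1 + inner ℂ Φ.2.2 Ψ.2.2 + potentialForm (stripMeasure S) P Φ.1 Ψ.1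

theorem integral_test_zero (S : Set ℝ) (k : ℝ × ℝ → ℂ) :
    ∫ z, k z * (0 : StripL2 S) z ∂stripMeasure S = 0 := by
  refine integral_eq_zero_of_ae ?_
  filter_upwards [Lp.coeFn_zero ℂ 2 (stripMeasure S)] with x hx
  simp only [hx, Pi.zero_apply]
  simp

theorem integral_test_smul (S : Set ℝ) (k : ℝ × ℝ → ℂ) (a : ℂ) (u : StripL2 S) :
    ∫ z, k z * (a • u : StripL2 S) z ∂stripMeasure S = a * ∫ z, k z * u z ∂stripMeasure S := by
  rw [← integral_const_mul]
  refine integral_congr_ae ?_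
  filter_upwards [Lp.coeFn_smul a u] with x hx
  simp only [hx, Pi.smul_apply, smul_eq_mul]
  ring

theorem integral_test_add (S : Set ℝ) {k : ℝ × ℝ → ℂ} (hk : Continuous k)
    (hc : HasCompactSupport k) (u w : StripL2 S) :
    ∫ z, k z * (u + w : StripL2 S) z ∂stripMeasure S =
      (∫ z, k z * u z ∂stripMeasure S) + ∫ z, k z * w z ∂stripMeasure S := by
  rw [← integral_add (integrable_test hk hc u) (integrable_test hk hc w)]
  refine integral_congr_ae ?_
  filter_upwards [Lp.coeFn_add u w] with x hx
  simp only [hx, Pi.add_apply]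
  ring

theorem test_ofReal {φ : ℝ × ℝ → ℝ} (h : Continuous φ) (hc : HasCompactSupport φ) :
    Continuous (fun z => (φ z : ℂ)) ∧ HasCompactSupport (fun z => (φ z : ℂ)) :=
  ⟨Complex.continuous_ofReal.comp h,
    hc.comp_left (g := fun t : ℝ => (t : ℂ)) Complex.ofReal_zero⟩

theorem test_fderiv {φ : ℝ × ℝ → ℝ} (h : ContDiff ℝ ∞ φ) (hc : HasCompactSupport φ) (e : ℝ × ℝ) :
    Continuous (fun z => ((fderiv ℝ φ z e : ℝ) : ℂ)) ∧
      HasCompactSupport (fun z => ((fderiv ℝ φ z e : ℝ) : ℂ)) :=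
  test_ofReal ((h.continuous_fderiv (by simp)).clm_apply continuous_const) (hc.fderiv_apply ℝ e)

theorem HasMagneticDeriv.add {S : Set ℝ} {B : ℝ} {ψ₁ v₁ ψ₂ v₂ : StripL2 S}
    (h₁ : HasMagneticDeriv S B ψ₁ v₁) (h₂ : HasMagneticDeriv S B ψ₂ v₂) :
    HasMagneticDeriv S B (ψ₁ + ψ₂) (v₁ + v₂) := by
  intro φ h1 h2
  obtain ⟨c0, s0⟩ := test_ofReal h1.continuous h2
  obtain ⟨c1, s1⟩ := test_fderiv h1 h2 (1, 0)
  have c2 : Continuous fun z : ℝ × ℝ =>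
      Complex.I * ((fderiv ℝ φ z (1, 0) : ℝ) : ℂ) - (B * z.2 * φ z : ℂ) := by fun_prop
  have s2 : HasCompactSupport fun z : ℝ × ℝ =>
      Complex.I * ((fderiv ℝ φ z (1, 0) : ℝ) : ℂ) - (B * z.2 * φ z : ℂ) :=
    (s1.mul_left (f := fun _ => Complex.I)).sub (s0.mul_left (f := fun z : ℝ × ℝ => (B * z.2 : ℂ)))
  rw [integral_test_add S c0 s0, integral_test_add S c2 s2, h₁ φ h1 h2, h₂ φ h1 h2]

theorem HasTransverseDeriv.add {S : Set ℝ} {ψ₁ v₁ ψ₂ v₂ : StripL2 S}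
    (h₁ : HasTransverseDeriv S ψ₁ v₁) (h₂ : HasTransverseDeriv S ψ₂ v₂) :
    HasTransverseDeriv S (ψ₁ + ψ₂) (v₁ + v₂) := by
  intro φ h1 h2
  obtain ⟨c0, s0⟩ := test_ofReal h1.continuous h2
  obtain ⟨c1, s1⟩ := test_fderiv h1 h2 (0, 1)
  rw [integral_test_add S c0 s0, integral_test_add S c1 s1, h₁ φ h1 h2, h₂ φ h1 h2]
  ring

/-- (The graph of) the self-adjoint operator `(-i∂ₓ - By)² - ∂_y² + P(x,y)` in `L²(ℝ × S)` with
Dirichlet condition on the boundary of the strip, for `P` bounded below: it is the operator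
associated with the form above, so `ψ` is in its domain with image `f` if and only if `ψ` is in the
form domain and `q(φ, ψ) = (φ, f)` for every `φ` in the form domain. -/
def stripOperator (S : Set ℝ) (B : ℝ) (P : ℝ × ℝ → ℝ) : Submodule ℂ (StripL2 S × StripL2 S) where
  carrier := {p | ∃ v w, (p.1, v, w) ∈ stripFormDomain S B P ∧
    ∀ Φ ∈ stripFormDomain S B P, stripForm S P Φ (p.1, v, w) = inner ℂ Φ.1 p.2}
  zero_mem' := by
    refine ⟨0, 0, ⟨fun φ _ _ => ?_, fun φ _ _ => ?_, HasFinitePotentialEnergy.zero P⟩,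
      fun Φ _ => ?_⟩
    · exact (integral_test_zero S _).trans (integral_test_zero S _).symm
    · exact (integral_test_zero S _).trans (by rw [Prod.fst_zero, integral_test_zero, neg_zero])
    · simp [stripForm, potentialForm_zero]
  add_mem' := by
    rintro p₁ p₂ ⟨v₁, w₁, ⟨hv₁, hw₁, he₁⟩, h₁⟩ ⟨v₂, w₂, ⟨hv₂, hw₂, he₂⟩, h₂⟩
    refine ⟨v₁ + v₂, w₁ + w₂, ⟨hv₁.add hv₂, hw₁.add hw₂, he₁.add he₂⟩, fun Φ hΦ => ?_⟩
    have a₁ := h₁ Φ hΦ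
    have a₂ := h₂ Φ hΦ
    simp only [stripForm] at a₁ a₂
    simp only [stripForm, Prod.fst_add, Prod.snd_add, inner_add_right,
      potentialForm_add hΦ.2.2 he₁ he₂, ← a₁, ← a₂]
    ring
  smul_mem' := by
    rintro a p ⟨v, w, ⟨hv, hw, he⟩, h⟩
    refine ⟨a • v, a • w, ⟨fun φ h1 h2 => ?_, fun φ h1 h2 => ?_, he.smul a⟩, fun Φ hΦ => ?_⟩
    · simp only [Prod.smul_fst, integral_test_smul]
      rw [hv φ h1 h2]
    · simp only [Prod.smul_fst, integral_test_smul]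
      rw [hw φ h1 h2]
      ring
    · have h' := h Φ hΦ
      simp only [stripForm] at h'
      simp only [stripForm, Prod.smul_fst, Prod.smul_snd, inner_smul_right,
        potentialForm_smul, ← h']
      ring

/-- The Hamiltonian `H_U(B) = (-i∂ₓ - By)² - ∂_y² + W(y) + U(x,y)` in `L²(ℝ × S)`. -/
def hamiltonian (S : Set ℝ) (W : ℝ → ℝ) (U : ℝ × ℝ → ℝ) (B : ℝ) :
    Submodule ℂ (StripL2 S × StripL2 S) :=
  stripOperator S B fun z => W z.2 + U z

/-- The projected potential `U_{1,1}(x) = ∫_S U(x,y) |χ(y)|² dy`. -/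
def projectedPotential (S : Set ℝ) (U : ℝ × ℝ → ℝ) (χ : TransverseL2 S) (x : ℝ) : ℝ :=
  ∫ y in S, U (x, y) * ‖χ y‖ ^ 2

/-- `∫ f < 0`: the integral of the positive part is smaller than that of the negative part. So the
integral of `f` exists in `[-∞, ∞)` and is negative (possibly `-∞`); for integrable `f` this
is `∫ f < 0` in the ordinary sense. -/
def HasNegativeIntegral (f : ℝ → ℝ) : Prop :=
  ∫⁻ x, ENNReal.ofReal (f x) < ∫⁻ x, ENNReal.ofReal (-f x)

end MagneticWire

end

/-! Let `e` be the minimum of the fibre eigenvalue, attained at `p₀`. The free form has no spectrum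
below `e`, since after a Fourier decomposition in `x` every fibre form is at least `e`. A
perturbation that decays in `x` can add only discrete spectrum below `e`. So it is enough to find
one state with energy below `e`.

The state is `e^{ip₀x} η(x) χ(y)`, where `η` is a cutoff of scale `n`. Its energy minus `e` times
its squared norm is `∫ η'² + ∫ η² U₁₁`. The first term is `O(1/n)`. By Fatou's lemma the second
stays below a fixed negative number, also when `∫ U₁₁ = -∞` (`exists_integral_cutoff_le_neg`,
`exists_product_state`, `exists_state_below_threshold`).

Essential spectrum is never named; its place is taken by lower bounds of a form on subspaces of
finite codimension. Let `J` embed the form domain, with the shifted form as inner product, into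
`L²`. Then `J J*` is the resolvent `(T + C)⁻¹`. A lower bound `m` for the form on finite codimension
bounds this resolvent by `(m + C)⁻¹` there, and a state below `m` makes its norm larger. The norm is
then an isolated eigenvalue of finite multiplicity (`exists_discrete_ground_state`,
`exists_discrete_ground_state_of_form`).

The lower bound for every `m < e` (`exists_finite_perturbed_lower_bound`) has two ingredients. One
is the free bound `e` (`strip_form_lower_bound`). The other is that, on finite codimension, the mass
in a bounded range of `x` is at most a small multiple of the energy
(`exists_finite_local_compactness`). Both use Fourier series in `x` of cut-off functions
(`cutoff_form_lower_bound`). For local compactness the high frequencies are controlled by the growth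
of the fibre potential in `p`, and each of the finitely many low ones by a Rellich-type estimate in
`y` (`exists_finite_transverse_lower_bound`). That estimate and the abstract theorem also show that
the infimum of the eigenvalues of a fibre operator bounds its form from below
(`lowestEigenvalue_mul_le`). -/

noncomputable section

namespace MagneticWire

open Filter Topology

/-! ### Discrete eigenvalues of a self-adjoint operator through its resolvent -/

section AbstractSpectral

/-- The hypothesis `hT` says that `R` is `(T + C)⁻¹`. If `x = R f`, then `(T - w) x = f - (w + C) R
f`, so `(T - w)⁻¹ = (1 - (w + C) R)⁻¹ R`. -/
theorem mem_resolventSet_of_isUnit {E : Type*} [NormedAddCommGroup E] [InnerProductSpace ℂ E]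
    {T : Submodule ℂ (E × E)} {R : E →L[ℂ] E} {C : ℂ}
    (hT : ∀ x y, (x, y) ∈ T ↔ R (y + C • x) = x) {w : ℂ}
    (hw : IsUnit (1 - (w + C) • R)) : w ∈ resolventSet T := by
  obtain ⟨A, hA⟩ := hw
  have hl : ∀ x, (↑A⁻¹ : E →L[ℂ] E) (x - (w + C) • R x) = x := by
    intro x
    have h1 : (↑A⁻¹ : E →L[ℂ] E) ((A : E →L[ℂ] E) x) = x := by
      rw [← mul_apply_eq_comp, Units.inv_mul]; rfl
    rw [hA] at h1
    simpa using h1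
  have hr : ∀ x, (↑A⁻¹ : E →L[ℂ] E) x - (w + C) • R ((↑A⁻¹ : E →L[ℂ] E) x) = x := by
    intro x
    have h1 : (A : E →L[ℂ] E) ((↑A⁻¹ : E →L[ℂ] E) x) = x := by
      rw [← mul_apply_eq_comp, Units.mul_inv]; rfl
    rw [hA] at h1
    simpa using h1
  refine ⟨(↑A⁻¹ : E →L[ℂ] E) * R, fun x y hxy => ?_, fun f => ?_⟩
  · rw [hT] at hxy
    rw [mul_apply_eq_comp]
    conv_rhs => rw [← hl x]
    congr 1
    conv_rhs => enter [1]; rw [← hxy]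
    rw [← map_smul, ← map_sub]
    congr 1
    module
  · rw [hT, mul_apply_eq_comp]
    have h1 := hr (R f)
    have h2 : f + w • (↑A⁻¹ : E →L[ℂ] E) (R f) + C • (↑A⁻¹ : E →L[ℂ] E) (R f) =
      f + (w + C) • (↑A⁻¹ : E →L[ℂ] E) (R f) := by module
    rw [h2, map_add, map_smul]
    nth_rewrite 1 [← h1]
    module

variable {E : Type*} [NormedAddCommGroup E] [InnerProductSpace ℂ E] [CompleteSpace E]

/-- Approximate eigenvectors of an operator for a value outside its essential norm have a convergent
subsequence, whose limit is an eigenvector. -/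
theorem exists_subseq_tendsto_eigenvector (R : E →L[ℂ] E) (N : Submodule ℂ E)
    [FiniteDimensional ℂ N] {ρ : ℝ} (hN : ∀ f ∈ Nᗮ, ‖R f‖ ≤ ρ * ‖f‖) {z : ℂ} (hz : ρ < ‖z‖)
    (f : ℕ → E) (hf : ∀ n, ‖f n‖ = 1) (hlim : Tendsto (fun n => R (f n) - z • f n) atTop (𝓝 0)) :
    ∃ (g : E) (φ : ℕ → ℕ), StrictMono φ ∧ Tendsto (f ∘ φ) atTop (𝓝 g) ∧ ‖g‖ = 1 ∧
      R g = z • g := by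
  have : ProperSpace N := FiniteDimensional.proper ℂ N
  -- The components in `N` have a convergent subsequence by compactness. Those in `Nᗮ` will be
  -- Cauchy along it, because `R - z` is bounded below on `Nᗮ` by `‖z‖ - ρ`.
  obtain ⟨p, -, φ, hφ, hp⟩ := (isCompact_closedBall (0 : N) 1).tendsto_subseq
    (x := fun n => N.orthogonalProjectionOnto (f n)) (fun n => by
      rw [mem_closedBall_zero_iff]
      calc ‖N.orthogonalProjectionOnto (f n)‖ ≤ ‖f n‖ := N.norm_orthogonalProjectionOnto_apply_le _
        _ = 1 := hf n)
  have hp' : Tendsto (fun n => ((N.orthogonalProjectionOnto (f (φ n)) : N) : E)) atTop (𝓝 (p : E)) :=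
    (continuous_subtype_val.tendsto p).comp hp
  set A : E →L[ℂ] E := R - z • ContinuousLinearMap.id ℂ E with hA
  have hAapp : ∀ x, A x = R x - z • x := fun x => by simp [hA]
  set h : ℕ → E := fun n => f (φ n) - (N.orthogonalProjectionOnto (f (φ n)) : N) with hh
  have hmem : ∀ n, h n ∈ Nᗮ := fun n => N.sub_starProjection_mem_orthogonal _
  have hAh : Tendsto (fun n => A (h n)) atTop (𝓝 (0 - A p)) := by
    have h1 : Tendsto (fun n => A (f (φ n))) atTop (𝓝 0) := by
      simpa only [hAapp] using! hlim.comp hφ.tendsto_atTop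
    have h2 := h1.sub ((A.continuous.tendsto _).comp hp')
    refine h2.congr fun n => ?_
    simp [hh]
  have hanti : ∀ n m, (‖z‖ - ρ) * ‖h n - h m‖ ≤ ‖A (h n) - A (h m)‖ := by
    intro n m
    have hm : h n - h m ∈ Nᗮ := Nᗮ.sub_mem (hmem n) (hmem m)
    rw [← map_sub, hAapp]
    have h1 := hN _ hm
    have h2 := norm_sub_norm_le (z • (h n - h m)) (R (h n - h m))
    rw [norm_smul, norm_sub_rev (z • _)] at h2
    linarith
  have hcau : CauchySeq h := by
    have hc := hAh.cauchySeq
    rw [Metric.cauchySeq_iff] at hc ⊢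
    intro ε hε
    obtain ⟨n0, hn0⟩ := hc ((‖z‖ - ρ) * ε) (mul_pos (by linarith) hε)
    refine ⟨n0, fun m hm n hn => ?_⟩
    have h1 := hn0 m hm n hn
    rw [dist_eq_norm] at h1 ⊢
    exact lt_of_mul_lt_mul_left ((hanti m n).trans_lt h1) (by linarith)
  obtain ⟨h0, hh0⟩ := cauchySeq_tendsto_of_complete hcau
  have hlimf : Tendsto (f ∘ φ) atTop (𝓝 (h0 + p)) := by
    refine (hh0.add hp').congr fun n => ?_
    simp [hh]
  refine ⟨h0 + p, φ, hφ, hlimf, ?_, ?_⟩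
  · refine tendsto_nhds_unique hlimf.norm ?_
    simp [hf]
  · have h1 : Tendsto (fun n => A (f (φ n))) atTop (𝓝 0) := by
      simpa only [hAapp] using! hlim.comp hφ.tendsto_atTop
    have h2 := tendsto_nhds_unique ((A.continuous.tendsto _).comp hlimf) h1
    rw [hAapp] at h2
    exact sub_eq_zero.mp h2

/-- A real point of the spectrum of a self-adjoint operator has approximate eigenvectors. -/
theorem exists_approximate_eigenvector {R : E →L[ℂ] E} (hR : IsSelfAdjoint R) {t : ℝ}
    (ht : (t : ℂ) ∈ _root_.spectrum ℂ R) {ε : ℝ} (hε : 0 < ε) :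
    ∃ f : E, ‖f‖ = 1 ∧ ‖R f - (t : ℂ) • f‖ < ε := by
  by_contra! hcon
  apply ht
  set A : E →L[ℂ] E := (algebraMap ℂ (E →L[ℂ] E) t) - R with hA
  have hAapp : ∀ x, A x = (t : ℂ) • x - R x := fun x => by simp [hA, Algebra.algebraMap_eq_smul_one]
  -- Without approximate eigenvectors `A` is bounded below. Since `A` is self-adjoint, the
  -- orthogonal complement of its range is its kernel, which is zero; hence `A` is invertible.
  have hlow : ∀ x, ‖x‖ ≤ ε⁻¹ * ‖A x‖ := by
    intro x
    by_cases hx : x = 0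
    · simp [hx]
    have hx' : 0 < ‖x‖ := norm_pos_iff.mpr hx
    have h1 := hcon ((‖x‖⁻¹ : ℂ) • x) (by
      rw [norm_smul]; simp [hx])
    rw [map_smul, smul_comm, ← smul_sub, norm_smul, norm_sub_rev, ← hAapp] at h1
    simp only [norm_inv, Complex.norm_real, norm_norm] at h1
    rw [inv_mul_eq_div, le_div_iff₀ hx'] at h1
    rw [inv_mul_eq_div, le_div_iff₀ hε]
    linarith
  have hanti : AntilipschitzWith (Real.toNNReal ε⁻¹) A := by
    refine A.antilipschitz_of_bound fun x => ?_
    rw [Real.coe_toNNReal _ (inv_nonneg.mpr hε.le)]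
    exact hlow x
  have hsa : IsSelfAdjoint A := by
    refine IsSelfAdjoint.sub ?_ hR
    rw [IsSelfAdjoint, ← algebraMap_star_comm]
    simp
  have hdense : A.range.topologicalClosure = ⊤ := by
    rw [Submodule.topologicalClosure_eq_top_iff, ContinuousLinearMap.orthogonal_range, hsa.adjoint_eq]
    refine (Submodule.eq_bot_iff _).mpr fun x hx => ?_
    have h1 : A x = 0 := hx
    have h2 := hlow x
    rw [h1, norm_zero, mul_zero] at h2
    simpa using h2
  show IsUnit A
  rw [ContinuousLinearMap.isUnit_iff_bijective]
  rw [ContinuousLinearMap.bijective_iff_dense_range_and_antilipschitz]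
  exact ⟨hdense, _, hanti⟩

/-- A point of the spectrum of a self-adjoint operator above its essential norm is an isolated
eigenvalue. -/
theorem spectrum_above_essential_norm {R : E →L[ℂ] E} (hR : IsSelfAdjoint R) (N : Submodule ℂ E)
    [FiniteDimensional ℂ N] {ρ : ℝ} (hN : ∀ f ∈ Nᗮ, ‖R f‖ ≤ ρ * ‖f‖) {t : ℝ}
    (ht : (t : ℂ) ∈ _root_.spectrum ℂ R) (hρt : ρ < t) :
    (∃ x : E, x ≠ 0 ∧ R x = (t : ℂ) • x) ∧
      ∃ ε > 0, ∀ w ∈ _root_.spectrum ℂ R, dist w (t : ℂ) < ε → w = t := by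
  have hz : ρ < ‖(t : ℂ)‖ := by
    rw [Complex.norm_real]; exact hρt.trans_le (le_abs_self t)
  constructor
  · choose f hf hlim using fun n : ℕ =>
      exists_approximate_eigenvector hR ht (ε := 1 / ((n : ℝ) + 1)) (by positivity)
    have hlim' : Tendsto (fun n => R (f n) - (t : ℂ) • f n) atTop (𝓝 0) :=
      squeeze_zero_norm (fun n => (hlim n).le) tendsto_one_div_add_atTop_nhds_zero_nat
    obtain ⟨g, -, -, -, hg1, hg⟩ := exists_subseq_tendsto_eigenvector R N hN hz f hf hlim'
    exact ⟨g, norm_ne_zero_iff.mp (by rw [hg1]; simp), hg⟩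
  · by_contra! hcon
    -- The entry `t - ρ` keeps the nearby spectral points `w n` above `ρ` in norm, so that they too
    -- are eigenvalues.
    have hpos : ∀ n : ℕ, 0 < min (1 / ((n : ℝ) + 1)) (t - ρ) := fun n =>
      lt_min (by positivity) (by linarith)
    choose w hw hdist hne using fun n : ℕ => hcon _ (hpos n)
    have hwr : ∀ n, w n = ((w n).re : ℂ) := fun n => hR.mem_spectrum_eq_re (hw n)
    have hd1 : ∀ n : ℕ, ‖w n - t‖ ≤ 1 / ((n : ℝ) + 1) := fun n => by
      rw [← dist_eq_norm]; exact (hdist n).le.trans (min_le_left _ _)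
    have hd2 : ∀ n : ℕ, ρ < ‖w n‖ := fun n => by
      have h1 := (hdist n).trans_le (min_le_right _ _)
      rw [dist_eq_norm, norm_sub_rev] at h1
      have h2 := norm_sub_norm_le (t : ℂ) (w n)
      have h3 : t ≤ ‖(t : ℂ)‖ := by rw [Complex.norm_real]; exact le_abs_self t
      linarith
    have heig : ∀ n, ∃ f : E, ‖f‖ = 1 ∧ R f = w n • f := by
      intro n
      choose f hf hlim using fun k : ℕ =>
        exists_approximate_eigenvector hR (t := (w n).re) (by rw [← hwr]; exact hw n)
          (ε := 1 / ((k : ℝ) + 1)) (by positivity)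
      have hlim' : Tendsto (fun k => R (f k) - w n • f k) atTop (𝓝 0) :=
        squeeze_zero_norm (fun k => by rw [hwr n]; exact (hlim k).le)
          tendsto_one_div_add_atTop_nhds_zero_nat
      obtain ⟨g, -, -, -, hg1, hg⟩ := exists_subseq_tendsto_eigenvector R N hN (hd2 n) f hf hlim'
      exact ⟨g, hg1, hg⟩
    choose f hf hRf using heig
    have hlim' : Tendsto (fun n => R (f n) - (t : ℂ) • f n) atTop (𝓝 0) := by
      refine squeeze_zero_norm (fun n => ?_) tendsto_one_div_add_atTop_nhds_zero_nat
      rw [hRf, ← sub_smul, norm_smul, hf, mul_one]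
      exact hd1 n
    obtain ⟨g, φ, -, hφ, hg1, hg⟩ := exists_subseq_tendsto_eigenvector R N hN hz f hf hlim'
    -- Eigenvectors for distinct eigenvalues are orthogonal, so `g` is orthogonal to the sequence
    -- whose subsequence converges to it. This contradicts `‖g‖ = 1`.
    have horth : ∀ n, inner ℂ (f n) g = 0 := by
      intro n
      have h1 : inner ℂ (R (f n)) g = inner ℂ (f n) (R g) := hR.isSymmetric (f n) g
      rw [hRf, hg, inner_smul_left, inner_smul_right, hwr n, Complex.conj_ofReal, ← hwr n] at h1
      have h2 : (w n - t) * inner ℂ (f n) g = 0 := by rw [sub_mul, h1, sub_self]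
      exact (mul_eq_zero.mp h2).resolve_left (sub_ne_zero.mpr (hne n))
    have h0 : Tendsto (fun n => inner ℂ ((f ∘ φ) n) g) atTop (𝓝 (inner ℂ g g)) :=
      hφ.inner tendsto_const_nhds
    simp only [Function.comp_apply, horth] at h0
    have h1 := tendsto_nhds_unique h0 tendsto_const_nhds
    rw [inner_self_eq_zero] at h1
    rw [h1, norm_zero] at hg1
    exact zero_ne_one hg1

variable {K : Type*} [NormedAddCommGroup K] [InnerProductSpace ℂ K] [CompleteSpace K]

/-- If a semibounded closed form lies above `m` on a subspace of finite codimension and takes a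
value below `m`, then the infimum of the form is a discrete eigenvalue of its operator. -/
theorem exists_discrete_ground_state (J : K →L[ℂ] E) {T : Submodule ℂ (E × E)} {C : ℝ}
    (hT : ∀ x y, (x, y) ∈ T ↔ (J ∘L J.adjoint) (y + (C : ℂ) • x) = x)
    {m : ℝ} (hmC : 0 < m + C) (G : Set E) (hG : G.Finite)
    (hess : ∀ k : K, (∀ g ∈ G, inner ℂ g (J k) = 0) → (m + C) * ‖J k‖ ^ 2 ≤ ‖k‖ ^ 2)
    (k₀ : K) (hk₀ : ‖k₀‖ ^ 2 < (m + C) * ‖J k₀‖ ^ 2) :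
    ∃ t : ℝ, (t : ℂ) ∈ discreteSpectrum T ∧ ∀ k : K, (t + C) * ‖J k‖ ^ 2 ≤ ‖k‖ ^ 2 := by
  -- By `hT` this is `(T + C)⁻¹`. Its norm `μ = ‖J‖²` is the best constant in `‖J k‖² ≤ μ ‖k‖²`, so
  -- `μ⁻¹ - C` is the infimum of the Rayleigh quotient.
  set R : E →L[ℂ] E := J ∘L J.adjoint with hRdef
  have hRpos : R.IsPositive := ContinuousLinearMap.isPositive_self_comp_adjoint J
  have hR : IsSelfAdjoint R := hRpos.isSelfAdjoint
  have hnorm : ‖R‖ = ‖J‖ * ‖J‖ := by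
    have := ContinuousLinearMap.norm_adjoint_comp_self J.adjoint
    simpa [hRdef] using this
  set μ := ‖R‖ with hμ
  set ρ : ℝ := (m + C)⁻¹ with hρ
  have hρpos : 0 < ρ := inv_pos.mpr hmC
  have hJ0 : 0 < ‖J k₀‖ ^ 2 := by
    by_contra hcon
    have h1 : ‖J k₀‖ ^ 2 = 0 := le_antisymm (not_lt.mp hcon) (sq_nonneg _)
    rw [h1, mul_zero] at hk₀
    exact absurd hk₀ (not_lt.mpr (sq_nonneg _))
  have hJle : ∀ k, ‖J k‖ ^ 2 ≤ μ * ‖k‖ ^ 2 := by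
    intro k
    rw [hnorm]
    have := J.le_opNorm k
    calc ‖J k‖ ^ 2 ≤ (‖J‖ * ‖k‖) ^ 2 := by gcongr
      _ = _ := by ring
  have hρμ : ρ < μ := by
    have h1 := hJle k₀
    have hμ0 : 0 ≤ μ := norm_nonneg _
    have h3 : μ ≠ 0 := by
      intro h; rw [h, zero_mul] at h1; linarith
    have h4 : 0 < μ := lt_of_le_of_ne hμ0 (Ne.symm h3)
    have h2 : ‖J k₀‖ ^ 2 < μ * ((m + C) * ‖J k₀‖ ^ 2) :=
      h1.trans_lt (by gcongr)
    rw [hρ, inv_lt_iff_one_lt_mul₀ hmC]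
    have h5 : 1 * ‖J k₀‖ ^ 2 < (μ * (m + C)) * ‖J k₀‖ ^ 2 := by linarith
    exact lt_of_mul_lt_mul_right h5 hJ0.le
  have hμpos : 0 < μ := hρpos.trans hρμ
  -- With this choice `f ∈ Nᗮ` makes `R f` orthogonal to `G`, so `hess` applies to `J* f`; together
  -- with `‖J* f‖² = (f, R f)` it gives `‖R f‖ ≤ ρ ‖f‖`.
  set N : Submodule ℂ E := Submodule.span ℂ (R '' G) with hNdef
  have hNfin : FiniteDimensional ℂ N := FiniteDimensional.span_of_finite ℂ (hG.image R)
  have hN : ∀ f ∈ Nᗮ, ‖R f‖ ≤ ρ * ‖f‖ := by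
    intro f hf
    have h1 : ∀ g ∈ G, inner ℂ g (J (J.adjoint f)) = 0 := by
      intro g hg
      have h2 : inner ℂ (R g) f = 0 :=
        (Submodule.mem_orthogonal _ _).mp hf _ (Submodule.subset_span ⟨g, hg, rfl⟩)
      have h3 : inner ℂ (R g) f = inner ℂ g (R f) := hR.isSymmetric g f
      rw [h3] at h2
      exact h2
    have h2 := hess _ h1
    have h3 : ‖J.adjoint f‖ ^ 2 ≤ ‖R f‖ * ‖f‖ := by
      have h4 : (‖J.adjoint f‖ : ℂ) ^ 2 = inner ℂ f (R f) := by
        have := inner_self_eq_norm_sq_to_K (𝕜 := ℂ) (J.adjoint f)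
        rw [ContinuousLinearMap.adjoint_inner_left] at this
        exact_mod_cast this.symm
      have h5 := norm_inner_le_norm (𝕜 := ℂ) f (R f)
      rw [← h4] at h5
      simp only [norm_pow, Complex.norm_real, norm_norm] at h5
      linarith
    have h4 : (m + C) * ‖R f‖ ^ 2 ≤ ‖R f‖ * ‖f‖ := h2.trans h3
    by_cases h5 : ‖R f‖ = 0
    · rw [h5]; positivity
    have h6 : 0 < ‖R f‖ := lt_of_le_of_ne (norm_nonneg _) (Ne.symm h5)
    rw [hρ, inv_mul_eq_div, le_div_iff₀ hmC]
    have h7 : ‖R f‖ * (‖R f‖ * (m + C)) ≤ ‖R f‖ * ‖f‖ := by linarith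
    exact le_of_mul_le_mul_left h7 h6
  have hspec : (μ : ℂ) ∈ _root_.spectrum ℂ R := by
    have : Nontrivial (E →L[ℂ] E) := ⟨R, 0, norm_ne_zero_iff.mp hμpos.ne'⟩
    have h1 := CStarAlgebra.norm_mem_spectrum_of_nonneg (A := E →L[ℂ] E) (a := R)
      ((ContinuousLinearMap.nonneg_iff_isPositive R).mpr hRpos)
    have := (spectrum.algebraMap_mem_iff ℂ (R := ℝ) (a := R) (r := μ)).mpr h1
    simpa using this
  obtain ⟨⟨x, hx0, hx⟩, ε, hε, hiso⟩ := spectrum_above_essential_norm hR N hN hspec hρμ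
  have hμC : (μ : ℂ) ≠ 0 := by exact_mod_cast hμpos.ne'
  have hsC : ((μ⁻¹ - C : ℝ) : ℂ) + C = (μ : ℂ)⁻¹ := by push_cast; ring
  have heig : ∀ y, y ∈ eigenspace T ((μ⁻¹ - C : ℝ) : ℂ) ↔ R y = (μ : ℂ) • y := by
    intro y
    have h1 : y ∈ eigenspace T ((μ⁻¹ - C : ℝ) : ℂ) ↔ (y, ((μ⁻¹ - C : ℝ) : ℂ) • y) ∈ T := by
      simp [eigenspace]
    rw [h1, hT, ← add_smul, hsC, map_smul]
    rw [inv_smul_eq_iff₀ hμC]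
  refine ⟨μ⁻¹ - C, ⟨?_, ?_, ?_, ?_⟩, ?_⟩
  · rintro ⟨S, hS, -⟩
    apply hx0
    have h1 := (heig x).mpr hx
    have h2 := hS x _ (show (x, ((μ⁻¹ - C : ℝ) : ℂ) • x) ∈ T from by simpa [eigenspace] using h1)
    rw [← h2, sub_self, map_zero]
  -- Isolation passes from `R` to `T` along `w ↦ (w + C)⁻¹`. The point `w = -C`, which this map does
  -- not reach properly, is in the resolvent set because `1 - (w + C) R = 1` there.
  · have hcont : ContinuousAt (fun w : ℂ => (w + C)⁻¹) ((μ⁻¹ - C : ℝ) : ℂ) := by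
      refine ContinuousAt.inv₀ (by fun_prop) ?_
      rw [hsC]; exact inv_ne_zero hμC
    rw [Metric.continuousAt_iff] at hcont
    obtain ⟨δ, hδ, hδ'⟩ := hcont ε hε
    refine ⟨δ, hδ, fun w hw hwd => ?_⟩
    have h1 := hδ' hwd
    rw [hsC, inv_inv] at h1
    have h2 : (w + C)⁻¹ ∈ _root_.spectrum ℂ R := by
      by_contra hcon
      apply hw
      apply mem_resolventSet_of_isUnit hT
      by_cases hs : w + C = 0
      · rw [hs, zero_smul, sub_zero]; exact isUnit_one
      have h3 : IsUnit (algebraMap ℂ (E →L[ℂ] E) (w + C)⁻¹ - R) := by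
        simpa [_root_.spectrum.notMem_iff] using hcon
      have h4 : 1 - (w + (C : ℂ)) • R =
          algebraMap ℂ (E →L[ℂ] E) (w + C) * (algebraMap ℂ (E →L[ℂ] E) (w + C)⁻¹ - R) := by
        rw [mul_sub, ← map_mul, mul_inv_cancel₀ hs, map_one, Algebra.smul_def]
      rw [h4]
      exact ((IsUnit.mk0 _ hs).map (algebraMap ℂ (E →L[ℂ] E))).mul h3
    have h3 := hiso _ h2 h1
    have h4 : w + C = (μ : ℂ)⁻¹ := by rw [← h3, inv_inv]
    rw [← hsC] at h4
    exact add_right_cancel h4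
  · intro h
    have h1 := (heig x).mpr hx
    rw [h] at h1
    exact hx0 ((Submodule.mem_bot ℂ).mp h1)
  -- The projection to `N` is injective on the eigenspace: an eigenvector in `Nᗮ` would give `μ ≤
  -- ρ`.
  · let L : eigenspace T ((μ⁻¹ - C : ℝ) : ℂ) →ₗ[ℂ] N :=
      (N.orthogonalProjectionOnto : E →ₗ[ℂ] N) ∘ₗ (eigenspace T ((μ⁻¹ - C : ℝ) : ℂ)).subtype
    refine Module.Finite.of_injective L ?_
    rw [← LinearMap.ker_eq_bot, LinearMap.ker_eq_bot']
    rintro ⟨y, hy⟩ hLy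
    have h1 : y ∈ Nᗮ := by
      rw [← Submodule.orthogonalProjectionOnto_eq_zero_iff]
      exact hLy
    have h2 := hN y h1
    rw [(heig y).mp hy, norm_smul, Complex.norm_real, Real.norm_of_nonneg hμpos.le] at h2
    have h3 : ‖y‖ = 0 := by
      by_contra h4
      have h5 : 0 < ‖y‖ := lt_of_le_of_ne (norm_nonneg _) (Ne.symm h4)
      exact absurd (le_of_mul_le_mul_right h2 h5) (not_le.mpr hρμ)
    exact Subtype.ext (norm_eq_zero.mp h3)
  · intro k
    have h1 := hJle k
    rw [sub_add_cancel, inv_mul_eq_div, div_le_iff₀ hμpos]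
    linarith

end AbstractSpectral

/-! ### From a closed graph with a potential to the abstract setting -/

section Forms

variable {X : Type*} [MeasurableSpace X] {μ : Measure X}

/-- Multiplication by a bounded function as an operator on `L²`. -/
def mulOperator {r : X → ℂ} (hr : MemLp r ∞ μ) : Lp ℂ 2 μ →L[ℂ] Lp ℂ 2 μ :=
  (ContinuousLinearMap.mul ℂ ℂ).holderL μ ∞ 2 2 hr.toLp

theorem coeFn_mulOperator {r : X → ℂ} (hr : MemLp r ∞ μ) (f : Lp ℂ 2 μ) :
    mulOperator hr f =ᵐ[μ] fun x => r x * f x := by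
  have h := (ContinuousLinearMap.mul ℂ ℂ).coeFn_holder (r := 2) hr.toLp f
  filter_upwards [h, hr.coeFn_toLp] with x h1 h2
  simp only [ContinuousLinearMap.mul_apply', h2] at h1
  exact h1

theorem inner_self_eq_ofReal {H : Type*} [NormedAddCommGroup H] [InnerProductSpace ℂ H] (x : H) :
    inner ℂ x x = ((‖x‖ ^ 2 : ℝ) : ℂ) := by
  rw [inner_self_eq_norm_sq_to_K]; push_cast; rfl

theorem norm_sq_eq_integral (f : Lp ℂ 2 μ) : ‖f‖ ^ 2 = ∫ x, ‖f x‖ ^ 2 ∂μ := by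
  have h := inner_self_eq_ofReal f
  rw [L2.inner_def] at h
  simp only [inner_self_eq_ofReal] at h
  rw [integral_complex_ofReal] at h
  exact_mod_cast h.symm

theorem inner_eq_integral (f g : Lp ℂ 2 μ) : inner ℂ f g = ∫ x, conj (f x) * g x ∂μ := by
  rw [L2.inner_def]
  refine integral_congr_ae (Eventually.of_forall fun x => ?_)
  simp only [RCLike.inner_apply]
  ring

theorem integrable_norm_sq (f : Lp ℂ 2 μ) : Integrable (fun x => ‖f x‖ ^ 2) μ :=
  (memLp_two_iff_integrable_sq_norm (Lp.aestronglyMeasurable f)).mp (Lp.memLp f)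

theorem integrable_conj_mul (f g : Lp ℂ 2 μ) : Integrable (fun x => conj (f x) * g x) μ := by
  refine (L2.integrable_inner f g).congr (Eventually.of_forall fun x => ?_)
  simp only [RCLike.inner_apply]
  ring

theorem potentialForm_self (V : X → ℝ) (ψ : Lp ℂ 2 μ) :
    potentialForm μ V ψ ψ = ((∫ x, V x * ‖ψ x‖ ^ 2 ∂μ : ℝ) : ℂ) := by
  rw [← integral_complex_ofReal]
  refine integral_congr_ae (Eventually.of_forall fun x => ?_)
  simp only [Complex.conj_mul']
  push_cast
  ring

/-- For a form `‖v‖² + ∫ P |ψ|²` on a closed graph `D ∋ (ψ, v)` that lies above `m` on a subspace of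
finite codimension and takes a value below `m`, the infimum is a discrete eigenvalue of the
associated operator. -/
theorem exists_discrete_ground_state_of_form {F : Type*} [NormedAddCommGroup F]
    [InnerProductSpace ℂ F] [CompleteSpace F] (D : Submodule ℂ (Lp ℂ 2 μ × F))
    (hD : IsClosed (D : Set (Lp ℂ 2 μ × F))) {P : X → ℝ} (hP : AEMeasurable P μ) {C : ℝ}
    (hPC : ∀ᵐ x ∂μ, 1 ≤ P x + C) {T : Submodule ℂ (Lp ℂ 2 μ × Lp ℂ 2 μ)}
    (hT : ∀ x y, (x, y) ∈ T ↔ ∃ v, ((x, v) ∈ D ∧ HasFinitePotentialEnergy μ P x) ∧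
      ∀ φ u, (φ, u) ∈ D → HasFinitePotentialEnergy μ P φ →
        inner ℂ u v + potentialForm μ P φ x = inner ℂ φ y)
    {m : ℝ} (G : Set (Lp ℂ 2 μ)) (hG : G.Finite)
    (hess : ∀ ψ v, (ψ, v) ∈ D → HasFinitePotentialEnergy μ P ψ → (∀ g ∈ G, inner ℂ g ψ = 0) →
      m * ‖ψ‖ ^ 2 ≤ ‖v‖ ^ 2 + ∫ x, P x * ‖ψ x‖ ^ 2 ∂μ)
    {ψ₀ : Lp ℂ 2 μ} {v₀ : F} (h₀ : (ψ₀, v₀) ∈ D) (hf₀ : HasFinitePotentialEnergy μ P ψ₀)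
    (hlt : ‖v₀‖ ^ 2 + ∫ x, P x * ‖ψ₀ x‖ ^ 2 ∂μ < m * ‖ψ₀‖ ^ 2) :
    ∃ t : ℝ, (t : ℂ) ∈ discreteSpectrum T ∧ ∀ ψ v, (ψ, v) ∈ D →
      HasFinitePotentialEnergy μ P ψ → t * ‖ψ‖ ^ 2 ≤ ‖v‖ ^ 2 + ∫ x, P x * ‖ψ x‖ ^ 2 ∂μ := by
  have hsm : AEMeasurable (fun x => Real.sqrt (P x + C)) μ := (hP.add_const C).sqrt
  have hr : MemLp (fun x => (((Real.sqrt (P x + C))⁻¹ : ℝ) : ℂ)) ∞ μ := by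
    refine memLp_top_of_bound
      (Complex.measurable_ofReal.comp_aemeasurable hsm.inv).aestronglyMeasurable 1 ?_
    filter_upwards [hPC] with x hx
    rw [Complex.norm_real, Real.norm_of_nonneg (by positivity)]
    exact inv_le_one_of_one_le₀ (Real.one_le_sqrt.mpr hx)
  -- Writing `ψ = M w` with `w = (P + C)^{1/2} ψ` turns the potential part of the shifted form into
  -- `‖w‖²`. The form domain becomes the space of pairs `(v, w)` with `(M w, v) ∈ D`. It is closed
  -- in a Hilbert space, hence complete.
  set M := mulOperator hr with hM
  have hMc := coeFn_mulOperator hr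
  have hr2 : ∀ᵐ x ∂μ, (P x + C) * ((Real.sqrt (P x + C))⁻¹ * (Real.sqrt (P x + C))⁻¹) = 1 := by
    filter_upwards [hPC] with x hx
    rw [← mul_inv, Real.mul_self_sqrt (by linarith), mul_inv_cancel₀ (by linarith)]
  have hMfin : ∀ w, HasFinitePotentialEnergy μ P (M w) := by
    intro w
    refine ((integrable_norm_sq w).sub ((integrable_norm_sq (M w)).const_mul C)).congr ?_
    filter_upwards [hMc w, hr2] with x h1 h2
    simp only [Pi.sub_apply]
    rw [hM, h1, norm_mul, Complex.norm_real, mul_pow, Real.norm_eq_abs, sq_abs]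
    linear_combination (-‖w x‖ ^ 2) * h2
  have hMsurj : ∀ ψ, HasFinitePotentialEnergy μ P ψ → ∃ w, M w = ψ := by
    intro ψ hψ
    have hmem : MemLp (fun x => ((Real.sqrt (P x + C) : ℝ) : ℂ) * ψ x) 2 μ := by
      rw [memLp_two_iff_integrable_sq_norm]
      · refine (Integrable.add hψ ((integrable_norm_sq ψ).const_mul C)).congr ?_
        filter_upwards [hPC] with x hx
        simp only [Pi.add_apply]
        rw [norm_mul, Complex.norm_real, mul_pow, Real.norm_eq_abs, sq_abs,
          Real.sq_sqrt (by linarith)]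
        ring
      · exact (Complex.measurable_ofReal.comp_aemeasurable hsm).aestronglyMeasurable.mul
          (Lp.aestronglyMeasurable ψ)
    refine ⟨hmem.toLp, Lp.ext ?_⟩
    filter_upwards [hMc hmem.toLp, hmem.coeFn_toLp, hPC] with x h1 h2 h3
    rw [hM, h1, h2, ← mul_assoc, ← Complex.ofReal_mul, inv_mul_cancel₀, Complex.ofReal_one, one_mul]
    exact (Real.sqrt_pos.mpr (by linarith)).ne'
  have hMform : ∀ w₁ w₂, potentialForm μ P (M w₁) (M w₂) + C * inner ℂ (M w₁) (M w₂) =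
      inner ℂ w₁ w₂ := by
    intro w₁ w₂
    rw [inner_eq_integral, inner_eq_integral, potentialForm, ← integral_const_mul, ← integral_add]
    · refine integral_congr_ae ?_
      filter_upwards [hMc w₁, hMc w₂, hr2] with x h1 h2 h3
      rw [hM, h1, h2, map_mul, Complex.conj_ofReal]
      have h4 : ((P x : ℂ) + C) * ((((Real.sqrt (P x + C))⁻¹ : ℝ) : ℂ) *
        (((Real.sqrt (P x + C))⁻¹ : ℝ) : ℂ)) = 1 := by exact_mod_cast h3
      linear_combination (conj (w₁ x) * w₂ x) * h4
    · exact (hMfin w₁).integrable (hMfin w₂)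
    · exact (integrable_conj_mul _ _).const_mul _
  let L : WithLp 2 (F × Lp ℂ 2 μ) →L[ℂ] Lp ℂ 2 μ × F :=
    (M ∘L WithLp.sndL 2 ℂ F (Lp ℂ 2 μ)).prod (WithLp.fstL 2 ℂ F (Lp ℂ 2 μ))
  let K : Submodule ℂ (WithLp 2 (F × Lp ℂ 2 μ)) := D.comap (L : _ →ₗ[ℂ] _)
  have hKmem : ∀ k, k ∈ K ↔ (M k.snd, k.fst) ∈ D := fun k => Iff.rfl
  have hKclosed : IsClosed (K : Set (WithLp 2 (F × Lp ℂ 2 μ))) := hD.preimage L.continuous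
  have : CompleteSpace K := hKclosed.completeSpace_coe
  let J : K →L[ℂ] Lp ℂ 2 μ := (M ∘L WithLp.sndL 2 ℂ F (Lp ℂ 2 μ)) ∘L K.subtypeL
  have hJ : ∀ k : K, J k = M k.1.snd := fun k => rfl
  have hinner : ∀ k' k : K, inner ℂ k' k = inner ℂ k'.1.fst k.1.fst +
      potentialForm μ P (J k') (J k) + C * inner ℂ (J k') (J k) := by
    intro k' k
    rw [hJ, hJ, add_assoc, hMform, Submodule.coe_inner, WithLp.prod_inner_apply]
    rfl
  have hnorm : ∀ k : K, ‖k‖ ^ 2 = ‖k.1.fst‖ ^ 2 + (∫ x, P x * ‖(J k) x‖ ^ 2 ∂μ) + C * ‖J k‖ ^ 2 := by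
    intro k
    have h := hinner k k
    rw [potentialForm_self, inner_self_eq_ofReal k.1.fst, inner_self_eq_ofReal (J k)] at h
    exact_mod_cast (inner_self_eq_ofReal k).symm.trans h
  have hlift : ∀ ψ v, (ψ, v) ∈ D → HasFinitePotentialEnergy μ P ψ →
      ∃ k : K, J k = ψ ∧ k.1.fst = v := by
    intro ψ v hψ hf
    obtain ⟨w, hw⟩ := hMsurj ψ hf
    exact ⟨⟨WithLp.toLp 2 (v, w), by rw [hKmem]; simpa [hw] using hψ⟩, hw, rfl⟩
  -- The weak equation for `x`, with `C` times the inner product added on both sides, reads `(k', k)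
  -- = (J k', y + C x)` for all `k'`, that is, `k = J* (y + C x)`.
  have hTR : ∀ x y, (x, y) ∈ T ↔ (J ∘L J.adjoint) (y + (C : ℂ) • x) = x := by
    intro x y
    rw [hT]
    constructor
    · rintro ⟨v, ⟨hv, hfx⟩, hall⟩
      obtain ⟨k, hk, hkv⟩ := hlift x v hv hfx
      have hkJ : k = J.adjoint (y + (C : ℂ) • x) := by
        refine ext_inner_left ℂ fun k' => ?_
        rw [ContinuousLinearMap.adjoint_inner_right, hinner, hkv, hk,
          hall (J k') k'.1.fst k'.2 (hMfin _), inner_add_right, inner_smul_right]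
      rw [ContinuousLinearMap.comp_apply, ← hkJ, hk]
    · intro h
      set k := J.adjoint (y + (C : ℂ) • x) with hk
      have hkx : J k = x := h
      refine ⟨k.1.fst, ⟨hkx ▸ k.2, hkx ▸ hMfin _⟩, fun φ u hφ hf => ?_⟩
      obtain ⟨k', hk', hku⟩ := hlift φ u hφ hf
      have h1 : inner ℂ k' k = inner ℂ (J k') (y + (C : ℂ) • x) :=
        ContinuousLinearMap.adjoint_inner_right _ _ _
      rw [hinner, hku, hk', hkx, inner_add_right, inner_smul_right] at h1
      exact add_right_cancel h1
  obtain ⟨k₀, hk₀, hkv₀⟩ := hlift ψ₀ v₀ h₀ hf₀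
  have hk₀lt : ‖k₀‖ ^ 2 < (m + C) * ‖J k₀‖ ^ 2 := by
    rw [hnorm, hk₀, hkv₀]; linarith
  have hmC : 0 < m + C := by
    by_contra hcon
    have h1 : (m + C) * ‖J k₀‖ ^ 2 ≤ 0 := mul_nonpos_of_nonpos_of_nonneg (not_lt.mp hcon) (sq_nonneg _)
    linarith [sq_nonneg ‖k₀‖]
  obtain ⟨t, ht, hmin⟩ := exists_discrete_ground_state J hTR hmC G hG (fun k hk => by
    have h1 := hess (J k) k.1.fst k.2 (hMfin _) hk
    rw [hnorm]; linarith) k₀ hk₀lt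
  refine ⟨t, ht, fun ψ v hψ hf => ?_⟩
  obtain ⟨k, hk, hkv⟩ := hlift ψ v hψ hf
  have h1 := hmin k
  rw [hnorm, hk, hkv] at h1
  linarith

end Forms

/-! ### Plane waves and Parseval's identity on a period -/

section Parseval

/-- The plane wave `e^{ipx}`. -/
def planeWave (p x : ℝ) : ℂ := Complex.exp (((p * x : ℝ) : ℂ) * Complex.I)

theorem norm_planeWave (p x : ℝ) : ‖planeWave p x‖ = 1 := Complex.norm_exp_ofReal_mul_I _

theorem contDiff_planeWave (p : ℝ) : ContDiff ℝ ∞ (planeWave p) := by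
  unfold planeWave
  exact ((Complex.ofRealCLM.contDiff.comp (contDiff_const.mul contDiff_id)).mul
    contDiff_const).cexp

theorem continuous_planeWave (p : ℝ) : Continuous (planeWave p) := (contDiff_planeWave p).continuous

theorem hasDerivAt_planeWave (p x : ℝ) :
    HasDerivAt (planeWave p) (p * Complex.I * planeWave p x) x := by
  have h1 : HasDerivAt (fun x : ℝ => ((p * x : ℝ) : ℂ) * Complex.I) (p * Complex.I) x := by
    have h2 : HasDerivAt (fun x : ℝ => p * x) p x := by
      simpa using (hasDerivAt_id x).const_mul p
    exact (h2.ofReal_comp).mul_const _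
  have := h1.cexp
  rw [mul_comm] at this
  exact this

/-- The `k`-th frequency of period `L`. -/
def frequency (L : ℝ) (k : ℤ) : ℝ := 2 * Real.pi * k / L

theorem fourier_eq_planeWave (L : ℝ) (k : ℤ) (x : ℝ) :
    fourier k (x : AddCircle L) = planeWave (frequency L k) x := by
  rw [fourier_coe_apply, planeWave, frequency]
  congr 1
  push_cast
  ring

/-- Parseval's identity for a function supported in an interval of length `L`. -/
theorem hasSum_sq_fourier {L : ℝ} (hL : 0 < L) {f : ℝ → ℂ} (hf : MemLp f 2 volume)
    (hsupp : ∀ x, x ∉ Ioc (-(L / 2)) (L / 2) → f x = 0) :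
    HasSum (fun k : ℤ => ‖∫ x, planeWave (-frequency L k) x * f x‖ ^ 2) (L * ∫ x, ‖f x‖ ^ 2) := by
  have hab : -(L / 2) < L / 2 := by linarith
  have h := (hasSum_sq_fourierCoeffOn hab (hf.restrict _)).mul_left (L ^ 2)
  have hlen : L / 2 - -(L / 2) = L := by ring
  have key : ∀ g : ℝ → ℂ, (∀ x, x ∉ Ioc (-(L / 2)) (L / 2) → g x = 0) →
      ∫ x in (-(L / 2))..(L / 2), g x = ∫ x, g x := by
    intro g hg
    rw [intervalIntegral.integral_of_le hab.le]
    exact setIntegral_eq_integral_of_forall_compl_eq_zero hg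
  have key' : ∫ x in (-(L / 2))..(L / 2), ‖f x‖ ^ 2 = ∫ x, ‖f x‖ ^ 2 := by
    rw [intervalIntegral.integral_of_le hab.le]
    exact setIntegral_eq_integral_of_forall_compl_eq_zero fun x hx => by simp [hsupp x hx]
  have hfun : (fun k : ℤ => ‖∫ x, planeWave (-frequency L k) x * f x‖ ^ 2) =
      fun k => L ^ 2 * ‖fourierCoeffOn hab f k‖ ^ 2 := by
    funext k
    rw [fourierCoeffOn_eq_integral]
    have h1 : ∀ x : ℝ, fourier (-k) (x : AddCircle (L / 2 - -(L / 2))) =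
        planeWave (-frequency L k) x := by
      intro x
      rw [fourier_eq_planeWave, hlen]
      congr 1
      simp only [frequency]
      push_cast
      ring
    simp only [h1, smul_eq_mul]
    rw [key _ fun x hx => by simp [hsupp x hx], hlen, norm_smul, mul_pow, Real.norm_eq_abs, sq_abs]
    field_simp
  have hval : L * ∫ x, ‖f x‖ ^ 2 =
      L ^ 2 * (L / 2 - -(L / 2))⁻¹ • ∫ x in (-(L / 2))..(L / 2), ‖f x‖ ^ 2 := by
    rw [key', hlen, smul_eq_mul]
    field_simp
  rw [hfun, hval]
  exact h

/-- The version in `ℝ≥0∞` allows the sum over frequencies to be exchanged with integrals over `y`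
with no summability to check. -/
theorem lintegral_sq_fourier {L : ℝ} (hL : 0 < L) {f : ℝ → ℂ} (hf : MemLp f 2 volume)
    (hsupp : ∀ x, x ∉ Ioc (-(L / 2)) (L / 2) → f x = 0) :
    ∑' k : ℤ, ‖∫ x, planeWave (-frequency L k) x * f x‖ₑ ^ 2 =
      ENNReal.ofReal L * ∫⁻ x, ‖f x‖ₑ ^ 2 := by
  have h := hasSum_sq_fourier hL hf hsupp
  have h1 : ∀ k : ℤ, ‖∫ x, planeWave (-frequency L k) x * f x‖ₑ ^ 2 =
      ENNReal.ofReal (‖∫ x, planeWave (-frequency L k) x * f x‖ ^ 2) := fun k => by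
    rw [ENNReal.ofReal_pow (norm_nonneg _), ofReal_norm]
  have h2 : ∫⁻ x, ‖f x‖ₑ ^ 2 = ENNReal.ofReal (∫ x, ‖f x‖ ^ 2) := by
    rw [ofReal_integral_eq_lintegral_ofReal
      ((memLp_two_iff_integrable_sq_norm hf.1).mp hf) (Eventually.of_forall fun x => sq_nonneg _)]
    refine lintegral_congr fun x => ?_
    rw [ENNReal.ofReal_pow (norm_nonneg _), ofReal_norm]
  simp only [h1]
  rw [h2, ← ENNReal.ofReal_mul hL.le, ← h.tsum_eq,
    ENNReal.ofReal_tsum_of_nonneg (fun _ => sq_nonneg _) h.summable]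

end Parseval

/-! ### Pairings with test functions -/

section Test

variable {X : Type*} [MeasurableSpace X] {μ : Measure X}

theorem integrable_mul_of_memLp {k : X → ℂ} (hk : MemLp k 2 μ) (ψ : Lp ℂ 2 μ) :
    Integrable (fun x => k x * ψ x) μ :=
  MemLp.integrable_mul (p := 2) (q := 2) hk (Lp.memLp ψ)

theorem memLp_conj {k : X → ℂ} {p : ℝ≥0∞} (hk : MemLp k p μ) : MemLp (fun x => conj (k x)) p μ :=
  hk.star

theorem inner_conj_toLp {k : X → ℂ} (hk : MemLp k 2 μ) (ψ : Lp ℂ 2 μ) :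
    inner ℂ (memLp_conj hk).toLp ψ = ∫ x, k x * ψ x ∂μ := by
  rw [inner_eq_integral]
  refine integral_congr_ae ?_
  filter_upwards [(memLp_conj hk).coeFn_toLp] with x hx
  rw [hx, Complex.conj_conj]

theorem continuous_integral_mul {k : X → ℂ} (hk : MemLp k 2 μ) :
    Continuous fun ψ : Lp ℂ 2 μ => ∫ x, k x * ψ x ∂μ := by
  simp only [← inner_conj_toLp hk]
  exact continuous_const.inner continuous_id

theorem integral_complex_split [TopologicalSpace X] [OpensMeasurableSpace X] [IsFiniteMeasureOnCompacts μ] {k : X → ℂ}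
    (hk : Continuous k) (hkc : HasCompactSupport k) (u : Lp ℂ 2 μ) :
    ∫ x, k x * u x ∂μ = (∫ x, ((k x).re : ℂ) * u x ∂μ) +
      Complex.I * ∫ x, ((k x).im : ℂ) * u x ∂μ := by
  rw [← integral_const_mul, ← integral_add]
  · refine integral_congr_ae (Eventually.of_forall fun x => ?_)
    have h1 := Complex.re_add_im (k x)
    simp only
    linear_combination (-u x) * h1
  · exact integrable_test (Complex.continuous_ofReal.comp (Complex.continuous_re.comp hk))
      (hkc.comp_left (g := fun z : ℂ => (z.re : ℂ)) (by simp)) u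
  · exact (integrable_test (Complex.continuous_ofReal.comp (Complex.continuous_im.comp hk))
      (hkc.comp_left (g := fun z : ℂ => (z.im : ℂ)) (by simp)) u).const_mul _

/-- Weak derivatives are defined by real test functions, whereas Fourier coefficients need plane
waves times a cutoff. Real and imaginary parts are tested separately. -/
theorem HasDirichletDeriv.complex_test {S : Set ℝ} {ψ v : TransverseL2 S}
    (h : HasDirichletDeriv S ψ v) {g : ℝ → ℂ} (hg : ContDiff ℝ ∞ g) (hc : HasCompactSupport g) :
    ∫ y in S, g y * v y = -∫ y in S, deriv g y * ψ y := by
  have hre : ContDiff ℝ ∞ fun y => (g y).re := Complex.reCLM.contDiff.comp hg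
  have him : ContDiff ℝ ∞ fun y => (g y).im := Complex.imCLM.contDiff.comp hg
  have hcre : HasCompactSupport fun y => (g y).re := hc.comp_left (g := Complex.re) rfl
  have hcim : HasCompactSupport fun y => (g y).im := hc.comp_left (g := Complex.im) rfl
  have hd : ∀ y, HasDerivAt g (deriv g y) y := fun y =>
    (hg.differentiable (by simp) y).hasDerivAt
  have hdre : ∀ y, deriv (fun y => (g y).re) y = (deriv g y).re := fun y =>
    (Complex.reCLM.hasFDerivAt.comp_hasDerivAt y (hd y)).deriv
  have hdim : ∀ y, deriv (fun y => (g y).im) y = (deriv g y).im := fun y =>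
    (Complex.imCLM.hasFDerivAt.comp_hasDerivAt y (hd y)).deriv
  have h1 := h _ hre hcre
  have h2 := h _ him hcim
  simp only [hdre, hdim] at h1 h2
  rw [integral_complex_split hg.continuous hc,
    integral_complex_split (hg.continuous_deriv (by simp)) hc.deriv, h1, h2]
  ring

end Test

/-! ### Rellich-type bound for a confining potential on the section -/

section Rellich

theorem exists_smooth_cutoff {Y : ℝ} (hY : 0 < Y) : ∃ θ : ℝ → ℝ, ContDiff ℝ ∞ θ ∧
    HasCompactSupport θ ∧ (∀ y, 0 ≤ θ y) ∧ (∀ y, θ y ≤ 1) ∧ (∀ y, |y| ≤ Y → θ y = 1) ∧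
      (∀ y, Y + 1 ≤ |y| → θ y = 0) := by
  let f : ContDiffBump (0 : ℝ) := ⟨Y, Y + 1, hY, by linarith⟩
  refine ⟨f, f.contDiff, f.hasCompactSupport, fun y => f.nonneg, fun y => f.le_one, ?_, ?_⟩
  · intro y hy
    exact f.one_of_mem_closedBall (by simpa using hy)
  · intro y hy
    exact f.zero_of_le_dist (by simpa using hy)

/-- The form `‖ψ'‖² + ∫ V |ψ|²` of a confining potential is arbitrarily large on subspaces of finite
codimension. -/
theorem exists_finite_transverse_lower_bound {S : Set ℝ} (hS : MeasurableSet S) {V : ℝ → ℝ}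
    (hV0 : ∀ y ∈ S, 0 ≤ V y) (hconf : ∀ M : ℝ, ∃ Y : ℝ, ∀ y ∈ S, Y < |y| → M ≤ V y) (M : ℝ) :
    ∃ G : Set (TransverseL2 S), G.Finite ∧ ∀ ψ v : TransverseL2 S, HasDirichletDeriv S ψ v →
      HasFinitePotentialEnergy (volume.restrict S) V ψ → (∀ g ∈ G, inner ℂ g ψ = 0) →
      M * ‖ψ‖ ^ 2 ≤ ‖v‖ ^ 2 + ∫ y in S, V y * ‖ψ y‖ ^ 2 := by
  wlog hM : 0 < M generalizing M
  · obtain ⟨G, hG, h⟩ := this 1 one_pos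
    refine ⟨G, hG, fun ψ v hd hf hg => ?_⟩
    have := h ψ v hd hf hg
    nlinarith [sq_nonneg ‖ψ‖]
  -- Asking for `4 * M` leaves room for the losses from localization: at the end half of the
  -- resulting bound is absorbed and `2 * M` survives.
  obtain ⟨Y₀, hY₀⟩ := hconf (4 * M)
  set Y := max Y₀ 1 with hYdef
  have hY : 0 < Y := lt_of_lt_of_le one_pos (le_max_right _ _)
  obtain ⟨θ, hθs, hθc, hθ0, hθ1, hθin, hθout⟩ := exists_smooth_cutoff hY
  obtain ⟨D, hD⟩ : ∃ D, ∀ y, ‖deriv θ y‖ ≤ D :=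
    hθc.deriv.exists_bound_of_continuous (hθs.continuous_deriv (by simp))
  have hD0 : 0 ≤ D := (norm_nonneg _).trans (hD 0)
  set L := 2 * (Y + 1) with hLdef
  have hL : 0 < L := by positivity
  have hcont : ∀ k : ℤ, ContDiff ℝ ∞ fun y => planeWave (-frequency L k) y * (θ y : ℂ) := fun k =>
    (contDiff_planeWave _).mul (Complex.ofRealCLM.contDiff.comp hθs)
  have hθc' : HasCompactSupport fun y => (θ y : ℂ) :=
    hθc.comp_left (g := fun t : ℝ => (t : ℂ)) Complex.ofReal_zero
  have hcomp : ∀ k : ℤ, HasCompactSupport fun y => planeWave (-frequency L k) y * (θ y : ℂ) :=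
    fun k => hθc'.mul_left
  have hmem : ∀ k : ℤ, MemLp (fun y => planeWave (-frequency L k) y * (θ y : ℂ)) 2
    (volume.restrict S) := fun k => (hcont k).continuous.memLp_of_hasCompactSupport (hcomp k)
  obtain ⟨N, hN⟩ := exists_nat_ge ((4 * D ^ 2 + 8 * M + 1) / (2 * Real.pi / L))
  -- `4 * D ^ 2` absorbs the derivative of the cutoff and `8 * M` the factor in front of `‖v‖²`. The
  -- `1` gives `Λ ≤ Λ²`, so that frequencies of modulus at least `Λ` have square at least `Λ`.
  set Λ := 4 * D ^ 2 + 8 * M + 1 with hΛ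
  have hΛ1 : 1 ≤ Λ := by have := sq_nonneg D; linarith
  -- Orthogonality to these functions kills the Fourier coefficients of `θ ψ` with `|k| ≤ N`.
  refine ⟨(fun k : ℤ => (memLp_conj (hmem k)).toLp) '' (Icc (-(N : ℤ)) N),
    (Set.finite_Icc _ _).image _, fun ψ v hd hf hg => ?_⟩
  have hc0 : ∀ k ∈ Icc (-(N : ℤ)) N, ∫ y in S, planeWave (-frequency L k) y * (θ y : ℂ) * ψ y = 0 := by
    intro k hk
    rw [← inner_conj_toLp (hmem k)]
    exact hg _ ⟨k, hk, rfl⟩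
  set f : ℝ → ℂ := S.indicator fun y => (θ y : ℂ) * ψ y with hfdef
  -- This is the derivative of `f`, including across the boundary of `S`: the test functions in
  -- `HasDirichletDeriv` need not vanish there, so no boundary term arises in `hcoef'`.
  set f' : ℝ → ℂ := S.indicator fun y => (θ y : ℂ) * v y + ((deriv θ y : ℝ) : ℂ) * ψ y with hf'def
  have hθm : Continuous fun y => (θ y : ℂ) := Complex.continuous_ofReal.comp hθs.continuous
  have hθm' : Continuous fun y => ((deriv θ y : ℝ) : ℂ) :=
    Complex.continuous_ofReal.comp (hθs.continuous_deriv (by simp))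
  have hmul : ∀ (h : ℝ → ℂ) (_ : Continuous h) (b : ℝ) (_ : ∀ y, ‖h y‖ ≤ b) (u : TransverseL2 S),
      MemLp (fun y => h y * u y) 2 (volume.restrict S) := fun h hh b hb u =>
    (Lp.memLp u).mul (p := ∞) (memLp_top_of_bound hh.aestronglyMeasurable b (Eventually.of_forall hb))
  have hθb : ∀ y, ‖(θ y : ℂ)‖ ≤ 1 := fun y => by
    rw [Complex.norm_real, Real.norm_of_nonneg (hθ0 y)]; exact hθ1 y
  have hθb' : ∀ y, ‖((deriv θ y : ℝ) : ℂ)‖ ≤ D := fun y => by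
    rw [Complex.norm_real]; exact hD y
  have hfm : MemLp f 2 volume := (memLp_indicator_iff_restrict hS).mpr (hmul _ hθm 1 hθb ψ)
  have hf'm : MemLp f' 2 volume := (memLp_indicator_iff_restrict hS).mpr
    ((hmul _ hθm 1 hθb v).add (hmul _ hθm' D hθb' ψ))
  have hIoc : ∀ y, y ∉ Ioc (-(L / 2)) (L / 2) → Y + 1 ≤ |y| := by
    intro y hy
    by_contra hcon
    rw [not_le, abs_lt] at hcon
    exact hy ⟨by rw [hLdef]; linarith [hcon.1], by rw [hLdef]; linarith [hcon.2]⟩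
  have hθz : ∀ y, y ∉ Ioc (-(L / 2)) (L / 2) → θ y = 0 ∧ deriv θ y = 0 := by
    intro y hy
    have h1 := hIoc y hy
    have h2 : θ y = 0 := hθout y h1
    refine ⟨h2, ?_⟩
    -- A zero of a nonnegative function is a minimum; this also covers the edge `|y| = Y + 1`.
    have h3 : IsLocalMin θ y := Eventually.of_forall fun z => by rw [h2]; exact hθ0 z
    exact h3.deriv_eq_zero
  have hP := hasSum_sq_fourier hL hfm (fun y hy => by
    by_cases hyS : y ∈ S <;> simp [hfdef, hyS, (hθz y hy).1])
  have hP' := hasSum_sq_fourier hL hf'm (fun y hy => by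
    by_cases hyS : y ∈ S <;> simp [hf'def, hyS, (hθz y hy).1, (hθz y hy).2])
  have hcoef : ∀ k : ℤ, ∫ y, planeWave (-frequency L k) y * f y =
      ∫ y in S, planeWave (-frequency L k) y * (θ y : ℂ) * ψ y := by
    intro k
    rw [← integral_indicator hS]
    congr 1; funext y
    by_cases hyS : y ∈ S <;> simp [hfdef, hyS, mul_assoc]
  have hcoef' : ∀ k : ℤ, ∫ y, planeWave (-frequency L k) y * f' y =
      frequency L k * Complex.I * ∫ y, planeWave (-frequency L k) y * f y := by
    intro k
    have h1 := hd.complex_test (hcont k) (hcomp k)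
    have hder : ∀ y, deriv (fun y => planeWave (-frequency L k) y * (θ y : ℂ)) y =
        planeWave (-frequency L k) y * ((deriv θ y : ℝ) : ℂ) -
          frequency L k * Complex.I * (planeWave (-frequency L k) y * (θ y : ℂ)) := by
      intro y
      have h2 := (hasDerivAt_planeWave (-frequency L k) y).mul
        ((hθs.differentiable (by simp) y).hasDerivAt.ofReal_comp)
      refine h2.deriv.trans ?_
      push_cast
      ring
    have hwm : Continuous fun y => planeWave (-frequency L k) y * ((deriv θ y : ℝ) : ℂ) :=
      (continuous_planeWave _).mul hθm'
    have hdc : HasCompactSupport fun y => ((deriv θ y : ℝ) : ℂ) :=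
      hθc.deriv.comp_left (g := fun t : ℝ => (t : ℂ)) Complex.ofReal_zero
    have hi1 : Integrable (fun y => planeWave (-frequency L k) y * ((deriv θ y : ℝ) : ℂ) * ψ y)
        (volume.restrict S) := integrable_test hwm hdc.mul_left ψ
    have hi2 := integrable_test (μ := volume.restrict S) (hcont k).continuous (hcomp k) ψ
    have hi3 := integrable_test (μ := volume.restrict S) (hcont k).continuous (hcomp k) v
    have h3 : ∫ y, planeWave (-frequency L k) y * f' y =
        (∫ y in S, planeWave (-frequency L k) y * (θ y : ℂ) * v y) +
          ∫ y in S, planeWave (-frequency L k) y * ((deriv θ y : ℝ) : ℂ) * ψ y := by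
      rw [← integral_add hi3 hi1, ← integral_indicator hS]
      congr 1; funext y
      by_cases hyS : y ∈ S <;> simp [hf'def, hyS, mul_assoc, mul_add]
    have h4 : ∫ y in S, deriv (fun y => planeWave (-frequency L k) y * (θ y : ℂ)) y * ψ y =
        (∫ y in S, planeWave (-frequency L k) y * ((deriv θ y : ℝ) : ℂ) * ψ y) -
          frequency L k * Complex.I * ∫ y in S, planeWave (-frequency L k) y * (θ y : ℂ) * ψ y := by
      rw [← integral_const_mul, ← integral_sub hi1 (hi2.const_mul _)]
      congr 1; funext y
      rw [hder]; ring
    rw [h3, h1, h4, hcoef]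
    ring
  have hterm : ∀ k : ℤ, Λ * ‖∫ y, planeWave (-frequency L k) y * f y‖ ^ 2 ≤
      ‖∫ y, planeWave (-frequency L k) y * f' y‖ ^ 2 := by
    intro k
    by_cases hk : k ∈ Icc (-(N : ℤ)) N
    · rw [hcoef, hc0 k hk]; simp
    · have hk' : (N : ℝ) ≤ |(k : ℝ)| := by
        have : (N : ℤ) ≤ |k| := by
          by_contra hcon
          rw [not_le, abs_lt] at hcon
          exact hk ⟨hcon.1.le, hcon.2.le⟩
        exact_mod_cast this
      rw [hcoef', norm_mul, norm_mul, Complex.norm_I, mul_one, mul_pow, Complex.norm_real,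
        Real.norm_eq_abs]
      have hpos : 0 < 2 * Real.pi / L := by positivity
      have h1 : Λ ≤ |frequency L k| := by
        rw [div_le_iff₀ hpos] at hN
        calc Λ ≤ N * (2 * Real.pi / L) := hN
          _ ≤ |(k : ℝ)| * (2 * Real.pi / L) := by gcongr
          _ = |frequency L k| := by
            rw [← abs_of_pos hpos, ← abs_mul, frequency]
            congr 1; ring
      gcongr
      nlinarith
  have hmain : Λ * (L * ∫ y, ‖f y‖ ^ 2) ≤ L * ∫ y, ‖f' y‖ ^ 2 :=
    hasSum_le hterm (hP.mul_left Λ) hP'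
  have hmain' : Λ * ∫ y, ‖f y‖ ^ 2 ≤ ∫ y, ‖f' y‖ ^ 2 := by
    have : L * (Λ * ∫ y, ‖f y‖ ^ 2) ≤ L * ∫ y, ‖f' y‖ ^ 2 := by linarith
    exact le_of_mul_le_mul_left this hL
  have hnf : ∫ y, ‖f y‖ ^ 2 = ∫ y in S, ‖(θ y : ℂ) * ψ y‖ ^ 2 := by
    rw [← integral_indicator hS]
    congr 1; funext y
    by_cases hyS : y ∈ S <;> simp [hfdef, hyS]
  have hnf' : ∫ y, ‖f' y‖ ^ 2 ≤ 2 * ‖v‖ ^ 2 + 2 * D ^ 2 * ‖ψ‖ ^ 2 := by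
    have h1 : ∫ y, ‖f' y‖ ^ 2 = ∫ y in S, ‖(θ y : ℂ) * v y + ((deriv θ y : ℝ) : ℂ) * ψ y‖ ^ 2 := by
      rw [← integral_indicator hS]
      congr 1; funext y
      by_cases hyS : y ∈ S <;> simp [hf'def, hyS]
    rw [h1, norm_sq_eq_integral v, norm_sq_eq_integral ψ, ← integral_const_mul, ← integral_const_mul,
      ← integral_add ((integrable_norm_sq v).const_mul _) ((integrable_norm_sq ψ).const_mul _)]
    refine integral_mono_of_nonneg (Eventually.of_forall fun y => sq_nonneg _)
      (((integrable_norm_sq v).const_mul _).add ((integrable_norm_sq ψ).const_mul _))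
      (Eventually.of_forall fun y => ?_)
    have h2 : ‖(θ y : ℂ) * v y + ((deriv θ y : ℝ) : ℂ) * ψ y‖ ≤ ‖v y‖ + D * ‖ψ y‖ := by
      refine (norm_add_le _ _).trans ?_
      rw [norm_mul, norm_mul]
      have := mul_le_mul_of_nonneg_right (hθb y) (norm_nonneg (v y))
      have := mul_le_mul_of_nonneg_right (hθb' y) (norm_nonneg (ψ y))
      linarith
    calc ‖(θ y : ℂ) * v y + ((deriv θ y : ℝ) : ℂ) * ψ y‖ ^ 2 ≤ (‖v y‖ + D * ‖ψ y‖) ^ 2 := by gcongr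
      _ ≤ 2 * ‖v y‖ ^ 2 + 2 * D ^ 2 * ‖ψ y‖ ^ 2 := by nlinarith [sq_nonneg (‖v y‖ - D * ‖ψ y‖)]
  -- Where `|y| ≤ Y` the cutoff is one; elsewhere `V / (4 M) ≥ 1`.
  have hψ : ‖ψ‖ ^ 2 ≤ (∫ y, ‖f y‖ ^ 2) + (4 * M)⁻¹ * ∫ y in S, V y * ‖ψ y‖ ^ 2 := by
    have hi : Integrable (fun y => ‖(θ y : ℂ) * ψ y‖ ^ 2) (volume.restrict S) :=
      (memLp_two_iff_integrable_sq_norm (hmul _ hθm 1 hθb ψ).1).mp (hmul _ hθm 1 hθb ψ)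
    have hf' : Integrable (fun y => V y * ‖ψ y‖ ^ 2) (volume.restrict S) := hf
    rw [hnf, ← integral_const_mul, ← integral_add hi (hf'.const_mul _), norm_sq_eq_integral]
    refine integral_mono_ae (integrable_norm_sq ψ) (hi.add (hf'.const_mul _)) ?_
    filter_upwards [ae_restrict_mem hS] with y hy
    by_cases hyY : |y| ≤ Y
    · simp only [hθin y hyY, Complex.ofReal_one, one_mul]
      have := hV0 y hy
      have : 0 ≤ (4 * M)⁻¹ * (V y * ‖ψ y‖ ^ 2) := by positivity
      linarith
    · have h1 : 4 * M ≤ V y := hY₀ y hy ((le_max_left _ _).trans_lt (not_le.mp hyY))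
      have h2 : 1 ≤ (4 * M)⁻¹ * V y := by
        rw [inv_mul_eq_div, le_div_iff₀ (by positivity)]; linarith
      have h3 := mul_le_mul_of_nonneg_right h2 (sq_nonneg ‖ψ y‖)
      have h4 := sq_nonneg ‖(θ y : ℂ) * ψ y‖
      show _ ≤ ‖(θ y : ℂ) * ψ y‖ ^ 2 + (4 * M)⁻¹ * (V y * ‖ψ y‖ ^ 2)
      linarith
  set q := ∫ y in S, V y * ‖ψ y‖ ^ 2
  set nf := ∫ y, ‖f y‖ ^ 2
  have h4M : (4 * M) * ‖ψ‖ ^ 2 ≤ 4 * M * nf + q := by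
    have := mul_le_mul_of_nonneg_left hψ (by positivity : (0 : ℝ) ≤ 4 * M)
    rwa [mul_add, mul_inv_cancel_left₀ (by positivity)] at this
  have hnf0 : 0 ≤ nf := integral_nonneg fun y => sq_nonneg _
  have h5 : Λ * nf ≤ 2 * ‖v‖ ^ 2 + 2 * D ^ 2 * ‖ψ‖ ^ 2 := hmain'.trans hnf'
  have hΛpos : 0 < Λ := by linarith
  have h6 : Λ * (4 * M * nf) ≤ Λ * (‖v‖ ^ 2 + 2 * M * ‖ψ‖ ^ 2) := by
    have h7 : 8 * M ≤ Λ := by have := sq_nonneg D; linarith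
    have h8 : 4 * D ^ 2 ≤ Λ := by linarith
    calc Λ * (4 * M * nf) = 4 * M * (Λ * nf) := by ring
      _ ≤ 4 * M * (2 * ‖v‖ ^ 2 + 2 * D ^ 2 * ‖ψ‖ ^ 2) := by gcongr
      _ = (8 * M) * ‖v‖ ^ 2 + (4 * D ^ 2) * (2 * M * ‖ψ‖ ^ 2) := by ring
      _ ≤ Λ * ‖v‖ ^ 2 + Λ * (2 * M * ‖ψ‖ ^ 2) := by gcongr
      _ = _ := by ring
  have h9 := le_of_mul_le_mul_left h6 hΛpos
  have h10 : 0 ≤ M * ‖ψ‖ ^ 2 := by positivity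
  linarith

end Rellich

/-! ### The lowest fibre eigenvalue as a bound for the fibre form -/

section Transverse

/-- The graph of the Dirichlet derivative. -/
def dirichletGraph (S : Set ℝ) : Submodule ℂ (TransverseL2 S × TransverseL2 S) where
  carrier := {p | HasDirichletDeriv S p.1 p.2}
  zero_mem' := HasDirichletDeriv.zero S
  add_mem' := fun h₁ h₂ => h₁.add h₂
  smul_mem' := fun a _ h => h.smul a

/-- Each test function imposes a condition that is continuous in `L²`. -/
theorem isClosed_dirichletGraph (S : Set ℝ) :
    IsClosed (dirichletGraph S : Set (TransverseL2 S × TransverseL2 S)) := by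
  have : (dirichletGraph S : Set (TransverseL2 S × TransverseL2 S)) =
      ⋂ (φ : ℝ → ℝ) (_ : ContDiff ℝ ∞ φ) (_ : HasCompactSupport φ),
        {p | ∫ y in S, (φ y : ℂ) * p.2 y = -∫ y in S, ((deriv φ y : ℝ) : ℂ) * p.1 y} := by
    ext p
    simp only [mem_iInter]
    exact Iff.rfl
  rw [this]
  have key : ∀ k : ℝ → ℝ, Continuous k → HasCompactSupport k →
      MemLp (fun y => (k y : ℂ)) 2 (volume.restrict S) := fun k hk hc =>
    (Complex.continuous_ofReal.comp hk).memLp_of_hasCompactSupport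
      (hc.comp_left (g := fun t : ℝ => (t : ℂ)) Complex.ofReal_zero)
  refine isClosed_iInter fun φ => isClosed_iInter fun h => isClosed_iInter fun hc => ?_
  exact isClosed_eq ((continuous_integral_mul (key φ h.continuous hc)).comp continuous_snd)
    ((continuous_integral_mul (key _ (h.continuous_deriv (by simp)) hc.deriv)).comp
      continuous_fst).neg

/-- The eigenvalue equation is tested with the eigenfunction itself. -/
theorem exists_form_eq_of_mem_eigenspace {S : Set ℝ} {V : ℝ → ℝ} {t : ℝ} {ψ : TransverseL2 S}
    (h : ψ ∈ eigenspace (transverseOperator S V) (t : ℂ)) :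
    ∃ v, HasDirichletDeriv S ψ v ∧ HasFinitePotentialEnergy (volume.restrict S) V ψ ∧
      ‖v‖ ^ 2 + ∫ y in S, V y * ‖ψ y‖ ^ 2 = t * ‖ψ‖ ^ 2 := by
  obtain ⟨v, hv, hall⟩ : ∃ v, (ψ, v) ∈ transverseFormDomain S V ∧
    ∀ Φ ∈ transverseFormDomain S V, transverseForm S V Φ (ψ, v) = inner ℂ Φ.1 ((t : ℂ) • ψ) := h
  refine ⟨v, hv.1, hv.2, ?_⟩
  have h1 := hall _ hv
  simp only [transverseForm] at h1
  rw [inner_smul_right, potentialForm_self, inner_self_eq_ofReal v, inner_self_eq_ofReal ψ] at h1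
  exact_mod_cast h1

/-- The form of a confining potential is bounded below by the lowest eigenvalue. -/
theorem lowestEigenvalue_mul_le {S : Set ℝ} (hS : MeasurableSet S) {V : ℝ → ℝ} (hV : Measurable V)
    (hV0 : ∀ y ∈ S, 0 ≤ V y) (hconf : ∀ M : ℝ, ∃ Y : ℝ, ∀ y ∈ S, Y < |y| → M ≤ V y)
    {ψ v : TransverseL2 S} (hψ : HasDirichletDeriv S ψ v)
    (hf : HasFinitePotentialEnergy (volume.restrict S) V ψ) :
    lowestEigenvalue (transverseOperator S V) * ‖ψ‖ ^ 2 ≤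
      ‖v‖ ^ 2 + ∫ y in S, V y * ‖ψ y‖ ^ 2 := by
  have hint0 : ∀ u : TransverseL2 S, 0 ≤ ∫ y in S, V y * ‖u y‖ ^ 2 := fun u =>
    setIntegral_nonneg hS fun y hy => mul_nonneg (hV0 y hy) (sq_nonneg _)
  by_cases h0 : ψ = 0
  · have h1 := hint0 ψ
    have h2 : ‖ψ‖ = 0 := by rw [h0, norm_zero]
    rw [h2, zero_pow two_ne_zero, mul_zero]
    positivity
  have hψpos : 0 < ‖ψ‖ ^ 2 := by positivity
  set q := ‖v‖ ^ 2 + ∫ y in S, V y * ‖ψ y‖ ^ 2 with hq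
  -- The level is one above the Rayleigh quotient of `ψ`, so `ψ` itself serves as the state below
  -- it. The eigenvalue `t` obtained is a lower bound of the form and at least the infimum of all
  -- eigenvalues.
  obtain ⟨G, hG, hess⟩ := exists_finite_transverse_lower_bound hS hV0 hconf (q / ‖ψ‖ ^ 2 + 1)
  obtain ⟨t, ht, hmin⟩ := exists_discrete_ground_state_of_form (dirichletGraph S)
    (isClosed_dirichletGraph S) (P := V) hV.aemeasurable (C := 1)
    (by filter_upwards [ae_restrict_mem hS] with y hy; linarith [hV0 y hy])
    (T := transverseOperator S V)
    (fun x y => by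
      constructor
      · rintro ⟨w, hw, hall⟩
        exact ⟨w, hw, fun φ u hφ hφf => hall (φ, u) ⟨hφ, hφf⟩⟩
      · rintro ⟨w, hw, hall⟩
        exact ⟨w, hw, fun Φ hΦ => hall Φ.1 Φ.2 hΦ.1 hΦ.2⟩)
    G hG (fun φ u hφ hφf hg => hess φ u hφ hφf hg) (show (ψ, v) ∈ dirichletGraph S from hψ) hf
    (by rw [add_mul, div_mul_cancel₀ _ hψpos.ne']; linarith)
  refine le_trans ?_ (hmin ψ v hψ hf)
  refine mul_le_mul_of_nonneg_right ?_ hψpos.le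
  -- The real `sInf` needs a lower bound of the set: eigenvalues are nonnegative because the form
  -- is.
  refine csInf_le ⟨0, ?_⟩ ht.2.2.1
  intro s hs
  obtain ⟨φ, hφ, hφ0⟩ := (Submodule.ne_bot_iff _).mp hs
  obtain ⟨w, -, -, hw⟩ := exists_form_eq_of_mem_eigenspace hφ
  have h1 : 0 < ‖φ‖ ^ 2 := by positivity
  have h2 := hint0 φ
  by_contra hcon
  have h3 := mul_neg_of_neg_of_pos (not_le.mp hcon) h1
  linarith [sq_nonneg ‖w‖]

end Transverse

/-! ### The strip operator in the abstract setting -/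

section Strip

theorem transverse_test {g : ℝ × ℝ → ℂ} (hg : ContDiff ℝ ∞ g) (hc : HasCompactSupport g) :
    Continuous (fun z : ℝ × ℝ => fderiv ℝ g z (0, 1)) ∧
      HasCompactSupport (fun z : ℝ × ℝ => fderiv ℝ g z (0, 1)) :=
  ⟨(hg.continuous_fderiv (by simp)).clm_apply continuous_const, hc.fderiv_apply ℝ (0, 1)⟩

theorem fderiv_re_apply {g : ℝ × ℝ → ℂ} (hg : ContDiff ℝ ∞ g) (z e : ℝ × ℝ) :
    fderiv ℝ (fun z => (g z).re) z e = (fderiv ℝ g z e).re := by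
  have h := Complex.reCLM.hasFDerivAt.comp z (hg.differentiable (by simp) z).hasFDerivAt
  have h2 : fderiv ℝ (fun z => (g z).re) z = Complex.reCLM.comp (fderiv ℝ g z) := h.fderiv
  rw [h2]; rfl

theorem fderiv_im_apply {g : ℝ × ℝ → ℂ} (hg : ContDiff ℝ ∞ g) (z e : ℝ × ℝ) :
    fderiv ℝ (fun z => (g z).im) z e = (fderiv ℝ g z e).im := by
  have h := Complex.imCLM.hasFDerivAt.comp z (hg.differentiable (by simp) z).hasFDerivAt
  have h2 : fderiv ℝ (fun z => (g z).im) z = Complex.imCLM.comp (fderiv ℝ g z) := h.fderiv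
  rw [h2]; rfl

variable {S : Set ℝ} {B : ℝ} {ψ v w : StripL2 S}

theorem HasMagneticDeriv.complex_test (h : HasMagneticDeriv S B ψ v) {g : ℝ × ℝ → ℂ}
    (hg : ContDiff ℝ ∞ g) (hc : HasCompactSupport g) :
    ∫ z, g z * v z ∂stripMeasure S =
      ∫ z, (Complex.I * fderiv ℝ g z (1, 0) - B * z.2 * g z) * ψ z ∂stripMeasure S := by
  have hre : ContDiff ℝ ∞ fun y => (g y).re := Complex.reCLM.contDiff.comp hg
  have him : ContDiff ℝ ∞ fun y => (g y).im := Complex.imCLM.contDiff.comp hg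
  have hcre : HasCompactSupport fun y => (g y).re := hc.comp_left (g := Complex.re) rfl
  have hcim : HasCompactSupport fun y => (g y).im := hc.comp_left (g := Complex.im) rfl
  have h1 := h _ hre hcre
  have h2 := h _ him hcim
  have key : ∀ φ : ℝ × ℝ → ℝ, ContDiff ℝ ∞ φ → HasCompactSupport φ →
      Integrable (fun z => (Complex.I * ((fderiv ℝ φ z (1, 0) : ℝ) : ℂ) - (B * z.2 * φ z : ℂ)) * ψ z)
        (stripMeasure S) := by
    intro φ hφ hφc
    obtain ⟨c0, s0⟩ := test_ofReal hφ.continuous hφc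
    obtain ⟨c1, s1⟩ := test_fderiv hφ hφc (1, 0)
    exact integrable_test (by fun_prop) ((s1.mul_left (f := fun _ => Complex.I)).sub
      (s0.mul_left (f := fun z : ℝ × ℝ => (B * z.2 : ℂ)))) ψ
  rw [integral_complex_split hg.continuous hc, h1, h2, ← integral_const_mul, ← integral_add
    (key _ hre hcre) ((key _ him hcim).const_mul _)]
  refine integral_congr_ae (Eventually.of_forall fun z => ?_)
  simp only [fderiv_re_apply hg, fderiv_im_apply hg]
  have e1 := Complex.re_add_im (g z)
  have e2 := Complex.re_add_im (fderiv ℝ g z (1, 0))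
  linear_combination (Complex.I * ψ z) * e2 - (B * z.2 * ψ z) * e1

theorem HasTransverseDeriv.complex_test (h : HasTransverseDeriv S ψ w) {g : ℝ × ℝ → ℂ}
    (hg : ContDiff ℝ ∞ g) (hc : HasCompactSupport g) :
    ∫ z, g z * w z ∂stripMeasure S = -∫ z, fderiv ℝ g z (0, 1) * ψ z ∂stripMeasure S := by
  have hre : ContDiff ℝ ∞ fun y => (g y).re := Complex.reCLM.contDiff.comp hg
  have him : ContDiff ℝ ∞ fun y => (g y).im := Complex.imCLM.contDiff.comp hg
  have hcre : HasCompactSupport fun y => (g y).re := hc.comp_left (g := Complex.re) rfl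
  have hcim : HasCompactSupport fun y => (g y).im := hc.comp_left (g := Complex.im) rfl
  have h1 := h _ hre hcre
  have h2 := h _ him hcim
  obtain ⟨c, s⟩ := transverse_test hg hc
  rw [integral_complex_split hg.continuous hc, h1, h2, integral_complex_split c s]
  simp only [fderiv_re_apply hg, fderiv_im_apply hg]
  ring

/-- The graph of the weak derivatives `ψ ↦ ((-i∂ₓ - By)ψ, ∂_y ψ)`. -/
def stripGraph (S : Set ℝ) (B : ℝ) : Submodule ℂ (StripL2 S × WithLp 2 (StripL2 S × StripL2 S)) where
  carrier := {p | HasMagneticDeriv S B p.1 p.2.fst ∧ HasTransverseDeriv S p.1 p.2.snd}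
  zero_mem' := by
    refine ⟨fun φ _ _ => ?_, fun φ _ _ => ?_⟩
    · exact (integral_test_zero S _).trans (integral_test_zero S _).symm
    · exact (integral_test_zero S _).trans (by rw [Prod.fst_zero, integral_test_zero, neg_zero])
  add_mem' := fun h₁ h₂ => ⟨h₁.1.add h₂.1, h₁.2.add h₂.2⟩
  smul_mem' := fun a p h => by
    refine ⟨fun φ h1 h2 => ?_, fun φ h1 h2 => ?_⟩
    · have := h.1 φ h1 h2
      simp only [Prod.smul_fst, Prod.smul_snd, WithLp.smul_fst, integral_test_smul, this]
    · have := h.2 φ h1 h2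
      simp only [Prod.smul_fst, Prod.smul_snd, WithLp.smul_snd, integral_test_smul, this]
      ring

theorem isClosed_stripGraph (S : Set ℝ) (B : ℝ) :
    IsClosed (stripGraph S B : Set (StripL2 S × WithLp 2 (StripL2 S × StripL2 S))) := by
  have : (stripGraph S B : Set (StripL2 S × WithLp 2 (StripL2 S × StripL2 S))) =
      ⋂ (φ : ℝ × ℝ → ℝ) (_ : ContDiff ℝ ∞ φ) (_ : HasCompactSupport φ),
        ({p | ∫ z, (φ z : ℂ) * p.2.fst z ∂stripMeasure S =
            ∫ z, (Complex.I * ((fderiv ℝ φ z (1, 0) : ℝ) : ℂ) - (B * z.2 * φ z : ℂ)) * p.1 z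
              ∂stripMeasure S} ∩
          {p | ∫ z, (φ z : ℂ) * p.2.snd z ∂stripMeasure S =
            -∫ z, ((fderiv ℝ φ z (0, 1) : ℝ) : ℂ) * p.1 z ∂stripMeasure S}) := by
    ext p
    simp only [mem_iInter]
    exact ⟨fun h φ h1 h2 => ⟨h.1 φ h1 h2, h.2 φ h1 h2⟩,
      fun h => ⟨fun φ h1 h2 => (h φ h1 h2).1, fun φ h1 h2 => (h φ h1 h2).2⟩⟩
  rw [this]
  refine isClosed_iInter fun φ => isClosed_iInter fun h => isClosed_iInter fun hc => ?_
  obtain ⟨c0, s0⟩ := test_ofReal h.continuous hc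
  obtain ⟨c1, s1⟩ := test_fderiv h hc (1, 0)
  obtain ⟨c2, s2⟩ := test_fderiv h hc (0, 1)
  have c3 : Continuous fun z : ℝ × ℝ =>
      Complex.I * ((fderiv ℝ φ z (1, 0) : ℝ) : ℂ) - (B * z.2 * φ z : ℂ) := by fun_prop
  have s3 : HasCompactSupport fun z : ℝ × ℝ =>
      Complex.I * ((fderiv ℝ φ z (1, 0) : ℝ) : ℂ) - (B * z.2 * φ z : ℂ) :=
    (s1.mul_left (f := fun _ => Complex.I)).sub (s0.mul_left (f := fun z : ℝ × ℝ => (B * z.2 : ℂ)))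
  have hfst : Continuous fun p : StripL2 S × WithLp 2 (StripL2 S × StripL2 S) => p.2.fst :=
    (WithLp.fstL 2 ℂ _ _).continuous.comp continuous_snd
  have hsnd : Continuous fun p : StripL2 S × WithLp 2 (StripL2 S × StripL2 S) => p.2.snd :=
    (WithLp.sndL 2 ℂ _ _).continuous.comp continuous_snd
  exact (isClosed_eq
      ((continuous_integral_mul (c0.memLp_of_hasCompactSupport s0)).comp hfst)
      ((continuous_integral_mul (c3.memLp_of_hasCompactSupport s3)).comp continuous_fst)).inter
    (isClosed_eq
      ((continuous_integral_mul (c0.memLp_of_hasCompactSupport s0)).comp hsnd)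
      ((continuous_integral_mul (c2.memLp_of_hasCompactSupport s2)).comp continuous_fst).neg)

/-- The form of the strip operator lies above `m` on a subspace of finite codimension and takes a
value below `m`, then the operator has discrete spectrum. -/
theorem discreteSpectrum_stripOperator_nonempty {P : ℝ × ℝ → ℝ}
    (hP : AEMeasurable P (stripMeasure S)) {C : ℝ} (hPC : ∀ᵐ z ∂stripMeasure S, 1 ≤ P z + C) {m : ℝ}
    (G : Set (StripL2 S)) (hG : G.Finite)
    (hess : ∀ ψ v w : StripL2 S, (ψ, v, w) ∈ stripFormDomain S B P → (∀ g ∈ G, inner ℂ g ψ = 0) →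
      m * ‖ψ‖ ^ 2 ≤ ‖v‖ ^ 2 + ‖w‖ ^ 2 + ∫ z, P z * ‖ψ z‖ ^ 2 ∂stripMeasure S)
    (h₀ : (ψ, v, w) ∈ stripFormDomain S B P)
    (hlt : ‖v‖ ^ 2 + ‖w‖ ^ 2 + ∫ z, P z * ‖ψ z‖ ^ 2 ∂stripMeasure S < m * ‖ψ‖ ^ 2) :
    (discreteSpectrum (stripOperator S B P)).Nonempty := by
  have hnorm : ∀ u : WithLp 2 (StripL2 S × StripL2 S), ‖u‖ ^ 2 = ‖u.fst‖ ^ 2 + ‖u.snd‖ ^ 2 :=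
    fun u => WithLp.prod_norm_sq_eq_of_L2 u
  obtain ⟨t, ht, -⟩ := exists_discrete_ground_state_of_form (stripGraph S B)
    (isClosed_stripGraph S B) hP hPC (T := stripOperator S B P)
    (fun x y => by
      constructor
      · rintro ⟨v', w', ⟨h1, h2, h3⟩, hall⟩
        refine ⟨WithLp.toLp 2 (v', w'), ⟨⟨h1, h2⟩, h3⟩, fun φ u hφ hφf => ?_⟩
        rw [WithLp.prod_inner_apply]
        exact hall (φ, u.fst, u.snd) ⟨hφ.1, hφ.2, hφf⟩
      · rintro ⟨u', ⟨⟨h1, h2⟩, h3⟩, hall⟩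
        refine ⟨u'.fst, u'.snd, ⟨h1, h2, h3⟩, fun Φ hΦ => ?_⟩
        have := hall Φ.1 (WithLp.toLp 2 Φ.2) ⟨hΦ.1, hΦ.2.1⟩ hΦ.2.2
        rw [WithLp.prod_inner_apply] at this
        exact this)
    (m := m) G hG
    (fun φ u hφ hφf hg => by
      rw [hnorm]; exact hess φ u.fst u.snd ⟨hφ.1, hφ.2, hφf⟩ hg)
    (v₀ := WithLp.toLp 2 (v, w)) (show (ψ, WithLp.toLp 2 (v, w)) ∈ stripGraph S B from ⟨h₀.1, h₀.2.1⟩)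
    h₀.2.2 (by rw [hnorm]; exact hlt)
  exact ⟨t, ht⟩

end Strip

/-! ### Weighted square integrals in `ℝ≥0∞` -/

section Weights

variable {X : Type*} [MeasurableSpace X] {μ : Measure X}

theorem ofReal_mul_enorm_sq {a : ℝ} (ha : 0 ≤ a) (z : ℂ) :
    ENNReal.ofReal a * ‖z‖ₑ ^ 2 = ENNReal.ofReal (a * ‖z‖ ^ 2) := by
  rw [ENNReal.ofReal_mul ha, ENNReal.ofReal_pow (norm_nonneg _), ofReal_norm]

theorem lintegral_weight {ρ : X → ℝ} {F : X → ℂ} (hρ : ∀ᵐ x ∂μ, 0 ≤ ρ x)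
    (hI : Integrable (fun x => ρ x * ‖F x‖ ^ 2) μ) :
    ∫⁻ x, ENNReal.ofReal (ρ x) * ‖F x‖ₑ ^ 2 ∂μ = ENNReal.ofReal (∫ x, ρ x * ‖F x‖ ^ 2 ∂μ) := by
  rw [ofReal_integral_eq_lintegral_ofReal hI
    (by filter_upwards [hρ] with x hx; exact mul_nonneg hx (sq_nonneg _))]
  refine lintegral_congr_ae ?_
  filter_upwards [hρ] with x hx
  exact ofReal_mul_enorm_sq hx _

theorem integrable_weight {ρ : X → ℝ} {F : X → ℂ} (hρ : ∀ᵐ x ∂μ, 0 ≤ ρ x)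
    (hρm : AEMeasurable ρ μ) (hF : AEStronglyMeasurable F μ)
    (hfin : ∫⁻ x, ENNReal.ofReal (ρ x) * ‖F x‖ₑ ^ 2 ∂μ ≠ ⊤) :
    Integrable (fun x => ρ x * ‖F x‖ ^ 2) μ := by
  refine ⟨hρm.aestronglyMeasurable.mul (hF.norm.pow 2), ?_⟩
  rw [hasFiniteIntegral_iff_ofReal
    (by filter_upwards [hρ] with x hx; exact mul_nonneg hx (sq_nonneg _))]
  refine lt_of_le_of_lt (le_of_eq ?_) hfin.lt_top
  refine lintegral_congr_ae ?_
  filter_upwards [hρ] with x hx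
  exact (ofReal_mul_enorm_sq hx _).symm

theorem memLp_two_of_lintegral {F : X → ℂ} (hF : AEStronglyMeasurable F μ)
    (hfin : ∫⁻ x, ‖F x‖ₑ ^ 2 ∂μ ≠ ⊤) : MemLp F 2 μ := by
  rw [memLp_two_iff_integrable_sq_norm hF]
  have := integrable_weight (ρ := fun _ => 1) (Eventually.of_forall fun _ => zero_le_one)
    aemeasurable_const hF (by simpa using hfin)
  simpa using this

theorem lintegral_enorm_sq {F : X → ℂ} (hF : MemLp F 2 μ) :
    ∫⁻ x, ‖F x‖ₑ ^ 2 ∂μ = ENNReal.ofReal (∫ x, ‖F x‖ ^ 2 ∂μ) := by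
  have := lintegral_weight (μ := μ) (ρ := fun _ => 1) (F := F)
    (Eventually.of_forall fun _ => zero_le_one)
    (by simpa using (memLp_two_iff_integrable_sq_norm hF.1).mp hF)
  simpa using this

end Weights

/-! ### Fourier series in the longitudinal variable -/

section FourierSlice

theorem stripMeasure_eq_prod (S : Set ℝ) : stripMeasure S = volume.prod (volume.restrict S) := by
  have := Measure.prod_restrict (μ := (volume : Measure ℝ)) (ν := (volume : Measure ℝ)) univ S
  rw [Measure.restrict_univ] at this
  rw [this]; rfl

/-- The Fourier coefficients in the first variable, as functions of the second. -/
def fourierSlice (L : ℝ) (k : ℤ) (F : ℝ × ℝ → ℂ) (y : ℝ) : ℂ :=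
  ∫ x, planeWave (-frequency L k) x * F (x, y)

variable {S : Set ℝ} {L : ℝ} {F : ℝ × ℝ → ℂ}

theorem aestronglyMeasurable_fourierSlice (k : ℤ)
    (hF : AEStronglyMeasurable F (stripMeasure S)) :
    AEStronglyMeasurable (fourierSlice L k F) (volume.restrict S) := by
  rw [stripMeasure_eq_prod] at hF
  have h1 : AEStronglyMeasurable (fun z : ℝ × ℝ => planeWave (-frequency L k) z.1 * F z)
      (volume.prod (volume.restrict S)) :=
    (((continuous_planeWave _).comp continuous_fst).aestronglyMeasurable).mul hF
  exact h1.prod_swap.integral_prod_right'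

/-- Parseval's identity in the first variable, with a weight depending on the second. -/
theorem tsum_lintegral_fourierSlice (hL : 0 < L) (hF : MemLp F 2 (stripMeasure S))
    (hsupp : ∀ x, x ∉ Ioc (-(L / 2)) (L / 2) → ∀ y, F (x, y) = 0) {ρ : ℝ → ℝ≥0∞}
    (hρ : AEMeasurable ρ (volume.restrict S)) :
    ∑' k : ℤ, ∫⁻ y in S, ρ y * ‖fourierSlice L k F y‖ₑ ^ 2 =
      ENNReal.ofReal L * ∫⁻ z, ρ z.2 * ‖F z‖ₑ ^ 2 ∂stripMeasure S := by
  have hmeas : ∀ k : ℤ, AEMeasurable (fun y => ρ y * ‖fourierSlice L k F y‖ₑ ^ 2)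
      (volume.restrict S) := fun k =>
    hρ.mul ((aestronglyMeasurable_fourierSlice k hF.1).enorm.pow_const 2)
  rw [← lintegral_tsum hmeas]
  rw [stripMeasure_eq_prod] at hF ⊢
  have hm : AEMeasurable (fun z : ℝ × ℝ => ρ z.2 * ‖F z‖ₑ ^ 2) (volume.prod (volume.restrict S)) :=
    hρ.comp_snd.mul (hF.1.enorm.pow_const 2)
  rw [lintegral_prod_symm _ hm, ← lintegral_const_mul' _ _
    ENNReal.ofReal_ne_top]
  refine lintegral_congr_ae ?_
  have h1 : Integrable (fun z => ‖F z‖ ^ 2) (volume.prod (volume.restrict S)) :=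
    (memLp_two_iff_integrable_sq_norm hF.1).mp hF
  filter_upwards [h1.prod_left_ae, hF.1.prodMk_right] with y hy hym
  have hmem : MemLp (fun x => F (x, y)) 2 volume := (memLp_two_iff_integrable_sq_norm hym).mpr hy
  have h2 := lintegral_sq_fourier hL hmem (fun x hx => hsupp x hx y)
  simp only [fourierSlice]
  rw [ENNReal.tsum_mul_left, h2, lintegral_const_mul'' _ (hym.enorm.pow_const 2)]
  ring

theorem memLp_fourierSlice (hL : 0 < L) (hF : MemLp F 2 (stripMeasure S))
    (hsupp : ∀ x, x ∉ Ioc (-(L / 2)) (L / 2) → ∀ y, F (x, y) = 0) (k : ℤ) :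
    MemLp (fourierSlice L k F) 2 (volume.restrict S) := by
  refine memLp_two_of_lintegral (aestronglyMeasurable_fourierSlice k hF.1) ?_
  have h1 := tsum_lintegral_fourierSlice hL hF hsupp (ρ := fun _ => 1) aemeasurable_const
  have h2 := ENNReal.le_tsum (f := fun k => ∫⁻ y in S, 1 * ‖fourierSlice L k F y‖ₑ ^ 2) k
  rw [h1] at h2
  simp only [one_mul] at h2
  refine (h2.trans_lt ?_).ne
  rw [lintegral_enorm_sq hF]
  exact ENNReal.mul_lt_top ENNReal.ofReal_lt_top ENNReal.ofReal_lt_top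

theorem integral_mul_fourierSlice (k : ℤ) {φ : ℝ → ℂ}
    (hI : Integrable (fun z : ℝ × ℝ => φ z.2 * (planeWave (-frequency L k) z.1 * F z))
      (stripMeasure S)) :
    ∫ y in S, φ y * fourierSlice L k F y =
      ∫ z, φ z.2 * (planeWave (-frequency L k) z.1 * F z) ∂stripMeasure S := by
  rw [stripMeasure_eq_prod] at hI ⊢
  rw [integral_prod_symm _ hI]
  simp only [fourierSlice, integral_const_mul]

theorem hasCompactSupport_tensor {a φ : ℝ → ℂ} (ha : HasCompactSupport a)
    (hφ : HasCompactSupport φ) : HasCompactSupport (fun z : ℝ × ℝ => a z.1 * φ z.2) := by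
  refine HasCompactSupport.intro (IsCompact.prod ha hφ) fun z hz => ?_
  rw [mem_prod, not_and_or] at hz
  rcases hz with h | h
  · rw [image_eq_zero_of_notMem_tsupport h, zero_mul]
  · rw [image_eq_zero_of_notMem_tsupport h, mul_zero]

theorem integrable_tensor_fourier {h q : ℝ → ℂ} (hh : Continuous h) (hhc : HasCompactSupport h)
    (hq : Continuous q) (hqc : HasCompactSupport q) (p : ℝ) (f : StripL2 S) :
    Integrable (fun z : ℝ × ℝ => q z.2 * (planeWave p z.1 * (h z.1 * f z))) (stripMeasure S) := by
  have hpw := continuous_planeWave p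
  have h1 := integrable_test (μ := stripMeasure S)
    (g := fun z : ℝ × ℝ => (planeWave p z.1 * h z.1) * q z.2)
    (((hpw.comp continuous_fst).mul (hh.comp continuous_fst)).mul (hq.comp continuous_snd))
    (hasCompactSupport_tensor (a := fun x => planeWave p x * h x) hhc.mul_left hqc) f
  refine h1.congr (Eventually.of_forall fun z => ?_)
  simp only
  ring

theorem tensor_test {a φ : ℝ → ℂ} (ha : ContDiff ℝ ∞ a) (hac : HasCompactSupport a)
    (hφ : ContDiff ℝ ∞ φ) (hφc : HasCompactSupport φ) :
    ContDiff ℝ ∞ (fun z : ℝ × ℝ => a z.1 * φ z.2) ∧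
      HasCompactSupport (fun z : ℝ × ℝ => a z.1 * φ z.2) ∧
      (∀ z : ℝ × ℝ, fderiv ℝ (fun z : ℝ × ℝ => a z.1 * φ z.2) z (1, 0) = deriv a z.1 * φ z.2) ∧
      ∀ z : ℝ × ℝ, fderiv ℝ (fun z : ℝ × ℝ => a z.1 * φ z.2) z (0, 1) = a z.1 * deriv φ z.2 := by
  have hf : ∀ z : ℝ × ℝ, HasFDerivAt (fun z : ℝ × ℝ => a z.1 * φ z.2)
      (a z.1 • (ContinuousLinearMap.toSpanSingleton ℝ (deriv φ z.2)).comp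
          (ContinuousLinearMap.snd ℝ ℝ ℝ) +
        φ z.2 • (ContinuousLinearMap.toSpanSingleton ℝ (deriv a z.1)).comp
          (ContinuousLinearMap.fst ℝ ℝ ℝ)) z := by
    intro z
    have h1 : HasFDerivAt (fun z : ℝ × ℝ => a z.1) _ z :=
      ((ha.differentiable (by simp) z.1).hasDerivAt.hasFDerivAt).comp z hasFDerivAt_fst
    have h2 : HasFDerivAt (fun z : ℝ × ℝ => φ z.2) _ z :=
      ((hφ.differentiable (by simp) z.2).hasDerivAt.hasFDerivAt).comp z hasFDerivAt_snd
    exact h1.mul h2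
  refine ⟨(ha.comp contDiff_fst).mul (hφ.comp contDiff_snd), ?_, fun z => ?_, fun z => ?_⟩
  · exact hasCompactSupport_tensor hac hφc
  · rw [(hf z).fderiv]; simp [mul_comm]
  · rw [(hf z).fderiv]; simp

theorem memLp_cutoff_mul {S : Set ℝ} {h : ℝ → ℂ} (hh : Continuous h) (hc : HasCompactSupport h)
    (u : StripL2 S) : MemLp (fun z : ℝ × ℝ => h z.1 * u z) 2 (stripMeasure S) := by
  obtain ⟨b, hb⟩ := hc.exists_bound_of_continuous hh
  exact (Lp.memLp u).mul (p := ∞) (memLp_top_of_bound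
    (hh.comp continuous_fst).aestronglyMeasurable b (Eventually.of_forall fun z => hb z.1))

end FourierSlice

/-! ### Decomposition of the strip form into fibre forms -/

section PartialFourier

variable {S : Set ℝ} {B L : ℝ} {ψ v w : StripL2 S} {η : ℝ → ℝ}

theorem cutoff_planeWave (hη : ContDiff ℝ ∞ η) (hc : HasCompactSupport η) (p : ℝ) :
    ContDiff ℝ ∞ (fun x => planeWave (-p) x * (η x : ℂ)) ∧
      HasCompactSupport (fun x => planeWave (-p) x * (η x : ℂ)) ∧
      ∀ x, deriv (fun x => planeWave (-p) x * (η x : ℂ)) x =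
        planeWave (-p) x * ((deriv η x : ℝ) : ℂ) -
          p * Complex.I * (planeWave (-p) x * (η x : ℂ)) := by
  refine ⟨(contDiff_planeWave _).mul (Complex.ofRealCLM.contDiff.comp hη),
    HasCompactSupport.mul_left
      (hc.comp_left (g := fun t : ℝ => (t : ℂ)) Complex.ofReal_zero), fun x => ?_⟩
  refine ((hasDerivAt_planeWave (-p) x).mul
    ((hη.differentiable (by simp) x).hasDerivAt.ofReal_comp)).deriv.trans ?_
  push_cast
  ring

/-- The strip identity is tested with a product of a modulated cutoff in `x` and `g(y)`. The
derivative in `y` falls on `g` alone, so the derivative and the Dirichlet condition pass to the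
slices. -/
theorem fourierSlice_hasDirichletDeriv (hη : ContDiff ℝ ∞ η)
    (hc : HasCompactSupport η) (h : HasTransverseDeriv S ψ w) (k : ℤ) {φ u : TransverseL2 S}
    (hφ : φ =ᵐ[volume.restrict S] fourierSlice L k fun z => η z.1 * ψ z)
    (hu : u =ᵐ[volume.restrict S] fourierSlice L k fun z => η z.1 * w z) :
    HasDirichletDeriv S φ u := by
  intro g hg hgc
  obtain ⟨ha, hac, -⟩ := cutoff_planeWave hη hc (frequency L k)
  have hg' : ContDiff ℝ ∞ fun y => (g y : ℂ) := Complex.ofRealCLM.contDiff.comp hg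
  have hgc' : HasCompactSupport fun y => (g y : ℂ) :=
    hgc.comp_left (g := fun t : ℝ => (t : ℂ)) Complex.ofReal_zero
  have hgd : ∀ y, deriv (fun y => (g y : ℂ)) y = ((deriv g y : ℝ) : ℂ) := fun y =>
    ((hg.differentiable (by simp) y).hasDerivAt.ofReal_comp).deriv
  obtain ⟨t1, t2, -, t4⟩ := tensor_test ha hac hg' hgc'
  have hηc : Continuous fun x => (η x : ℂ) := Complex.continuous_ofReal.comp hη.continuous
  have hηs : HasCompactSupport fun x => (η x : ℂ) :=
    hc.comp_left (g := fun t : ℝ => (t : ℂ)) Complex.ofReal_zero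
  have key : ∀ (q : ℝ → ℂ) (_ : Continuous q) (_ : HasCompactSupport q) (U : TransverseL2 S)
      (f : StripL2 S) (_ : U =ᵐ[volume.restrict S] fourierSlice L k fun z => η z.1 * f z),
      ∫ y in S, q y * U y = ∫ z, (planeWave (-frequency L k) z.1 * (η z.1 : ℂ) * q z.2) * f z
        ∂stripMeasure S := by
    intro q hq hqc U f hU
    have h1 := integral_mul_fourierSlice k
      (integrable_tensor_fourier hηc hηs hq hqc (-frequency L k) f)
    have h2 : ∫ y in S, q y * U y =
        ∫ y in S, q y * fourierSlice L k (fun z => (η z.1 : ℂ) * f z) y := by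
      refine integral_congr_ae ?_
      filter_upwards [hU] with y hy
      rw [hy]
    rw [h2, h1]
    refine integral_congr_ae (Eventually.of_forall fun z => ?_)
    simp only
    ring
  rw [key _ hg'.continuous hgc' u w hu, h.complex_test t1 t2, key (fun y => ((deriv g y : ℝ) : ℂ))
    (Complex.continuous_ofReal.comp (hg.continuous_deriv (by simp))) (hgc.deriv.comp_left
      (g := fun t : ℝ => (t : ℂ)) Complex.ofReal_zero) φ ψ hφ]
  simp only [t4, hgd]

/-- The function on the left is the slice of `(-i∂ₓ - By)(ηψ)`, and on the `k`-th Fourier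
coefficient `-i∂ₓ` acts as multiplication by the frequency. This turns the magnetic energy into the
term `(By - p)²` of the fibre potential. -/
theorem fourierSlice_magnetic (hL : 0 < L) (hη : ContDiff ℝ ∞ η) (hc : HasCompactSupport η)
    (hsupp : ∀ x, x ∉ Ioc (-(L / 2)) (L / 2) → η x = 0 ∧ deriv η x = 0)
    (h : HasMagneticDeriv S B ψ v) (k : ℤ) :
    ∀ᵐ y ∂volume.restrict S,
      fourierSlice L k (fun z => η z.1 * v z - Complex.I * (deriv η z.1 : ℝ) * ψ z) y =
        (frequency L k - B * y) * fourierSlice L k (fun z => η z.1 * ψ z) y := by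
  set p := frequency L k with hp
  obtain ⟨ha, hac, had⟩ := cutoff_planeWave hη hc p
  have hηc : Continuous fun x => (η x : ℂ) := Complex.continuous_ofReal.comp hη.continuous
  have hηs : HasCompactSupport fun x => (η x : ℂ) :=
    hc.comp_left (g := fun t : ℝ => (t : ℂ)) Complex.ofReal_zero
  have hη'c : Continuous fun x => Complex.I * ((deriv η x : ℝ) : ℂ) :=
    continuous_const.mul (Complex.continuous_ofReal.comp (hη.continuous_deriv (by simp)))
  have hη's : HasCompactSupport fun x => Complex.I * ((deriv η x : ℝ) : ℂ) :=
    (hc.deriv.comp_left (g := fun t : ℝ => (t : ℂ)) Complex.ofReal_zero).mul_left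
  have hF : MemLp (fun z : ℝ × ℝ => (η z.1 : ℂ) * v z - Complex.I * (deriv η z.1 : ℝ) * ψ z) 2
    (stripMeasure S) := (memLp_cutoff_mul hηc hηs v).sub (memLp_cutoff_mul hη'c hη's ψ)
  have hG : MemLp (fun z : ℝ × ℝ => (η z.1 : ℂ) * ψ z) 2 (stripMeasure S) :=
    memLp_cutoff_mul hηc hηs ψ
  have hFs := memLp_fourierSlice hL hF
    (fun x hx y => by simp [(hsupp x hx).1, (hsupp x hx).2]) k
  have hGs := memLp_fourierSlice hL hG (fun x hx y => by simp [(hsupp x hx).1]) k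
  have hcoef : Continuous fun y : ℝ => (p : ℂ) - B * y := by fun_prop
  -- Both sides are compared against compactly supported `g`, for which local integrability is
  -- enough and the growth of `p - By` does no harm.
  refine ae_eq_of_integral_contDiff_smul_eq (hFs.locallyIntegrable one_le_two)
    ((hGs.locallyIntegrable one_le_two).continuous_mul hcoef) fun g hg hgc => ?_
  have hg' : ContDiff ℝ ∞ fun y => (g y : ℂ) := Complex.ofRealCLM.contDiff.comp hg
  have hgc' : HasCompactSupport fun y => (g y : ℂ) :=
    hgc.comp_left (g := fun t : ℝ => (t : ℂ)) Complex.ofReal_zero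
  have hgw : Continuous fun y : ℝ => (g y : ℂ) * ((p : ℂ) - B * y) := hg'.continuous.mul hcoef
  obtain ⟨t1, t2, t3, -⟩ := tensor_test ha hac hg' hgc'
  simp only [Complex.real_smul]
  have i1 := integrable_tensor_fourier (S := S) hηc hηs hg'.continuous hgc' (-p) v
  have i2 := integrable_tensor_fourier (S := S) hη'c hη's hg'.continuous hgc' (-p) ψ
  have i3 := integrable_tensor_fourier (S := S) hηc hηs hgw hgc'.mul_right (-p) ψ
  have e1 : ∫ y in S, (g y : ℂ) * fourierSlice L k
      (fun z => η z.1 * v z - Complex.I * (deriv η z.1 : ℝ) * ψ z) y =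
      (∫ z, (planeWave (-p) z.1 * (η z.1 : ℂ) * (g z.2 : ℂ)) * v z ∂stripMeasure S) -
        ∫ z, (g z.2 : ℂ) * (planeWave (-p) z.1 * (Complex.I * (deriv η z.1 : ℝ) * ψ z))
          ∂stripMeasure S := by
    rw [integral_mul_fourierSlice (φ := fun y => (g y : ℂ)) k
      ((i1.sub i2).congr (Eventually.of_forall fun z => by
        simp only [Pi.sub_apply]; ring)), ← integral_sub (i1.congr
        (Eventually.of_forall fun z => by simp only; ring)) i2]
    refine integral_congr_ae (Eventually.of_forall fun z => ?_)
    simp only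
    ring
  have e2 : ∫ y in S, (g y : ℂ) * (((p : ℂ) - B * y) * fourierSlice L k (fun z => η z.1 * ψ z) y) =
      ∫ z, (g z.2 : ℂ) * ((p : ℂ) - B * z.2) * (planeWave (-p) z.1 * (η z.1 * ψ z))
        ∂stripMeasure S := by
    rw [← integral_mul_fourierSlice (φ := fun y : ℝ => (g y : ℂ) * ((p : ℂ) - B * y)) k i3]
    simp only [mul_assoc]
  rw [e1, e2, h.complex_test t1 t2, sub_eq_iff_eq_add, ← integral_add i3 i2]
  refine integral_congr_ae (Eventually.of_forall fun z => ?_)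
  simp only [t3, had]
  have hI := Complex.I_mul_I
  linear_combination (-p * (planeWave (-p) z.1 * η z.1 * g z.2 * ψ z)) * hI

/-- Decomposition of the strip form into fibre forms: a lower bound for all fibres of a cut-off
function is a lower bound on the strip. -/
theorem cutoff_form_lower_bound (hS : MeasurableSet S) {W : ℝ → ℝ} (hWm : Measurable W)
    (hW0 : ∀ y ∈ S, 0 ≤ W y) (hL : 0 < L) (hη : ContDiff ℝ ∞ η) (hc : HasCompactSupport η)
    (hsupp : ∀ x, x ∉ Ioc (-(L / 2)) (L / 2) → η x = 0 ∧ deriv η x = 0)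
    (hv : HasMagneticDeriv S B ψ v) (hw : HasTransverseDeriv S ψ w)
    (hWf : Integrable (fun z : ℝ × ℝ => W z.2 * ‖(η z.1 : ℂ) * ψ z‖ ^ 2) (stripMeasure S))
    {m : ℝ} (hm : 0 ≤ m)
    (hfib : ∀ (k : ℤ) (φ u : TransverseL2 S),
      φ =ᵐ[volume.restrict S] fourierSlice L k (fun z => η z.1 * ψ z) →
      HasDirichletDeriv S φ u →
      HasFinitePotentialEnergy (volume.restrict S)
        (fun y => (B * y - frequency L k) ^ 2 + W y) φ →
      m * ‖φ‖ ^ 2 ≤ ‖u‖ ^ 2 + ∫ y in S, ((B * y - frequency L k) ^ 2 + W y) * ‖φ y‖ ^ 2) :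
    m * ∫ z, ‖(η z.1 : ℂ) * ψ z‖ ^ 2 ∂stripMeasure S ≤
      (∫ z, ‖(η z.1 : ℂ) * v z - Complex.I * (deriv η z.1 : ℝ) * ψ z‖ ^ 2 ∂stripMeasure S) +
        (∫ z, ‖(η z.1 : ℂ) * w z‖ ^ 2 ∂stripMeasure S) +
        ∫ z, W z.2 * ‖(η z.1 : ℂ) * ψ z‖ ^ 2 ∂stripMeasure S := by
  have hηc : Continuous fun x => (η x : ℂ) := Complex.continuous_ofReal.comp hη.continuous
  have hηs : HasCompactSupport fun x => (η x : ℂ) :=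
    hc.comp_left (g := fun t : ℝ => (t : ℂ)) Complex.ofReal_zero
  have hη'c : Continuous fun x => Complex.I * ((deriv η x : ℝ) : ℂ) :=
    continuous_const.mul (Complex.continuous_ofReal.comp (hη.continuous_deriv (by simp)))
  have hη's : HasCompactSupport fun x => Complex.I * ((deriv η x : ℝ) : ℂ) :=
    (hc.deriv.comp_left (g := fun t : ℝ => (t : ℂ)) Complex.ofReal_zero).mul_left
  have hFψ : MemLp (fun z : ℝ × ℝ => (η z.1 : ℂ) * ψ z) 2 (stripMeasure S) :=
    memLp_cutoff_mul hηc hηs ψ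
  have hFw : MemLp (fun z : ℝ × ℝ => (η z.1 : ℂ) * w z) 2 (stripMeasure S) :=
    memLp_cutoff_mul hηc hηs w
  have hFv : MemLp (fun z : ℝ × ℝ => (η z.1 : ℂ) * v z - Complex.I * (deriv η z.1 : ℝ) * ψ z) 2
    (stripMeasure S) := (memLp_cutoff_mul hηc hηs v).sub (memLp_cutoff_mul hη'c hη's ψ)
  have sψ : ∀ x, x ∉ Ioc (-(L / 2)) (L / 2) → ∀ y, (η x : ℂ) * ψ (x, y) = 0 :=
    fun x hx y => by simp [(hsupp x hx).1]
  have sw : ∀ x, x ∉ Ioc (-(L / 2)) (L / 2) → ∀ y, (η x : ℂ) * w (x, y) = 0 :=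
    fun x hx y => by simp [(hsupp x hx).1]
  have sv : ∀ x, x ∉ Ioc (-(L / 2)) (L / 2) → ∀ y,
      (η x : ℂ) * v (x, y) - Complex.I * (deriv η x : ℝ) * ψ (x, y) = 0 :=
    fun x hx y => by simp [(hsupp x hx).1, (hsupp x hx).2]
  have hW0' : ∀ᵐ y ∂volume.restrict S, 0 ≤ W y := by
    filter_upwards [ae_restrict_mem hS] with y hy using hW0 y hy
  have hW0s : ∀ᵐ z ∂stripMeasure S, 0 ≤ W z.2 := by
    filter_upwards [ae_restrict_mem (MeasurableSet.univ.prod hS)] with z hz using hW0 _ hz.2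
  have Pψ := tsum_lintegral_fourierSlice hL hFψ sψ (ρ := fun _ => 1) aemeasurable_const
  have Pw := tsum_lintegral_fourierSlice hL hFw sw (ρ := fun _ => 1) aemeasurable_const
  have Pv := tsum_lintegral_fourierSlice hL hFv sv (ρ := fun _ => 1) aemeasurable_const
  have PW := tsum_lintegral_fourierSlice hL hFψ sψ (ρ := fun y => ENNReal.ofReal (W y))
    hWm.ennreal_ofReal.aemeasurable
  simp only [one_mul] at Pψ Pw Pv
  rw [lintegral_enorm_sq hFψ] at Pψ
  rw [lintegral_enorm_sq hFw] at Pw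
  rw [lintegral_enorm_sq hFv] at Pv
  rw [lintegral_weight hW0s hWf] at PW
  have hterm : ∀ k : ℤ,
      ENNReal.ofReal m * ∫⁻ y in S, ‖fourierSlice L k (fun z => η z.1 * ψ z) y‖ₑ ^ 2 ≤
        (∫⁻ y in S, ‖fourierSlice L k
          (fun z => η z.1 * v z - Complex.I * (deriv η z.1 : ℝ) * ψ z) y‖ₑ ^ 2) +
        (∫⁻ y in S, ‖fourierSlice L k (fun z => η z.1 * w z) y‖ₑ ^ 2) +
        ∫⁻ y in S, ENNReal.ofReal (W y) *
          ‖fourierSlice L k (fun z => η z.1 * ψ z) y‖ₑ ^ 2 := by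
    intro k
    have mψ := memLp_fourierSlice hL hFψ sψ k
    have mw := memLp_fourierSlice hL hFw sw k
    have mv := memLp_fourierSlice hL hFv sv k
    have hmag := fourierSlice_magnetic hL hη hc hsupp hv k
    -- One term of the convergent Parseval sum weighted by `W` is finite; with `IV` this puts the
    -- slice in the form domain of its fibre.
    have IW : Integrable (fun y => W y * ‖fourierSlice L k (fun z => η z.1 * ψ z) y‖ ^ 2)
        (volume.restrict S) := by
      refine integrable_weight hW0' hWm.aemeasurable mψ.1 ?_
      have h1 := ENNReal.le_tsum (f := fun k => ∫⁻ y in S, ENNReal.ofReal (W y) *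
        ‖fourierSlice L k (fun z => (η z.1 : ℂ) * ψ z) y‖ₑ ^ 2) k
      rw [PW] at h1
      exact (h1.trans_lt (ENNReal.mul_lt_top ENNReal.ofReal_lt_top ENNReal.ofReal_lt_top)).ne
    have emag : (fun y => ‖fourierSlice L k
        (fun z => η z.1 * v z - Complex.I * (deriv η z.1 : ℝ) * ψ z) y‖ ^ 2) =ᵐ[volume.restrict S]
        fun y => (B * y - frequency L k) ^ 2 *
          ‖fourierSlice L k (fun z => η z.1 * ψ z) y‖ ^ 2 := by
      filter_upwards [hmag] with y hy
      rw [hy, norm_mul, mul_pow]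
      congr 1
      rw [← Complex.ofReal_mul, ← Complex.ofReal_sub, Complex.norm_real, Real.norm_eq_abs, sq_abs]
      ring
    have IV := ((memLp_two_iff_integrable_sq_norm mv.1).mp mv).congr emag
    obtain ⟨φ, hcψ⟩ : ∃ φ : TransverseL2 S, φ =ᵐ[volume.restrict S]
      fourierSlice L k (fun z => η z.1 * ψ z) := ⟨mψ.toLp, mψ.coeFn_toLp⟩
    obtain ⟨u, hcw⟩ : ∃ u : TransverseL2 S, u =ᵐ[volume.restrict S]
      fourierSlice L k (fun z => η z.1 * w z) := ⟨mw.toLp, mw.coeFn_toLp⟩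
    have hVeq : (fun y => ((B * y - frequency L k) ^ 2 + W y) * ‖φ y‖ ^ 2)
        =ᵐ[volume.restrict S] fun y => ‖fourierSlice L k
          (fun z => η z.1 * v z - Complex.I * (deriv η z.1 : ℝ) * ψ z) y‖ ^ 2 +
          W y * ‖fourierSlice L k (fun z => η z.1 * ψ z) y‖ ^ 2 := by
      filter_upwards [hcψ, emag] with y h1 h2
      rw [h1, h2]; ring
    have hfin : HasFinitePotentialEnergy (volume.restrict S)
        (fun y => (B * y - frequency L k) ^ 2 + W y) φ :=
      (((memLp_two_iff_integrable_sq_norm mv.1).mp mv).add IW).congr hVeq.symm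
    have h1 := hfib k φ u hcψ
      (fourierSlice_hasDirichletDeriv hη hc hw k hcψ hcw) hfin
    have n1 : ∫ y in S, ‖φ y‖ ^ 2 =
        ∫ y in S, ‖fourierSlice L k (fun z => η z.1 * ψ z) y‖ ^ 2 :=
      integral_congr_ae (by filter_upwards [hcψ] with y hy; rw [hy])
    have n2 : ∫ y in S, ‖u y‖ ^ 2 =
        ∫ y in S, ‖fourierSlice L k (fun z => η z.1 * w z) y‖ ^ 2 :=
      integral_congr_ae (by filter_upwards [hcw] with y hy; rw [hy])
    rw [norm_sq_eq_integral, norm_sq_eq_integral, integral_congr_ae hVeq,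
      integral_add ((memLp_two_iff_integrable_sq_norm mv.1).mp mv) IW,
      n1, n2] at h1
    rw [lintegral_enorm_sq mψ, lintegral_enorm_sq mw, lintegral_enorm_sq mv,
      lintegral_weight hW0' IW, ← ENNReal.ofReal_mul hm,
      ← ENNReal.ofReal_add (integral_nonneg fun _ => sq_nonneg _)
        (integral_nonneg fun _ => sq_nonneg _),
      ← ENNReal.ofReal_add (add_nonneg (integral_nonneg fun _ => sq_nonneg _)
        (integral_nonneg fun _ => sq_nonneg _)) (integral_nonneg_of_ae (by
          filter_upwards [hW0'] with y hy using mul_nonneg hy (sq_nonneg _)))]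
    exact ENNReal.ofReal_le_ofReal (by linarith)
  -- The fibre inequalities are summed by Parseval; every total carries the same factor `L`, which
  -- cancels at the end.
  have hsum := ENNReal.tsum_le_tsum hterm
  rw [ENNReal.tsum_mul_left, ENNReal.tsum_add, ENNReal.tsum_add, Pψ, Pw, Pv, PW] at hsum
  have nv : 0 ≤ ∫ z, ‖(η z.1 : ℂ) * v z - Complex.I * (deriv η z.1 : ℝ) * ψ z‖ ^ 2
    ∂stripMeasure S := integral_nonneg fun _ => sq_nonneg _
  have nw : 0 ≤ ∫ z, ‖(η z.1 : ℂ) * w z‖ ^ 2 ∂stripMeasure S := integral_nonneg fun _ => sq_nonneg _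
  have nW : 0 ≤ ∫ z, W z.2 * ‖(η z.1 : ℂ) * ψ z‖ ^ 2 ∂stripMeasure S := integral_nonneg_of_ae (by
    filter_upwards [hW0s] with y hy using mul_nonneg hy (sq_nonneg _))
  rw [← ENNReal.ofReal_mul hL.le, ← ENNReal.ofReal_mul hL.le, ← ENNReal.ofReal_mul hL.le,
    ← ENNReal.ofReal_mul hL.le, ← ENNReal.ofReal_mul hm, ← ENNReal.ofReal_add (by positivity)
    (by positivity), ← ENNReal.ofReal_add (by positivity) (by positivity),
    ENNReal.ofReal_le_ofReal_iff (by positivity)] at hsum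
  refine le_of_mul_le_mul_left ?_ hL
  linarith

end PartialFourier

/-! ### Growth of the fibre potential -/

section Geometry

variable {S : Set ℝ} {W : ℝ → ℝ} {c : ℝ}

theorem measurableSet_section (hS : (∃ a : ℝ, 0 < a ∧ S = Set.Ioo (-a) a) ∨ S = Set.univ) :
    MeasurableSet S := by
  rcases hS with ⟨a, -, rfl⟩ | rfl
  · exact measurableSet_Ioo
  · exact MeasurableSet.univ

/-- On an interval the condition is vacuous beyond `Y = a`. On the line `c y²` provides the growth.
-/
theorem fibre_potential_confining (hS : (∃ a : ℝ, 0 < a ∧ S = Set.Ioo (-a) a) ∨ S = Set.univ)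
    (hcS : S = Set.univ → 0 < c) (hW : ∀ y ∈ S, c * y ^ 2 ≤ W y) (B p M : ℝ) :
    ∃ Y : ℝ, ∀ y ∈ S, Y < |y| → M ≤ (B * y - p) ^ 2 + W y := by
  rcases hS with ⟨a, -, rfl⟩ | h
  · exact ⟨a, fun y hy h => absurd h (not_lt.mpr (abs_le.mpr ⟨hy.1.le, hy.2.le⟩))⟩
  · have hc := hcS h
    refine ⟨|M| / c + 1, fun y hy h => ?_⟩
    have h1 := hW y hy
    have h0 : 0 ≤ |M| / c := by positivity
    have h2 : |M| / c ≤ |y| ^ 2 := by nlinarith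
    rw [sq_abs, div_le_iff₀ hc] at h2
    have h3 := le_abs_self M
    have h4 := sq_nonneg (B * y - p)
    linarith

/-- A large momentum costs energy uniformly in `y`. On an interval `By` is bounded and `(By - p)² ≥
p²/2 - (By)²`. On the line the minimum over `y` of `(By - p)² + c y²` is `c p² / (B² + c)`, which is
where `c > 0` enters. -/
theorem fibre_potential_coercive (hS : (∃ a : ℝ, 0 < a ∧ S = Set.Ioo (-a) a) ∨ S = Set.univ)
    (hc : 0 ≤ c) (hcS : S = Set.univ → 0 < c) (hW : ∀ y ∈ S, c * y ^ 2 ≤ W y) (B : ℝ) :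
    ∃ κ > 0, ∃ C : ℝ, ∀ p, ∀ y ∈ S, κ * p ^ 2 - C ≤ (B * y - p) ^ 2 + W y := by
  rcases hS with ⟨a, -, rfl⟩ | h
  · refine ⟨1 / 2, by norm_num, B ^ 2 * a ^ 2, fun p y hy => ?_⟩
    have h1 := hW y hy
    have h2 : 0 ≤ c * y ^ 2 := by positivity
    have h3 : y ^ 2 ≤ a ^ 2 := sq_le_sq' hy.1.le hy.2.le
    have h4 : B ^ 2 * y ^ 2 ≤ B ^ 2 * a ^ 2 := by gcongr
    nlinarith [sq_nonneg (2 * (B * y) - p)]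
  · have hc := hcS h
    have hpos : 0 < B ^ 2 + c := by positivity
    refine ⟨c / (B ^ 2 + c), by positivity, 0, fun p y hy => ?_⟩
    have h1 := hW y hy
    have h2 : (B * y - p) ^ 2 + c * y ^ 2 - c / (B ^ 2 + c) * p ^ 2 =
        (B ^ 2 + c) * (y - B * p / (B ^ 2 + c)) ^ 2 := by
      field_simp
      ring
    have h3 : 0 ≤ (B ^ 2 + c) * (y - B * p / (B ^ 2 + c)) ^ 2 := by positivity
    linarith

end Geometry

/-! ### Slowly varying cutoffs and their localization errors -/

section Cutoff

/-- Smooth cut-off functions with slope inversely proportional to their scale. -/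
theorem exists_slow_cutoff : ∃ D : ℝ, 0 ≤ D ∧ ∀ r : ℝ, 0 < r → ∃ η : ℝ → ℝ, ContDiff ℝ ∞ η ∧
    HasCompactSupport η ∧ (∀ x, 0 ≤ η x) ∧ (∀ x, η x ≤ 1) ∧ (∀ x, |x| ≤ r → η x = 1) ∧
      (∀ x, 2 * r ≤ |x| → η x = 0 ∧ deriv η x = 0) ∧ ∀ x, |deriv η x| ≤ D / r := by
  obtain ⟨θ, hθs, hθc, hθ0, hθ1, hθin, hθout⟩ := exists_smooth_cutoff one_pos
  obtain ⟨D, hD⟩ : ∃ D, ∀ y, ‖deriv θ y‖ ≤ D :=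
    hθc.deriv.exists_bound_of_continuous (hθs.continuous_deriv (by simp))
  have hD0 : 0 ≤ D := (norm_nonneg _).trans (hD 0)
  refine ⟨D, hD0, fun r hr => ?_⟩
  have habs : ∀ x, |r⁻¹ * x| = |x| / r := fun x => by
    rw [abs_mul, abs_of_pos (inv_pos.mpr hr), inv_mul_eq_div]
  have hzero : ∀ x, 2 * r ≤ |x| → θ (r⁻¹ * x) = 0 := fun x hx => hθout _ (by
    rw [habs, le_div_iff₀ hr]; linarith)
  have hder : ∀ x, HasDerivAt (fun x => θ (r⁻¹ * x)) (deriv θ (r⁻¹ * x) * r⁻¹) x := fun x => by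
    have h1 : HasDerivAt (fun x => r⁻¹ * x) r⁻¹ x := by simpa using (hasDerivAt_id x).const_mul r⁻¹
    exact ((hθs.differentiable (by simp) _).hasDerivAt).comp x h1
  refine ⟨fun x => θ (r⁻¹ * x), hθs.comp (contDiff_const.mul contDiff_id), ?_, fun x => hθ0 _,
    fun x => hθ1 _, fun x hx => hθin _ ?_, fun x hx => ⟨hzero x hx, ?_⟩, fun x => ?_⟩
  · refine HasCompactSupport.intro (isCompact_Icc (a := -(2 * r)) (b := 2 * r)) fun x hx => ?_
    refine hzero x ?_
    by_contra hcon
    rw [not_le, abs_lt] at hcon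
    exact hx ⟨hcon.1.le, hcon.2.le⟩
  · rw [habs, div_le_one hr]; exact hx
  · have : IsLocalMin (fun x => θ (r⁻¹ * x)) x := Eventually.of_forall fun z => by
      simp only [hzero x hx]; exact hθ0 _
    exact this.deriv_eq_zero
  · rw [(hder x).deriv, abs_mul, abs_of_pos (inv_pos.mpr hr), ← div_eq_mul_inv]
    gcongr
    exact hD _

variable {S : Set ℝ} {B : ℝ} {ψ v w : StripL2 S} {η : ℝ → ℝ}

theorem integral_cutoff_le (h0 : ∀ x, 0 ≤ η x) (h1 : ∀ x, η x ≤ 1) :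
    ∫ z, ‖(η z.1 : ℂ) * w z‖ ^ 2 ∂stripMeasure S ≤ ‖w‖ ^ 2 := by
  rw [norm_sq_eq_integral]
  refine integral_mono_of_nonneg (Eventually.of_forall fun _ => sq_nonneg _) (integrable_norm_sq w)
    (Eventually.of_forall fun z => ?_)
  simp only [norm_mul, Complex.norm_real, Real.norm_of_nonneg (h0 _)]
  have := mul_le_of_le_one_left (norm_nonneg (w z)) (h1 z.1)
  have h2 : 0 ≤ η z.1 * ‖w z‖ := mul_nonneg (h0 _) (norm_nonneg _)
  gcongr

/-- The cross term is split by `2ε‖v‖‖ψ‖ ≤ ε(‖v‖² + ‖ψ‖²)`, so the whole error vanishes with the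
slope `ε`. -/
theorem integral_cutoff_magnetic_le (h0 : ∀ x, 0 ≤ η x) (h1 : ∀ x, η x ≤ 1) {ε : ℝ}
    (hε : 0 ≤ ε) (hd : ∀ x, |deriv η x| ≤ ε) :
    ∫ z, ‖(η z.1 : ℂ) * v z - Complex.I * (deriv η z.1 : ℝ) * ψ z‖ ^ 2 ∂stripMeasure S ≤
      (1 + ε) * ‖v‖ ^ 2 + (ε + ε ^ 2) * ‖ψ‖ ^ 2 := by
  rw [norm_sq_eq_integral v, norm_sq_eq_integral ψ, ← integral_const_mul, ← integral_const_mul,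
    ← integral_add ((integrable_norm_sq v).const_mul _) ((integrable_norm_sq ψ).const_mul _)]
  refine integral_mono_of_nonneg (Eventually.of_forall fun _ => sq_nonneg _)
    (((integrable_norm_sq v).const_mul _).add ((integrable_norm_sq ψ).const_mul _))
    (Eventually.of_forall fun z => ?_)
  have h2 : ‖(η z.1 : ℂ) * v z - Complex.I * (deriv η z.1 : ℝ) * ψ z‖ ≤ ‖v z‖ + ε * ‖ψ z‖ := by
    refine (norm_sub_le _ _).trans ?_
    simp only [norm_mul, Complex.norm_real, Complex.norm_I, one_mul, Real.norm_of_nonneg (h0 _)]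
    have := mul_le_of_le_one_left (norm_nonneg (v z)) (h1 z.1)
    have := mul_le_mul_of_nonneg_right (hd z.1) (norm_nonneg (ψ z))
    rw [Real.norm_eq_abs]
    linarith
  calc ‖(η z.1 : ℂ) * v z - Complex.I * (deriv η z.1 : ℝ) * ψ z‖ ^ 2 ≤ (‖v z‖ + ε * ‖ψ z‖) ^ 2 := by
        gcongr
    _ ≤ (1 + ε) * ‖v z‖ ^ 2 + (ε + ε ^ 2) * ‖ψ z‖ ^ 2 := by
        nlinarith [mul_nonneg hε (sq_nonneg (‖v z‖ - ‖ψ z‖))]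

theorem integrable_cutoff_potential (hη : Continuous η) (h0 : ∀ x, 0 ≤ η x) (h1 : ∀ x, η x ≤ 1)
    {P : ℝ × ℝ → ℝ} (hP : HasFinitePotentialEnergy (stripMeasure S) P ψ) :
    Integrable (fun z : ℝ × ℝ => P z * ‖(η z.1 : ℂ) * ψ z‖ ^ 2) (stripMeasure S) := by
  have hP' : Integrable (fun z => P z * ‖ψ z‖ ^ 2) (stripMeasure S) := hP
  have h2 := hP'.bdd_mul (f := fun z : ℝ × ℝ => η z.1 ^ 2) (c := 1)
    (((hη.comp continuous_fst).pow 2).aestronglyMeasurable) (Eventually.of_forall fun z => by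
      rw [Real.norm_of_nonneg (sq_nonneg _)]
      exact pow_le_one₀ (h0 _) (h1 _))
  refine h2.congr (Eventually.of_forall fun z => ?_)
  simp only [norm_mul, Complex.norm_real, Real.norm_of_nonneg (h0 _)]
  ring

theorem integral_cutoff_potential_le (hS : MeasurableSet S) {W : ℝ → ℝ} (hW0 : ∀ y ∈ S, 0 ≤ W y)
    (hη : Continuous η) (h0 : ∀ x, 0 ≤ η x) (h1 : ∀ x, η x ≤ 1)
    (hP : HasFinitePotentialEnergy (stripMeasure S) (fun z => W z.2) ψ) :
    ∫ z, W z.2 * ‖(η z.1 : ℂ) * ψ z‖ ^ 2 ∂stripMeasure S ≤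
      ∫ z, W z.2 * ‖ψ z‖ ^ 2 ∂stripMeasure S := by
  refine integral_mono_ae (integrable_cutoff_potential hη h0 h1 hP) hP ?_
  filter_upwards [ae_restrict_mem (MeasurableSet.univ.prod hS)] with z hz
  have hz' := hW0 _ hz.2
  simp only [norm_mul, Complex.norm_real, Real.norm_of_nonneg (h0 _)]
  have := mul_le_of_le_one_left (norm_nonneg (ψ z)) (h1 z.1)
  have h2 : 0 ≤ η z.1 * ‖ψ z‖ := mul_nonneg (h0 _) (norm_nonneg _)
  gcongr

end Cutoff

/-! ### Lower bounds on the strip, free and perturbed -/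

section LowerBounds

variable {S : Set ℝ} {B : ℝ} {W : ℝ → ℝ}

/-- The free strip form lies above any common lower bound of the fibre forms. -/
theorem strip_form_lower_bound (hS : MeasurableSet S) (hWm : Measurable W)
    (hW0 : ∀ y ∈ S, 0 ≤ W y) {m : ℝ} (hm : 0 ≤ m)
    (hfib : ∀ (p : ℝ) (φ u : TransverseL2 S), HasDirichletDeriv S φ u →
      HasFinitePotentialEnergy (volume.restrict S) (fun y => (B * y - p) ^ 2 + W y) φ →
      m * ‖φ‖ ^ 2 ≤ ‖u‖ ^ 2 + ∫ y in S, ((B * y - p) ^ 2 + W y) * ‖φ y‖ ^ 2)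
    {ψ v w : StripL2 S} (h : (ψ, v, w) ∈ stripFormDomain S B fun z => W z.2) :
    m * ‖ψ‖ ^ 2 ≤ ‖v‖ ^ 2 + ‖w‖ ^ 2 + ∫ z, W z.2 * ‖ψ z‖ ^ 2 ∂stripMeasure S := by
  obtain ⟨hv, hw, hP⟩ := h
  obtain ⟨D, hD, hcut⟩ := exists_slow_cutoff
  choose η hηs hηc hη0 hη1 hηin hηout hηd using fun n : ℕ =>
    hcut ((n : ℝ) + 1) (by positivity)
  set q := ‖v‖ ^ 2 + ‖w‖ ^ 2 + ∫ z, W z.2 * ‖ψ z‖ ^ 2 ∂stripMeasure S with hq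
  have hbound : ∀ n : ℕ, m * ∫ z, ‖(η n z.1 : ℂ) * ψ z‖ ^ 2 ∂stripMeasure S ≤
      q + (D * (1 / ((n : ℝ) + 1)) * ‖v‖ ^ 2 + (D * (1 / ((n : ℝ) + 1)) +
        (D * (1 / ((n : ℝ) + 1))) ^ 2) * ‖ψ‖ ^ 2) := by
    intro n
    have hr : (0 : ℝ) < (n : ℝ) + 1 := by positivity
    -- The cutoff vanishes once `|x|` reaches twice its scale `n + 1`, hence outside half a period
    -- `L / 2`. The bound on the cut-off function passes to `ψ` as `n → ∞`.
    have h1 := cutoff_form_lower_bound hS hWm hW0 (L := 4 * ((n : ℝ) + 1)) (by positivity)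
      (hηs n) (hηc n) (fun x hx => hηout n x (by
        by_contra hcon
        rw [not_le, abs_lt] at hcon
        exact hx ⟨by linarith [hcon.1], by linarith [hcon.2]⟩)) hv hw
      (integrable_cutoff_potential (hηs n).continuous (hη0 n) (hη1 n) hP) hm
      (fun k φ u _ hd hf => hfib _ φ u hd hf)
    have h2 := integral_cutoff_magnetic_le (v := v) (ψ := ψ) (hη0 n) (hη1 n)
      (div_nonneg hD hr.le) (hηd n)
    have h3 := integral_cutoff_le (w := w) (hη0 n) (hη1 n)
    have h4 := integral_cutoff_potential_le hS hW0 (hηs n).continuous (hη0 n) (hη1 n) hP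
    rw [div_eq_mul_one_div] at h2
    rw [hq]
    linarith
  have hlim : Tendsto (fun n => m * ∫ z, ‖(η n z.1 : ℂ) * ψ z‖ ^ 2 ∂stripMeasure S) atTop
      (𝓝 (m * ‖ψ‖ ^ 2)) := by
    refine Tendsto.const_mul _ ?_
    rw [norm_sq_eq_integral]
    refine tendsto_integral_of_dominated_convergence (fun z => ‖ψ z‖ ^ 2) (fun n => ?_)
      (integrable_norm_sq ψ) (fun n => Eventually.of_forall fun z => ?_)
      (Eventually.of_forall fun z => ?_)
    · exact ((((Complex.continuous_ofReal.comp (hηs n).continuous).comp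
        continuous_fst).aestronglyMeasurable).mul (Lp.aestronglyMeasurable ψ)).norm.pow 2
    · rw [Real.norm_of_nonneg (sq_nonneg _), norm_mul, Complex.norm_real,
        Real.norm_of_nonneg (hη0 n _)]
      have := mul_le_of_le_one_left (norm_nonneg (ψ z)) (hη1 n z.1)
      have h2 : 0 ≤ η n z.1 * ‖ψ z‖ := mul_nonneg (hη0 n _) (norm_nonneg _)
      gcongr
    · refine tendsto_const_nhds.congr' ?_
      filter_upwards [eventually_ge_atTop ⌈|z.1|⌉₊] with n hn
      rw [hηin n z.1 ((Nat.ceil_le.mp hn).trans (by linarith))]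
      simp
  have hlim2 : Tendsto (fun n : ℕ => q + (D * (1 / ((n : ℝ) + 1)) * ‖v‖ ^ 2 +
      (D * (1 / ((n : ℝ) + 1)) + (D * (1 / ((n : ℝ) + 1))) ^ 2) * ‖ψ‖ ^ 2)) atTop (𝓝 q) := by
    have h0 : Tendsto (fun n : ℕ => D * (1 / ((n : ℝ) + 1))) atTop (𝓝 0) := by
      simpa using tendsto_one_div_add_atTop_nhds_zero_nat.const_mul D
    have h1 := ((h0.mul_const (‖v‖ ^ 2)).add ((h0.add (h0.pow 2)).mul_const (‖ψ‖ ^ 2))).const_add q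
    simpa using h1
  exact le_of_tendsto_of_tendsto' hlim hlim2 hbound

theorem memLp_tensor {a g : ℝ → ℂ} (ha : MemLp a 2 volume) (hg : MemLp g 2 (volume.restrict S)) :
    MemLp (fun z : ℝ × ℝ => a z.1 * g z.2) 2 (stripMeasure S) := by
  rw [stripMeasure_eq_prod]
  have hm : AEStronglyMeasurable (fun z : ℝ × ℝ => a z.1 * g z.2)
    (volume.prod (volume.restrict S)) := ha.1.comp_fst.mul hg.1.comp_snd
  rw [memLp_two_iff_integrable_sq_norm hm]
  have := ((memLp_two_iff_integrable_sq_norm ha.1).mp ha).mul_prod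
    ((memLp_two_iff_integrable_sq_norm hg.1).mp hg)
  simpa only [norm_mul, mul_pow] using! this

/-- The free form controls the mass in a bounded part of the strip with an arbitrarily small
constant on a subspace of finite codimension. -/
theorem exists_finite_local_compactness (hS : MeasurableSet S) (hWm : Measurable W)
    (hW0 : ∀ y ∈ S, 0 ≤ W y)
    (hconf : ∀ p M : ℝ, ∃ Y : ℝ, ∀ y ∈ S, Y < |y| → M ≤ (B * y - p) ^ 2 + W y)
    (hcoer : ∃ κ > 0, ∃ C : ℝ, ∀ p, ∀ y ∈ S, κ * p ^ 2 - C ≤ (B * y - p) ^ 2 + W y)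
    {η : ℝ → ℝ} (hηs : ContDiff ℝ ∞ η) (hηc : HasCompactSupport η) (hη0 : ∀ x, 0 ≤ η x)
    (hη1 : ∀ x, η x ≤ 1) {δ : ℝ} (hδ : 0 < δ) :
    ∃ G : Set (StripL2 S), G.Finite ∧ ∀ ψ v w : StripL2 S,
      (ψ, v, w) ∈ stripFormDomain S B (fun z => W z.2) → (∀ g ∈ G, inner ℂ g ψ = 0) →
      ∫ z, ‖(η z.1 : ℂ) * ψ z‖ ^ 2 ∂stripMeasure S ≤
        δ * (‖v‖ ^ 2 + ‖w‖ ^ 2 + (∫ z, W z.2 * ‖ψ z‖ ^ 2 ∂stripMeasure S) + ‖ψ‖ ^ 2) := by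
  obtain ⟨κ, hκ, C, hcoer⟩ := hcoer
  obtain ⟨D, hD⟩ : ∃ D, ∀ y, ‖deriv η y‖ ≤ D :=
    hηc.deriv.exists_bound_of_continuous (hηs.continuous_deriv (by simp))
  have hD0 : 0 ≤ D := (norm_nonneg _).trans (hD 0)
  obtain ⟨r, hr0, hr⟩ : ∃ r : ℝ, 0 < r ∧ ∀ x, r ≤ |x| → η x = 0 := by
    obtain ⟨r, hr⟩ := hηc.isCompact.isBounded.subset_closedBall (0 : ℝ)
    refine ⟨|r| + 1, by positivity, fun x hx => image_eq_zero_of_notMem_tsupport fun hx' => ?_⟩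
    have h1 := hr hx'
    rw [mem_closedBall_zero_iff, Real.norm_eq_abs] at h1
    linarith [le_abs_self r]
  set L := 2 * r with hLdef
  have hL : 0 < L := by positivity
  have hsupp : ∀ x, x ∉ Ioc (-(L / 2)) (L / 2) → η x = 0 ∧ deriv η x = 0 := by
    intro x hx
    have h1 : η x = 0 := hr x (by
      by_contra hcon
      rw [not_le, abs_lt] at hcon
      exact hx ⟨by linarith [hcon.1], by linarith [hcon.2]⟩)
    exact ⟨h1, IsLocalMin.deriv_eq_zero (Eventually.of_forall fun z => by rw [h1]; exact hη0 z)⟩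
  -- `A` dominates the constants `1 + D` and `D + D²` of `integral_cutoff_magnetic_le`; the level `M
  -- = A / δ` then yields the factor `δ`.
  set A := 1 + D + D ^ 2 with hA
  have hA0 : 0 < A := by positivity
  set M := A / δ with hM
  have hM0 : 0 < M := by positivity
  choose G hG hess using fun k : ℤ => exists_finite_transverse_lower_bound hS
    (V := fun y => (B * y - frequency L k) ^ 2 + W y)
    (fun y hy => add_nonneg (sq_nonneg _) (hW0 y hy)) (hconf (frequency L k)) M
  have ha : ∀ k : ℤ, MemLp (fun x => planeWave (-frequency L k) x * (η x : ℂ)) 2 volume := fun k => by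
    obtain ⟨h1, h2, -⟩ := cutoff_planeWave hηs hηc (frequency L k)
    exact h1.continuous.memLp_of_hasCompactSupport h2
  have hK : ∀ (k : ℤ) (g : TransverseL2 S), MemLp (fun z : ℝ × ℝ =>
      (planeWave (-frequency L k) z.1 * (η z.1 : ℂ)) * conj (g z.2)) 2 (stripMeasure S) :=
    fun k g => memLp_tensor (ha k) (memLp_conj (Lp.memLp g))
  -- The second summand adds one to the bound on `|p_k|`: from `|p_k| ≥ X + 1` and `X ≥ 0` follows
  -- `p_k² ≥ X`, with `X = (M + |C|) / κ`.
  obtain ⟨N, hN⟩ := exists_nat_ge ((M + |C|) / κ / (2 * Real.pi / L) + L / (2 * Real.pi))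
  -- The condition that the `k`-th slice of `ηψ` be orthogonal to `g` is, by Fubini, orthogonality
  -- of `ψ` to one function on the strip. For `|k| > N` no condition is needed, since there the
  -- fibre potential alone is at least `M`.
  refine ⟨⋃ k ∈ Icc (-(N : ℤ)) N, (fun g => (memLp_conj (hK k g)).toLp) '' G k,
    (Set.finite_Icc _ _).biUnion fun k _ => (hG k).image _, fun ψ v w h hg => ?_⟩
  obtain ⟨hv, hw, hP⟩ := h
  have h1 := cutoff_form_lower_bound hS hWm hW0 hL hηs hηc hsupp hv hw
    (integrable_cutoff_potential hηs.continuous hη0 hη1 hP) hM0.le (fun k φ u hφ hd hf => by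
      by_cases hk : k ∈ Icc (-(N : ℤ)) N
      · refine hess k φ u hd hf fun g hgG => ?_
        have h2 := hg _ (mem_biUnion hk ⟨g, hgG, rfl⟩)
        simp only at h2
        rw [inner_conj_toLp (hK k g)] at h2
        have h3 := integrable_mul_of_memLp (hK k g) ψ
        have h4 : Integrable (fun z : ℝ × ℝ => conj (g z.2) *
            (planeWave (-frequency L k) z.1 * ((η z.1 : ℂ) * ψ z))) (stripMeasure S) :=
          h3.congr (Eventually.of_forall fun z => by simp only; ring)
        have h5 := integral_mul_fourierSlice (φ := fun y => conj (g y)) k h4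
        rw [inner_eq_integral]
        calc ∫ y in S, conj (g y) * φ y
            = ∫ y in S, conj (g y) * fourierSlice L k (fun z => η z.1 * ψ z) y :=
              integral_congr_ae (by filter_upwards [hφ] with y hy; rw [hy])
          _ = _ := h5
          _ = _ := integral_congr_ae (Eventually.of_forall fun z => by simp only; ring)
          _ = 0 := h2
      · have hk' : (N : ℝ) ≤ |(k : ℝ)| := by
          have : (N : ℤ) ≤ |k| := by
            by_contra hcon
            rw [not_le, abs_lt] at hcon
            exact hk ⟨hcon.1.le, hcon.2.le⟩
          exact_mod_cast this
        have hpos : 0 < 2 * Real.pi / L := by positivity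
        have hfreq : |frequency L k| = |(k : ℝ)| * (2 * Real.pi / L) := by
          rw [← abs_of_pos hpos, ← abs_mul, frequency]
          congr 1; ring
        have hbig : (M + |C|) / κ ≤ frequency L k ^ 2 := by
          have e1 : (M + |C|) / κ + 1 ≤ |frequency L k| := by
            rw [hfreq]
            calc (M + |C|) / κ + 1 = ((M + |C|) / κ / (2 * Real.pi / L) + L / (2 * Real.pi)) *
                  (2 * Real.pi / L) := by
                    field_simp
              _ ≤ |(k : ℝ)| * (2 * Real.pi / L) := by gcongr; exact hN.trans hk'
          have e2 : 0 ≤ (M + |C|) / κ := by positivity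
          rw [← sq_abs]
          nlinarith
        rw [div_le_iff₀ hκ] at hbig
        have hVM : ∀ y ∈ S, M ≤ (B * y - frequency L k) ^ 2 + W y := fun y hy => by
          have := hcoer (frequency L k) y hy
          have := le_abs_self C
          linarith
        have h2 : M * ‖φ‖ ^ 2 ≤ ∫ y in S, ((B * y - frequency L k) ^ 2 + W y) * ‖φ y‖ ^ 2 := by
          rw [norm_sq_eq_integral, ← integral_const_mul]
          refine integral_mono_ae ((integrable_norm_sq φ).const_mul _) hf ?_
          filter_upwards [ae_restrict_mem hS] with y hy
          exact mul_le_mul_of_nonneg_right (hVM y hy) (sq_nonneg _)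
        linarith [sq_nonneg ‖u‖])
  have h2 := integral_cutoff_magnetic_le (v := v) (ψ := ψ) hη0 hη1 hD0 hD
  have h3 := integral_cutoff_le (w := w) hη0 hη1
  have h4 := integral_cutoff_potential_le hS hW0 hηs.continuous hη0 hη1 hP
  have hWn : 0 ≤ ∫ z, W z.2 * ‖ψ z‖ ^ 2 ∂stripMeasure S := integral_nonneg_of_ae (by
    filter_upwards [ae_restrict_mem (MeasurableSet.univ.prod hS)] with z hz
    exact mul_nonneg (hW0 _ hz.2) (sq_nonneg _))
  set q := ∫ z, W z.2 * ‖ψ z‖ ^ 2 ∂stripMeasure S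
  set I := ∫ z, ‖(η z.1 : ℂ) * ψ z‖ ^ 2 ∂stripMeasure S
  have h5 : M * I ≤ A * (‖v‖ ^ 2 + ‖w‖ ^ 2 + q + ‖ψ‖ ^ 2) := by
    have e1 : (0 : ℝ) ≤ D + D ^ 2 := by positivity
    have e2 := mul_nonneg e1 (sq_nonneg ‖w‖)
    have e3 := mul_nonneg e1 hWn
    have e4 := mul_nonneg (sq_nonneg D) (sq_nonneg ‖v‖)
    have e5 := sq_nonneg ‖ψ‖
    rw [hA]
    linarith
  have h6 : A * I ≤ A * (δ * (‖v‖ ^ 2 + ‖w‖ ^ 2 + q + ‖ψ‖ ^ 2)) := by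
    rw [hM, div_mul_eq_mul_div, div_le_iff₀ hδ] at h5
    linarith
  exact le_of_mul_le_mul_left h6 hA0

/-- Below any common lower bound of the fibre forms, the perturbed form is bounded below on a
subspace of finite codimension. -/
theorem exists_finite_perturbed_lower_bound (hS : MeasurableSet S) (hWm : Measurable W)
    (hW0 : ∀ y ∈ S, 0 ≤ W y)
    (hconf : ∀ p M : ℝ, ∃ Y : ℝ, ∀ y ∈ S, Y < |y| → M ≤ (B * y - p) ^ 2 + W y)
    (hcoer : ∃ κ > 0, ∃ C : ℝ, ∀ p, ∀ y ∈ S, κ * p ^ 2 - C ≤ (B * y - p) ^ 2 + W y)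
    {U : ℝ × ℝ → ℝ} (hUm : AEStronglyMeasurable U (stripMeasure S)) {b : ℝ} (hb : 0 ≤ b)
    (hUb : ∀ᵐ z ∂stripMeasure S, |U z| ≤ b)
    (hUlim : ∀ ε > 0, ∃ R : ℝ, ∀ᵐ z ∂stripMeasure S, R ≤ |z.1| → |U z| ≤ ε)
    {e : ℝ} (he : 0 ≤ e)
    (hfib : ∀ (p : ℝ) (φ u : TransverseL2 S), HasDirichletDeriv S φ u →
      HasFinitePotentialEnergy (volume.restrict S) (fun y => (B * y - p) ^ 2 + W y) φ →
      e * ‖φ‖ ^ 2 ≤ ‖u‖ ^ 2 + ∫ y in S, ((B * y - p) ^ 2 + W y) * ‖φ y‖ ^ 2)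
    {m : ℝ} (hm : m < e) :
    ∃ G : Set (StripL2 S), G.Finite ∧ ∀ ψ v w : StripL2 S,
      (ψ, v, w) ∈ stripFormDomain S B (fun z => W z.2 + U z) → (∀ g ∈ G, inner ℂ g ψ = 0) →
      m * ‖ψ‖ ^ 2 ≤
        ‖v‖ ^ 2 + ‖w‖ ^ 2 + ∫ z, (W z.2 + U z) * ‖ψ z‖ ^ 2 ∂stripMeasure S := by
  set ε := (e - m) / 2 with hε
  have hε0 : 0 < ε := by rw [hε]; linarith
  obtain ⟨R, hR⟩ := hUlim ε hε0
  obtain ⟨D, hD, hcut⟩ := exists_slow_cutoff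
  obtain ⟨η, hηs, hηc, hη0, hη1, hηin, -, -⟩ := hcut (|R| + 1) (by positivity)
  -- Chosen so that `bδ(e + 1) ≤ min ε 1`. With free energy `q ≥ e‖ψ‖²`, the perturbed one is at
  -- least `(1 - bδ) q - (ε + bδ)‖ψ‖² ≥ (e - 2ε)‖ψ‖² = m‖ψ‖²`; the `1` in the minimum keeps `1 - bδ`
  -- nonnegative.
  set δ := min ε 1 / ((b + 1) * (e + 1)) with hδ
  have hmin : 0 < min ε 1 := lt_min hε0 one_pos
  have hδ0 : 0 < δ := by positivity
  obtain ⟨G, hG, hcomp⟩ := exists_finite_local_compactness hS hWm hW0 hconf hcoer hηs hηc hη0 hη1 hδ0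
  refine ⟨G, hG, fun ψ v w h hg => ?_⟩
  obtain ⟨hv, hw, hP⟩ := h
  have hIU : Integrable (fun z => U z * ‖ψ z‖ ^ 2) (stripMeasure S) :=
    (integrable_norm_sq ψ).bdd_mul (c := b) hUm hUb
  have hPW : HasFinitePotentialEnergy (stripMeasure S) (fun z => W z.2) ψ := by
    refine (Integrable.sub hP hIU).congr (Eventually.of_forall fun z => ?_)
    simp only [Pi.sub_apply]
    ring
  have h1 := hcomp ψ v w ⟨hv, hw, hPW⟩ hg
  have h2 := strip_form_lower_bound hS hWm hW0 he hfib ⟨hv, hw, hPW⟩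
  have hPW' : Integrable (fun z => W z.2 * ‖ψ z‖ ^ 2) (stripMeasure S) := hPW
  have h3 : ∫ z, (W z.2 + U z) * ‖ψ z‖ ^ 2 ∂stripMeasure S =
      (∫ z, W z.2 * ‖ψ z‖ ^ 2 ∂stripMeasure S) + ∫ z, U z * ‖ψ z‖ ^ 2 ∂stripMeasure S := by
    rw [← integral_add hPW' hIU]
    congr 1; funext z; ring
  have hηψ : MemLp (fun z : ℝ × ℝ => (η z.1 : ℂ) * ψ z) 2 (stripMeasure S) :=
    memLp_cutoff_mul (Complex.continuous_ofReal.comp hηs.continuous)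
      (hηc.comp_left (g := fun t : ℝ => (t : ℂ)) Complex.ofReal_zero) ψ
  have hIη := (memLp_two_iff_integrable_sq_norm hηψ.1).mp hηψ
  -- For `|x| ≥ R` the potential is at most `ε` in modulus; for smaller `|x|` the cutoff is one and
  -- the bound `b` is used.
  have h4 : -(ε * ‖ψ‖ ^ 2 + b * ∫ z, ‖(η z.1 : ℂ) * ψ z‖ ^ 2 ∂stripMeasure S) ≤
      ∫ z, U z * ‖ψ z‖ ^ 2 ∂stripMeasure S := by
    rw [norm_sq_eq_integral, ← integral_const_mul, ← integral_const_mul,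
      ← integral_add ((integrable_norm_sq ψ).const_mul _) (hIη.const_mul _), ← integral_neg]
    refine integral_mono_ae (((integrable_norm_sq ψ).const_mul _).add (hIη.const_mul _)).neg hIU ?_
    filter_upwards [hUb, hR] with z hz1 hz2
    have hn := sq_nonneg ‖ψ z‖
    by_cases hz : R ≤ |z.1|
    · have e1 := (abs_le.mp (hz2 hz)).1
      have e2 := mul_le_mul_of_nonneg_right e1 hn
      have e3 : 0 ≤ b * ‖(η z.1 : ℂ) * ψ z‖ ^ 2 := by positivity
      linarith
    · rw [hηin z.1 (by linarith [le_abs_self R, not_le.mp hz]), Complex.ofReal_one, one_mul]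
      have e2 := mul_le_mul_of_nonneg_right (abs_le.mp hz1).1 hn
      have e3 : 0 ≤ ε * ‖ψ z‖ ^ 2 := by positivity
      linarith
  rw [h3]
  set q := ‖v‖ ^ 2 + ‖w‖ ^ 2 + ∫ z, W z.2 * ‖ψ z‖ ^ 2 ∂stripMeasure S with hq
  have hn := sq_nonneg ‖ψ‖
  have hbδ : b * δ * (e + 1) ≤ min ε 1 := by
    rw [hδ]
    have : b * (min ε 1 / ((b + 1) * (e + 1))) * (e + 1) = min ε 1 * (b / (b + 1)) := by field_simp
    rw [this]
    exact mul_le_of_le_one_right hmin.le ((div_le_one (by linarith)).mpr (by linarith))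
  have ht0 : 0 ≤ b * δ := by positivity
  have ht1 : b * δ ≤ 1 := by
    have := hbδ.trans (min_le_right _ _)
    nlinarith [mul_nonneg ht0 he]
  have ht2 := mul_le_mul_of_nonneg_right (hbδ.trans (min_le_left _ _)) hn
  have h5 := mul_le_mul_of_nonneg_left h1 hb
  have h6 := mul_le_mul_of_nonneg_left h2 (sub_nonneg.mpr ht1)
  have h7 : m * ‖ψ‖ ^ 2 = e * ‖ψ‖ ^ 2 - 2 * (ε * ‖ψ‖ ^ 2) := by rw [hε]; ring
  rw [h7]
  linarith

end LowerBounds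

/-! ### Product states and their energy -/

section Product

variable {S : Set ℝ} {B p : ℝ} {χ u : TransverseL2 S}

theorem hasDerivAt_slice_fst {φ : ℝ × ℝ → ℝ} (hφ : ContDiff ℝ ∞ φ) (x y : ℝ) :
    HasDerivAt (fun x => φ (x, y)) (fderiv ℝ φ (x, y) (1, 0)) x :=
  ((hφ.differentiable (by simp)) (x, y)).hasFDerivAt.comp_hasDerivAt x
    ((hasDerivAt_id x).prodMk (hasDerivAt_const x y))

theorem hasDerivAt_slice_snd {φ : ℝ × ℝ → ℝ} (hφ : ContDiff ℝ ∞ φ) (x y : ℝ) :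
    HasDerivAt (fun y => φ (x, y)) (fderiv ℝ φ (x, y) (0, 1)) y :=
  ((hφ.differentiable (by simp)) (x, y)).hasFDerivAt.comp_hasDerivAt y
    ((hasDerivAt_const y x).prodMk (hasDerivAt_id y))

theorem hasCompactSupport_slice_snd {φ : ℝ × ℝ → ℝ} (hφ : HasCompactSupport φ) (x : ℝ) :
    HasCompactSupport fun y => φ (x, y) := by
  refine HasCompactSupport.intro (IsCompact.image hφ continuous_snd) fun y hy => ?_
  by_contra h
  exact hy ⟨(x, y), subset_tsupport _ h, rfl⟩

/-- The terms with `By` cancel pointwise. For fixed `y` the rest is the `x`-derivative of a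
compactly supported function times a constant, so its integral vanishes. -/
theorem hasMagneticDeriv_tensor {a : ℝ → ℂ} (ha : ContDiff ℝ ∞ a) (hac : HasCompactSupport a)
    {ψ v : StripL2 S} (hψ : ψ =ᵐ[stripMeasure S] fun z => a z.1 * χ z.2)
    (hv : v =ᵐ[stripMeasure S] fun z => (-Complex.I * deriv a z.1 - B * z.2 * a z.1) * χ z.2) :
    HasMagneticDeriv S B ψ v := by
  intro φ h1 h2
  obtain ⟨c0, s0⟩ := test_ofReal h1.continuous h2
  obtain ⟨c1, s1⟩ := test_fderiv h1 h2 (1, 0)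
  have c2 : Continuous fun z : ℝ × ℝ =>
      Complex.I * ((fderiv ℝ φ z (1, 0) : ℝ) : ℂ) - (B * z.2 * φ z : ℂ) := by fun_prop
  have s2 : HasCompactSupport fun z : ℝ × ℝ =>
      Complex.I * ((fderiv ℝ φ z (1, 0) : ℝ) : ℂ) - (B * z.2 * φ z : ℂ) :=
    (s1.mul_left (f := fun _ => Complex.I)).sub (s0.mul_left (f := fun z : ℝ × ℝ => (B * z.2 : ℂ)))
  have i1 := integrable_test c0 s0 v
  have i2 := integrable_test c2 s2 ψ
  rw [← sub_eq_zero, ← integral_sub i1 i2]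
  have he : (fun z : ℝ × ℝ => (φ z : ℂ) * v z -
      (Complex.I * ((fderiv ℝ φ z (1, 0) : ℝ) : ℂ) - (B * z.2 * φ z : ℂ)) * ψ z)
      =ᵐ[stripMeasure S] fun z => (((fderiv ℝ φ z (1, 0) : ℝ) : ℂ) * a z.1 +
        (φ z : ℂ) * deriv a z.1) * (-Complex.I * χ z.2) := by
    filter_upwards [hψ, hv] with z e1 e2
    rw [e1, e2]
    ring
  have i3 := (i1.sub i2).congr he
  rw [integral_congr_ae he]
  rw [stripMeasure_eq_prod] at i3 ⊢
  rw [integral_prod_symm _ i3]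
  refine integral_eq_zero_of_ae (Eventually.of_forall fun y => ?_)
  simp only [Pi.zero_apply]
  rw [integral_mul_const]
  have hφx : Continuous fun x : ℝ => ((fderiv ℝ φ (x, y) (1, 0) : ℝ) : ℂ) :=
    c1.comp (by fun_prop : Continuous fun x : ℝ => (x, y))
  have hφ0 : Continuous fun x : ℝ => (φ (x, y) : ℂ) :=
    c0.comp (by fun_prop : Continuous fun x : ℝ => (x, y))
  have ha' := ha.continuous_deriv (by simp)
  have hz : ∫ x, (((fderiv ℝ φ (x, y) (1, 0) : ℝ) : ℂ) * a x + (φ (x, y) : ℂ) * deriv a x) = 0 :=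
    integral_eq_zero_of_hasDerivAt_of_integrable (f := fun x => (φ (x, y) : ℂ) * a x)
      (fun x => ((hasDerivAt_slice_fst h1 x y).ofReal_comp).mul
        (ha.differentiable (by simp) x).hasDerivAt)
      (((hφx.mul ha.continuous).integrable_of_hasCompactSupport hac.mul_left).add
        ((hφ0.mul ha').integrable_of_hasCompactSupport hac.deriv.mul_left))
      ((hφ0.mul ha.continuous).integrable_of_hasCompactSupport hac.mul_left)
  rw [hz, zero_mul]

/-- For fixed `x` the slice `φ(x, ·)` is a test function for `χ`. -/
theorem hasTransverseDeriv_tensor (hu : HasDirichletDeriv S χ u) {a : ℝ → ℂ}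
    {ψ w : StripL2 S} (hψ : ψ =ᵐ[stripMeasure S] fun z => a z.1 * χ z.2)
    (hw : w =ᵐ[stripMeasure S] fun z => a z.1 * u z.2) : HasTransverseDeriv S ψ w := by
  intro φ h1 h2
  obtain ⟨c0, s0⟩ := test_ofReal h1.continuous h2
  obtain ⟨c1, s1⟩ := test_fderiv h1 h2 (0, 1)
  have e1 : (fun z => (φ z : ℂ) * w z) =ᵐ[stripMeasure S]
      fun z => a z.1 * ((φ z : ℂ) * u z.2) := by
    filter_upwards [hw] with z hz
    rw [hz]; ring
  have e2 : (fun z => ((fderiv ℝ φ z (0, 1) : ℝ) : ℂ) * ψ z) =ᵐ[stripMeasure S]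
      fun z => a z.1 * (((fderiv ℝ φ z (0, 1) : ℝ) : ℂ) * χ z.2) := by
    filter_upwards [hψ] with z hz
    rw [hz]; ring
  have i1 := (integrable_test c0 s0 w).congr e1
  have i2 := (integrable_test c1 s1 ψ).congr e2
  rw [integral_congr_ae e1, integral_congr_ae e2]
  rw [stripMeasure_eq_prod] at i1 i2 ⊢
  rw [integral_prod _ i1, integral_prod _ i2, ← integral_neg]
  congr 1
  funext x
  simp only
  rw [integral_const_mul, integral_const_mul, ← mul_neg]
  congr 1
  have := hu (fun y => φ (x, y)) (h1.comp (contDiff_const.prodMk contDiff_id))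
    (hasCompactSupport_slice_snd h2 x)
  simpa only [(hasDerivAt_slice_snd h1 x _).deriv] using this

/-- Here `a = e^{ipx} η` and `b = -i e^{ipx} η'`. They are a quarter turn out of phase, so `|t a +
b|²` has no cross term; with `t = p - By` the magnetic energy splits exactly. -/
theorem exists_modulated_cutoff {η : ℝ → ℝ} (hη : ContDiff ℝ ∞ η) (hηc : HasCompactSupport η)
    (p : ℝ) : ∃ a b : ℝ → ℂ, ContDiff ℝ ∞ a ∧ HasCompactSupport a ∧ Continuous b ∧
      HasCompactSupport b ∧ (∀ x, -Complex.I * deriv a x = p * a x + b x) ∧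
      (∀ x, ‖a x‖ ^ 2 = η x ^ 2) ∧
      ∀ x t : ℝ, ‖(t : ℂ) * a x + b x‖ ^ 2 = t ^ 2 * η x ^ 2 + deriv η x ^ 2 := by
  have hη' : ContDiff ℝ ∞ (fun x => (η x : ℂ)) := Complex.ofRealCLM.contDiff.comp hη
  have hηc' : HasCompactSupport fun x => (η x : ℂ) :=
    hηc.comp_left (g := fun t : ℝ => (t : ℂ)) Complex.ofReal_zero
  have hdηc : Continuous fun x => ((deriv η x : ℝ) : ℂ) :=
    Complex.continuous_ofReal.comp (hη.continuous_deriv (by simp))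
  have hdηs : HasCompactSupport fun x => ((deriv η x : ℝ) : ℂ) :=
    hηc.deriv.comp_left (g := fun t : ℝ => (t : ℂ)) Complex.ofReal_zero
  refine ⟨fun x => planeWave p x * (η x : ℂ),
    fun x => -Complex.I * planeWave p x * ((deriv η x : ℝ) : ℂ), (contDiff_planeWave p).mul hη',
    hηc'.mul_left, (continuous_const.mul (continuous_planeWave p)).mul hdηc, hdηs.mul_left,
    fun x => ?_, fun x => ?_, fun x t => ?_⟩
  · have h1 : HasDerivAt (fun x => planeWave p x * (η x : ℂ))
        (p * Complex.I * planeWave p x * (η x : ℂ) + planeWave p x * ((deriv η x : ℝ) : ℂ)) x :=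
      (hasDerivAt_planeWave p x).mul ((hη.differentiable (by simp) x).hasDerivAt.ofReal_comp)
    rw [h1.deriv]
    linear_combination (-(p * planeWave p x * (η x : ℂ))) * Complex.I_mul_I
  · rw [norm_mul, norm_planeWave, one_mul, Complex.norm_real, Real.norm_eq_abs, sq_abs]
  · have : (t : ℂ) * (planeWave p x * (η x : ℂ)) +
        -Complex.I * planeWave p x * ((deriv η x : ℝ) : ℂ) =
        planeWave p x * ((t * η x : ℝ) + (-deriv η x : ℝ) * Complex.I) := by
      push_cast; ring
    rw [this, norm_mul, norm_planeWave, one_mul, ← Complex.normSq_eq_norm_sq,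
      Complex.normSq_add_mul_I]
    ring

theorem norm_sq_of_ae_tensor {f : StripL2 S} {g h : ℝ → ℝ}
    (hf : ∀ᵐ z ∂stripMeasure S, ‖f z‖ ^ 2 = g z.1 * h z.2) :
    ‖f‖ ^ 2 = (∫ x, g x) * ∫ y in S, h y := by
  rw [norm_sq_eq_integral, integral_congr_ae hf, stripMeasure_eq_prod, integral_prod_mul g h]

/-- The product of a modulated cutoff with a transverse state, and its energy. -/
theorem exists_product_state (hS : MeasurableSet S) {W : ℝ → ℝ}
    (hW0 : ∀ y ∈ S, 0 ≤ W y) (hu : HasDirichletDeriv S χ u)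
    (hf : HasFinitePotentialEnergy (volume.restrict S) (fun y => (B * y - p) ^ 2 + W y) χ)
    {η : ℝ → ℝ} (hη : ContDiff ℝ ∞ η) (hηc : HasCompactSupport η) :
    ∃ ψ v w : StripL2 S, (ψ, v, w) ∈ stripFormDomain S B (fun z => W z.2) ∧
      (∀ᵐ z ∂stripMeasure S, ‖ψ z‖ ^ 2 = η z.1 ^ 2 * ‖χ z.2‖ ^ 2) ∧
      ‖ψ‖ ^ 2 = (∫ x, η x ^ 2) * ‖χ‖ ^ 2 ∧
      ‖v‖ ^ 2 + ‖w‖ ^ 2 + ∫ z, W z.2 * ‖ψ z‖ ^ 2 ∂stripMeasure S =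
        (∫ x, η x ^ 2) * (‖u‖ ^ 2 + ∫ y in S, ((B * y - p) ^ 2 + W y) * ‖χ y‖ ^ 2) +
          (∫ x, deriv η x ^ 2) * ‖χ‖ ^ 2 := by
  have hf' : Integrable (fun y => ((B * y - p) ^ 2 + W y) * ‖χ y‖ ^ 2) (volume.restrict S) := hf
  have hχm : AEStronglyMeasurable (fun y => ‖χ y‖ ^ 2) (volume.restrict S) :=
    (integrable_norm_sq χ).1
  -- Only the sum of the two potential terms is known to be integrable; positivity of `W` separates
  -- them.
  have hkin : Integrable (fun y => (B * y - p) ^ 2 * ‖χ y‖ ^ 2) (volume.restrict S) := by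
    refine hf'.mono' ((by fun_prop : Continuous fun y : ℝ =>
      (B * y - p) ^ 2).aestronglyMeasurable.mul hχm) ?_
    filter_upwards [ae_restrict_mem hS] with y hy
    rw [Real.norm_of_nonneg (by positivity)]
    have := mul_nonneg (hW0 y hy) (sq_nonneg ‖χ y‖)
    linarith
  have hpot : Integrable (fun y => W y * ‖χ y‖ ^ 2) (volume.restrict S) := by
    refine (hf'.sub hkin).congr (Eventually.of_forall fun y => ?_)
    simp only [Pi.sub_apply]
    ring
  have hsplit : ∫ y in S, ((B * y - p) ^ 2 + W y) * ‖χ y‖ ^ 2 =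
      (∫ y in S, (B * y - p) ^ 2 * ‖χ y‖ ^ 2) + ∫ y in S, W y * ‖χ y‖ ^ 2 := by
    rw [← integral_add hkin hpot]
    congr 1; funext y; ring
  have hκ : MemLp (fun y => ((p - B * y : ℝ) : ℂ) * χ y) 2 (volume.restrict S) := by
    refine (memLp_two_iff_integrable_sq_norm ((by fun_prop : Continuous fun y : ℝ =>
      ((p - B * y : ℝ) : ℂ)).aestronglyMeasurable.mul (Lp.aestronglyMeasurable χ))).mpr ?_
    refine hkin.congr (Eventually.of_forall fun y => ?_)
    simp only [Pi.mul_apply, norm_mul, Complex.norm_real, mul_pow, Real.norm_eq_abs, sq_abs]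
    ring
  obtain ⟨a, b, has, hac, hbc, hbs, had, hna, hnab⟩ := exists_modulated_cutoff hη hηc p
  have haL : MemLp a 2 volume := has.continuous.memLp_of_hasCompactSupport hac
  have hbL : MemLp b 2 volume := hbc.memLp_of_hasCompactSupport hbs
  obtain ⟨ψ, hψe⟩ : ∃ ψ : StripL2 S, ψ =ᵐ[stripMeasure S] fun z => a z.1 * χ z.2 :=
    ⟨_, (memLp_tensor haL (Lp.memLp χ)).coeFn_toLp⟩
  obtain ⟨v, hve⟩ : ∃ v : StripL2 S, v =ᵐ[stripMeasure S] fun z =>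
      a z.1 * (((p - B * z.2 : ℝ) : ℂ) * χ z.2) + b z.1 * χ z.2 :=
    ⟨_, ((memLp_tensor haL hκ).add (memLp_tensor hbL (Lp.memLp χ))).coeFn_toLp⟩
  obtain ⟨w, hwe⟩ : ∃ w : StripL2 S, w =ᵐ[stripMeasure S] fun z => a z.1 * u z.2 :=
    ⟨_, (memLp_tensor haL (Lp.memLp u)).coeFn_toLp⟩
  have hnψ : ∀ᵐ z ∂stripMeasure S, ‖ψ z‖ ^ 2 = η z.1 ^ 2 * ‖χ z.2‖ ^ 2 := by
    filter_upwards [hψe] with z hz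
    rw [hz, norm_mul, mul_pow, hna]
  have hnw : ∀ᵐ z ∂stripMeasure S, ‖w z‖ ^ 2 = η z.1 ^ 2 * ‖u z.2‖ ^ 2 := by
    filter_upwards [hwe] with z hz
    rw [hz, norm_mul, mul_pow, hna]
  have hnv : ∀ᵐ z ∂stripMeasure S, ‖v z‖ ^ 2 =
      η z.1 ^ 2 * ((B * z.2 - p) ^ 2 * ‖χ z.2‖ ^ 2) + deriv η z.1 ^ 2 * ‖χ z.2‖ ^ 2 := by
    filter_upwards [hve] with z hz
    rw [hz]
    have : a z.1 * (((p - B * z.2 : ℝ) : ℂ) * χ z.2) + b z.1 * χ z.2 =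
        (((p - B * z.2 : ℝ) : ℂ) * a z.1 + b z.1) * χ z.2 := by ring
    rw [this, norm_mul, mul_pow, hnab]
    ring
  have hη'c := hη.continuous_deriv (by simp)
  have hηI : Integrable (fun x => η x ^ 2) volume :=
    (memLp_two_iff_integrable_sq hη.continuous.aestronglyMeasurable).mp
      (hη.continuous.memLp_of_hasCompactSupport hηc)
  have hdηI : Integrable (fun x => deriv η x ^ 2) volume :=
    (memLp_two_iff_integrable_sq hη'c.aestronglyMeasurable).mp
      (hη'c.memLp_of_hasCompactSupport hηc.deriv)
  have iχ := integrable_norm_sq χ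
  have epot : (fun z : ℝ × ℝ => W z.2 * ‖ψ z‖ ^ 2) =ᵐ[stripMeasure S]
      fun z => η z.1 ^ 2 * (W z.2 * ‖χ z.2‖ ^ 2) := by
    filter_upwards [hnψ] with z hz
    rw [hz]; ring
  have ipot : Integrable (fun z : ℝ × ℝ => η z.1 ^ 2 * (W z.2 * ‖χ z.2‖ ^ 2)) (stripMeasure S) := by
    rw [stripMeasure_eq_prod]
    exact hηI.mul_prod hpot
  refine ⟨ψ, v, w, ⟨hasMagneticDeriv_tensor has hac hψe ?_,
    hasTransverseDeriv_tensor hu hψe hwe, ipot.congr epot.symm⟩, hnψ, ?_, ?_⟩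
  · filter_upwards [hve] with z hz
    rw [hz, had]
    push_cast
    ring
  · rw [norm_sq_of_ae_tensor (g := fun x => η x ^ 2) (h := fun y => ‖χ y‖ ^ 2) hnψ,
      ← norm_sq_eq_integral]
  · have e1 : ‖w‖ ^ 2 = (∫ x, η x ^ 2) * ‖u‖ ^ 2 := by
      rw [norm_sq_of_ae_tensor (g := fun x => η x ^ 2) (h := fun y => ‖u y‖ ^ 2) hnw,
        ← norm_sq_eq_integral]
    have e2 : ‖v‖ ^ 2 = (∫ x, η x ^ 2) * (∫ y in S, (B * y - p) ^ 2 * ‖χ y‖ ^ 2)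
        + (∫ x, deriv η x ^ 2) * ‖χ‖ ^ 2 := by
      rw [norm_sq_eq_integral, integral_congr_ae hnv, stripMeasure_eq_prod,
        integral_add (hηI.mul_prod hkin) (hdηI.mul_prod iχ),
        integral_prod_mul (fun x => η x ^ 2) (fun y => (B * y - p) ^ 2 * ‖χ y‖ ^ 2),
        integral_prod_mul (fun x => deriv η x ^ 2) (fun y => ‖χ y‖ ^ 2), ← norm_sq_eq_integral]
    rw [e1, e2, integral_congr_ae epot, stripMeasure_eq_prod,
      integral_prod_mul (fun x => η x ^ 2) (fun y => W y * ‖χ y‖ ^ 2), hsplit]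
    ring

end Product

/-! ### Cut-off integrals of a function with negative integral -/

section NegativeIntegral

/-- Fatou's lemma bounds the negative part from below in the limit, and `η² ≤ 1` bounds the positive
part from above for every `n`. An infinite negative part is thereby included. -/
theorem exists_integral_cutoff_le_neg {f : ℝ → ℝ} (hf : AEMeasurable f volume)
    (hneg : HasNegativeIntegral f) {η : ℕ → ℝ → ℝ} (hη : ∀ n, Continuous (η n))
    (hη0 : ∀ n, ∀ x : ℝ, 0 ≤ η n x) (hη1 : ∀ n x, η n x ≤ 1)
    (hηin : ∀ (n : ℕ) (x : ℝ), |x| ≤ (n : ℝ) + 1 → η n x = 1)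
    (hint : ∀ n, Integrable (fun x => η n x ^ 2 * f x) volume) :
    ∃ δ > 0, ∀ᶠ n in atTop, ∫ x, η n x ^ 2 * f x ≤ -δ := by
  -- A finite `t` strictly between the two parts serves as a stand-in for the possibly infinite
  -- negative part, and `δ` is its distance to the positive part.
  obtain ⟨t, ht1, ht2⟩ := ENNReal.lt_iff_exists_nnreal_btwn.mp hneg
  set P := ∫⁻ x, ENNReal.ofReal (f x) with hP
  have hPt : P.toReal < t := by
    have := (ENNReal.toReal_lt_toReal ht1.ne_top ENNReal.coe_ne_top).mpr ht1
    simpa using this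
  have hm : ∀ n, AEMeasurable (fun x => ENNReal.ofReal (-(η n x ^ 2 * f x))) volume := fun n =>
    ((((hη n).measurable.pow_const 2).aemeasurable.mul hf).neg).ennreal_ofReal
  have hfat : ∫⁻ x, ENNReal.ofReal (-f x) ≤
      liminf (fun n => ∫⁻ x, ENNReal.ofReal (-(η n x ^ 2 * f x))) atTop := by
    refine le_trans (lintegral_mono fun x => ?_) (lintegral_liminf_le' hm)
    refine le_of_eq (Tendsto.liminf_eq (tendsto_const_nhds.congr' ?_)).symm
    filter_upwards [eventually_ge_atTop ⌈|x|⌉₊] with n hn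
    have h1 : |x| ≤ n := (Nat.le_ceil _).trans (by exact_mod_cast hn)
    rw [hηin n x (by linarith), one_pow, one_mul]
  refine ⟨t - P.toReal, by linarith, ?_⟩
  filter_upwards [eventually_lt_of_lt_liminf (ht2.trans_le hfat)] with n hn
  have hpos : ∫⁻ x, ENNReal.ofReal (η n x ^ 2 * f x) ≤ P := by
    refine lintegral_mono fun x => ?_
    have h2 : η n x ^ 2 ≤ 1 := pow_le_one₀ (hη0 n x) (hη1 n x)
    rw [ENNReal.ofReal_mul (sq_nonneg _)]
    exact mul_le_of_le_one_left zero_le (ENNReal.ofReal_le_one.mpr h2)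
  rw [integral_eq_lintegral_pos_part_sub_lintegral_neg_part (hint n)]
  have h3 := ENNReal.toReal_mono ht1.ne_top hpos
  have h4 : (t : ℝ) ≤ (∫⁻ x, ENNReal.ofReal (-(η n x ^ 2 * f x))).toReal := by
    have := ENNReal.toReal_mono (hint n).neg.lintegral_lt_top.ne hn.le
    simpa using this
  linarith

end NegativeIntegral

/-! ### Fubini for the projected potential -/

section ProjectedPotential

variable {S : Set ℝ} {U : ℝ × ℝ → ℝ} {χ : TransverseL2 S} {b : ℝ}

theorem integrable_cutoff_mul_projected (hUm : AEStronglyMeasurable U (stripMeasure S))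
    (hUb : ∀ᵐ z ∂stripMeasure S, |U z| ≤ b) {f : ℝ → ℝ} (hf : Integrable f volume) :
    Integrable (fun z => U z * (f z.1 * ‖χ z.2‖ ^ 2)) (stripMeasure S) := by
  have h : Integrable (fun z : ℝ × ℝ => f z.1 * ‖χ z.2‖ ^ 2) (stripMeasure S) := by
    rw [stripMeasure_eq_prod]
    exact hf.mul_prod (integrable_norm_sq χ)
  exact h.bdd_mul (c := b) hUm hUb

theorem integral_projectedPotential (hUm : AEStronglyMeasurable U (stripMeasure S))
    (hUb : ∀ᵐ z ∂stripMeasure S, |U z| ≤ b) {f : ℝ → ℝ} (hf : Integrable f volume) :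
    Integrable (fun x => f x * projectedPotential S U χ x) volume ∧
      ∫ z, U z * (f z.1 * ‖χ z.2‖ ^ 2) ∂stripMeasure S =
        ∫ x, f x * projectedPotential S U χ x := by
  have h := integrable_cutoff_mul_projected (χ := χ) hUm hUb hf
  rw [stripMeasure_eq_prod] at h ⊢
  have he : ∀ x, ∫ y in S, U (x, y) * (f x * ‖χ y‖ ^ 2) = f x * projectedPotential S U χ x :=
    fun x => by
      rw [projectedPotential, ← integral_const_mul]
      congr 1; funext y; ring
  refine ⟨h.integral_prod_left.congr (Eventually.of_forall he), ?_⟩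
  rw [integral_prod _ h]
  exact integral_congr_ae (Eventually.of_forall he)

theorem aemeasurable_projectedPotential (hUm : AEStronglyMeasurable U (stripMeasure S)) :
    AEMeasurable (projectedPotential S U χ) volume := by
  rw [stripMeasure_eq_prod] at hUm
  exact (hUm.mul ((integrable_norm_sq χ).1.comp_snd)).integral_prod_right'.aemeasurable

end ProjectedPotential

/-! ### The state below the threshold -/

/-- Cut-off products of a ground state of the fibre at the minimum with a plane wave have energy
below the threshold. -/
theorem exists_state_below_threshold {S : Set ℝ} (hS : MeasurableSet S) {W : ℝ → ℝ}
    (hW0 : ∀ y ∈ S, 0 ≤ W y) {U : ℝ × ℝ → ℝ}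
    (hUm : AEStronglyMeasurable U (stripMeasure S)) {b : ℝ}
    (hUb : ∀ᵐ z ∂stripMeasure S, |U z| ≤ b) {B p e : ℝ} {χ u : TransverseL2 S} (hχ : ‖χ‖ = 1)
    (hu : HasDirichletDeriv S χ u)
    (hf : HasFinitePotentialEnergy (volume.restrict S) (fun y => (B * y - p) ^ 2 + W y) χ)
    (he : ‖u‖ ^ 2 + ∫ y in S, ((B * y - p) ^ 2 + W y) * ‖χ y‖ ^ 2 = e)
    (hneg : HasNegativeIntegral (projectedPotential S U χ)) :
    ∃ ψ v w : StripL2 S, (ψ, v, w) ∈ stripFormDomain S B (fun z => W z.2 + U z) ∧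
      ‖v‖ ^ 2 + ‖w‖ ^ 2 + ∫ z, (W z.2 + U z) * ‖ψ z‖ ^ 2 ∂stripMeasure S < e * ‖ψ‖ ^ 2 := by
  obtain ⟨D, hD, hcut⟩ := exists_slow_cutoff
  choose η hηs hηc hη0 hη1 hηin hηout hηd using fun n : ℕ =>
    hcut ((n : ℝ) + 1) (by positivity)
  have hηI : ∀ n, Integrable (fun x => η n x ^ 2) volume := fun n =>
    (memLp_two_iff_integrable_sq (hηs n).continuous.aestronglyMeasurable).mp
      ((hηs n).continuous.memLp_of_hasCompactSupport (hηc n))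
  have hproj := fun n => integral_projectedPotential (χ := χ) hUm hUb (hηI n)
  obtain ⟨δ, hδ, hev⟩ := exists_integral_cutoff_le_neg (aemeasurable_projectedPotential hUm) hneg
    (fun n => (hηs n).continuous) hη0 hη1 hηin (fun n => (hproj n).1)
  -- The slope is at most `D / (n + 1)` on an interval of length `4(n + 1)` and zero elsewhere, so
  -- the cost tends to zero while the gain from `U` stays at least `δ`.
  have hkin : ∀ n : ℕ, ∫ x, deriv (η n) x ^ 2 ≤ 4 * D ^ 2 * (1 / ((n : ℝ) + 1)) := fun n => by
    have hr : (0 : ℝ) < (n : ℝ) + 1 := by positivity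
    have hle : ∀ x, deriv (η n) x ^ 2 ≤
        indicator (Icc (-(2 * ((n : ℝ) + 1))) (2 * ((n : ℝ) + 1)))
          (fun _ => (D / ((n : ℝ) + 1)) ^ 2) x := fun x => by
      by_cases hx : x ∈ Icc (-(2 * ((n : ℝ) + 1))) (2 * ((n : ℝ) + 1))
      · rw [indicator_of_mem hx]
        exact sq_le_sq' (abs_le.mp (hηd n x)).1 (abs_le.mp (hηd n x)).2
      · rw [indicator_of_notMem hx, (hηout n x ?_).2, zero_pow two_ne_zero]
        by_contra hlt
        exact hx (abs_le.mp (not_le.mp hlt).le)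
    have h1 := integral_mono_of_nonneg (μ := volume)
      (Eventually.of_forall fun x => sq_nonneg (deriv (η n) x))
      ((integrable_indicator_iff measurableSet_Icc).mpr
        (integrableOn_const (by simp) (by simp))) (Eventually.of_forall hle)
    refine h1.trans (le_of_eq ?_)
    rw [integral_indicator measurableSet_Icc, setIntegral_const, Measure.real, Real.volume_Icc,
      ENNReal.toReal_ofReal (by linarith), smul_eq_mul]
    field_simp
    ring
  have hlim : Tendsto (fun n : ℕ => 4 * D ^ 2 * (1 / ((n : ℝ) + 1))) atTop (𝓝 0) := by
    have h := (tendsto_one_div_add_atTop_nhds_zero_nat (𝕜 := ℝ)).const_mul (4 * D ^ 2)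
    rwa [mul_zero] at h
  obtain ⟨n, hn1, hn2⟩ := (hev.and (hlim.eventually (gt_mem_nhds hδ))).exists
  obtain ⟨ψ, v, w, ⟨hv, hw, hP⟩, hψ, hnorm, hform⟩ :=
    exists_product_state hS hW0 hu hf (hηs n) (hηc n)
  have heU : (fun z => U z * ‖ψ z‖ ^ 2) =ᵐ[stripMeasure S]
      fun z => U z * (η n z.1 ^ 2 * ‖χ z.2‖ ^ 2) := by
    filter_upwards [hψ] with z hz
    rw [hz]
  have hIU := (integrable_cutoff_mul_projected (χ := χ) hUm hUb (hηI n)).congr heU.symm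
  have hIW : Integrable (fun z => W z.2 * ‖ψ z‖ ^ 2) (stripMeasure S) := hP
  have hadd : (fun z => W z.2 * ‖ψ z‖ ^ 2 + U z * ‖ψ z‖ ^ 2) =
      fun z => (W z.2 + U z) * ‖ψ z‖ ^ 2 := by
    funext z; ring
  refine ⟨ψ, v, w, ⟨hv, hw, ?_⟩, ?_⟩
  · have := hIW.add hIU
    rw [show ((fun z => W z.2 * ‖ψ z‖ ^ 2) + fun z => U z * ‖ψ z‖ ^ 2) = _ from hadd] at this
    exact this
  · rw [← hadd, integral_add hIW hIU, integral_congr_ae heU, (hproj n).2]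
    rw [he, hχ, one_pow, mul_one] at hform
    rw [hχ, one_pow, mul_one] at hnorm
    rw [hnorm]
    have := hkin n
    linarith

end MagneticWire

end

/-! ### Assembly of the threshold, the trial state and the lower bound -/

theorem mainTheorem2
    (S : Set ℝ) (hS : (∃ a : ℝ, 0 < a ∧ S = Set.Ioo (-a) a) ∨ S = Set.univ)
    (W : ℝ → ℝ) (hWmeas : Measurable W)
    (c : ℝ) (hc : 0 ≤ c) (hcS : S = Set.univ → 0 < c) (hW : ∀ y ∈ S, c * y ^ 2 ≤ W y)
    (U : ℝ × ℝ → ℝ) (hU : MemLp U ∞ (MagneticWire.stripMeasure S))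
    (hU0 : ¬ U =ᵐ[MagneticWire.stripMeasure S] 0)
    (hUlim : ∀ ε > 0, ∃ R : ℝ, ∀ᵐ z ∂MagneticWire.stripMeasure S, R ≤ |z.1| → |U z| ≤ ε)
    (B p₀ : ℝ)
    (hp₀ : ∀ p : ℝ,
      MagneticWire.fibreEigenvalue S W B p₀ ≤ MagneticWire.fibreEigenvalue S W B p)
    (χ : MagneticWire.TransverseL2 S) (hχnorm : ‖χ‖ = 1)
    (hχ : χ ∈ MagneticWire.eigenspace (MagneticWire.fibreOperator S W B p₀)
      (MagneticWire.fibreEigenvalue S W B p₀ : ℂ))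
    (hneg : MagneticWire.HasNegativeIntegral (MagneticWire.projectedPotential S U χ)) :
    (MagneticWire.discreteSpectrum (MagneticWire.hamiltonian S W U B)).Nonempty := by
  open MagneticWire in
  open MagneticWire in
  have hSm := measurableSet_section hS
  have hW0 : ∀ y ∈ S, 0 ≤ W y := fun y hy => (by positivity : 0 ≤ c * y ^ 2).trans (hW y hy)
  have hV0 : ∀ p, ∀ y ∈ S, 0 ≤ (B * y - p) ^ 2 + W y := fun p y hy =>
    add_nonneg (sq_nonneg _) (hW0 y hy)
  obtain ⟨b, hb, hUb⟩ : ∃ b : ℝ, 0 ≤ b ∧ ∀ᵐ z ∂stripMeasure S, |U z| ≤ b :=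
    ⟨(eLpNormEssSup U (stripMeasure S)).toReal, ENNReal.toReal_nonneg, by
      filter_upwards [enorm_ae_le_eLpNormEssSup U (stripMeasure S)] with z hz
      have h := ENNReal.toReal_mono (eLpNorm_exponent_top (f := U) ▸ hU.2.ne) hz
      rwa [toReal_enorm, Real.norm_eq_abs] at h⟩
  obtain ⟨u, hu, hf, he⟩ := exists_form_eq_of_mem_eigenspace hχ
  set e := fibreEigenvalue S W B p₀ with hedef
  rw [hχnorm, one_pow, mul_one] at he
  have he0 : 0 ≤ e := by
    rw [← he]
    exact add_nonneg (sq_nonneg _)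
      (setIntegral_nonneg hSm fun y hy => mul_nonneg (hV0 p₀ y hy) (sq_nonneg _))
  have hfib : ∀ (p : ℝ) (φ u : TransverseL2 S), HasDirichletDeriv S φ u →
      HasFinitePotentialEnergy (volume.restrict S) (fun y => (B * y - p) ^ 2 + W y) φ →
      e * ‖φ‖ ^ 2 ≤ ‖u‖ ^ 2 + ∫ y in S, ((B * y - p) ^ 2 + W y) * ‖φ y‖ ^ 2 :=
    fun p φ u h1 h2 => (mul_le_mul_of_nonneg_right (hp₀ p) (sq_nonneg _)).trans
      (lowestEigenvalue_mul_le hSm (by fun_prop) (hV0 p)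
        (fibre_potential_confining hS hcS hW B p) h1 h2)
  obtain ⟨ψ, v, w, hdom, hlt⟩ :=
    exists_state_below_threshold hSm hW0 hU.1 hUb hχnorm hu hf he hneg
  -- If `ψ` were zero, the right side of `hlt` would vanish and its left side would be nonnegative.
  have hψ : 0 < ‖ψ‖ ^ 2 := by
    rcases (sq_nonneg ‖ψ‖).eq_or_lt with h | h
    · rw [← h, mul_zero] at hlt
      have h0 : ψ = 0 := by simpa using h.symm
      have hz : ∫ z, (W z.2 + U z) * ‖ψ z‖ ^ 2 ∂stripMeasure S = 0 := by
        refine integral_eq_zero_of_ae ?_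
        filter_upwards [Lp.coeFn_zero ℂ 2 (stripMeasure S)] with z hz
        rw [h0, hz]
        simp
      rw [hz] at hlt
      linarith [sq_nonneg ‖v‖, sq_nonneg ‖w‖]
    · exact h
  -- The level `m` lies strictly between the Rayleigh quotient of the trial state and the threshold
  -- `e`.
  obtain ⟨m, hm1, hm2⟩ := exists_between ((div_lt_iff₀ hψ).mpr hlt)
  obtain ⟨G, hG, hess⟩ := exists_finite_perturbed_lower_bound hSm hWmeas hW0
    (fibre_potential_confining hS hcS hW B) (fibre_potential_coercive hS hc hcS hW B)
    hU.1 hb hUb hUlim he0 hfib hm2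
  -- Since `W ≥ 0` and `U ≥ -b` almost everywhere, this shift makes the potential at least one.
  refine discreteSpectrum_stripOperator_nonempty (C := b + 1)
    ((hWmeas.comp measurable_snd).aemeasurable.add hU.1.aemeasurable) ?_ G hG hess hdom
    ((div_lt_iff₀ hψ).mp hm1)
  filter_upwards [hUb, ae_restrict_mem (MeasurableSet.univ.prod hSm)] with z hz hzS
  have h1 := hW0 z.2 hzS.2
  have h2 := (abs_le.mp hz).1
  linarith
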